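/- For $s\in\mathbb R$ let $H^s$ be the Hilbert space of divergence-free tempered distributions $u\in\mathcal S'(\mathbb R^2;\mathbb R^2)$ with $\|u\|_{H^s}^2=\int_{\mathbb R^2}(1+|\xi|^2)^{s}|\mathscr F[u](\xi)|^2\,d\xi<\infty$, where $\mathscr F[f](\xi)=(2\pi)^{-1}\int_{\mathbb R^2}e^{-i\xi\cdot x}f(x)\,dx$. The dual of $H^s$ is identified with $H^{-s}$ through $\langle y,u\rangle=\int_{\mathbb R^2}\overline{\mathscr F[y](\xi)}\cdot\mathscr F[u](\xi)\,d\xi$, and $H^s_w$ denotes $H^s$ with its weak topology. Let $A^\alpha u=\mathscr F^{-1}[(1+|\xi|^2)^\alpha\mathscr F[u]]$, let $\Pi$ be the orthogonal projection of $L^2(\mathbb R^2;\mathbb R^2)$ onto its subspace $H^0$ of divergence-free fields, and let $B(u)=\Pi\big((u\cdot\nabla)u\big)$. Let $\nu>0$, $\alpha>1$ and $z\in C(\mathbb R_+;H^{2\alpha})$. Given $x\in H^{2\alpha}$, a function $v\in C(\mathbb R_+;H^{2\alpha})\cap L^2_{loc}(\mathbb R_+;H^{3\alpha})$ is called a solution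 with datum $x$ if, in $H^\alpha$, $$v(t)+\nu\int_0^tA^\alpha v(s)\,ds+\int_0^tB\big(v(s)+z(s)\big)\,ds=x\qquad\text{for all }t\ge 0 .$$ For every $x\in H^{2\alpha}$ there is exactly one solution with datum $x$, denoted $\mathcal V(x,z)$. For every $T>0$ the map $$H^{2\alpha}_w\ni x\longmapsto \mathcal V(x,z)|_{[0,T]}\in C\big([0,T];H^{2\alpha}_w\big),$$ where the target carries the topology of uniform convergence on $[0,T]$, is sequentially continuous. Namely, if $x_n\to x$ weakly in $H^{2\alpha}$, then for every $T>0$ and every $y\in H^{-2\alpha}$ $$\lim_{n\to\infty}\ \sup_{t\in[0,T]}\big|\langle y,\mathcal V(x_n,z)(t)-\mathcal V(x,z)(t)\rangle\big|=0 .$$ -/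

import Mathlib

open MeasureTheory FourierTransform LineDeriv SchwartzMap Filter Topology
open scoped NNReal ENNReal

noncomputable section

namespace HyperNS

/-- The plane `ℝ²` with its Euclidean structure. -/
abbrev Plane : Type := EuclideanSpace ℝ (Fin 2)

/-- Values of (complexified) planar vector fields.  Real vector fields are singled out below by
`IsRealValued`. -/
abbrev CVec : Type := EuclideanSpace ℂ (Fin 2)

/-- Tempered vector-valued distributions on the plane, `𝒮'(ℝ²; ℂ²)`. -/
abbrev Distr : Type := 𝓢'(Plane, CVec)

/-- The Hilbert space `L²(ℝ²; ℂ²)`. -/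
abbrev L2 : Type := Lp CVec 2 (volume : Measure Plane)

/-- The distribution `u` belongs to `𝒮'(ℝ²; ℝ²)`: it is real on real test functions. -/
def IsRealValued (u : Distr) : Prop :=
  ∀ φ : 𝓢(Plane, ℂ), (∀ x, (φ x).im = 0) → ∀ i : Fin 2, (u φ i).im = 0

/-- The distributional divergence `∂₁ u₁ + ∂₂ u₂` of `u` vanishes. -/
def IsDivFree (u : Distr) : Prop :=
  ∀ φ : 𝓢(Plane, ℂ), ∑ i : Fin 2, (∂_{(EuclideanSpace.single i (1 : ℝ) : Plane)} u) φ i = 0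

/-- The weight `(1 + |x|²)^(s/2)` at the angular frequency `x = 2πξ`.  Mathlib's Fourier transform
is `∫ exp(-2πi ξ·y) f(y) dy`; in the variable `x = 2πξ` it becomes, up to the factor `2π`, the
transform `(2π)⁻¹ ∫ exp(-i x·y) f(y) dy`, and `∫ |·|² dx` on the latter side is `∫ |·|² dξ` on the
former. -/
def weight (s : ℝ) (ξ : Plane) : ℝ := (1 + ‖(2 * Real.pi) • ξ‖ ^ 2) ^ (s / 2)

theorem weight_pos (s : ℝ) (ξ : Plane) : 0 < weight s ξ := by
  unfold weight; positivity

theorem weight_mul (s r : ℝ) (ξ : Plane) : weight s ξ * weight r ξ = weight (s + r) ξ := by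
  unfold weight
  rw [← Real.rpow_add (by positivity)]
  ring_nf

@[simp]
theorem weight_zero (ξ : Plane) : weight 0 ξ = 1 := by
  simp [weight]

theorem weight_neg (s : ℝ) (ξ : Plane) : weight s (-ξ) = weight s ξ := by
  simp [weight]

theorem weight_hasTemperateGrowth (s : ℝ) :
    (fun ξ : Plane => (weight s ξ : ℂ)).HasTemperateGrowth := by
  have h1 : (fun ξ : Plane => (1 + ‖ξ‖ ^ 2) ^ (s / 2)).HasTemperateGrowth := by fun_prop
  have h2 : (fun ξ : Plane => (2 * Real.pi) • ξ).HasTemperateGrowth := by fun_prop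
  have h3 : (fun ξ : Plane => weight s ξ).HasTemperateGrowth := h1.comp h2
  fun_prop

/-- The Bessel multiplier on tempered distributions:
`u ↦ 𝓕⁻¹[x ↦ (1 + |x|²)^(s/2) 𝓕[u](x)]`, that is `(1 - Δ)^(s/2)`. -/
def bessel (s : ℝ) : Distr →L[ℂ] Distr :=
  TemperedDistribution.fourierMultiplierCLM CVec (fun ξ => (weight s ξ : ℂ))

/-- The product of the weight of order `s` with the Fourier transform of `u`. -/
def weightedFourier (s : ℝ) (u : Distr) : Distr :=
  TemperedDistribution.smulLeftCLM CVec (fun ξ : Plane => (weight s ξ : ℂ)) (𝓕 u)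

theorem weightedFourier_add (s : ℝ) (u v : Distr) :
    weightedFourier s (u + v) = weightedFourier s u + weightedFourier s v := by
  simp [weightedFourier, FourierTransform.fourier_add]

theorem smulLeft_weight (s r : ℝ) (u : Distr) :
    TemperedDistribution.smulLeftCLM CVec (fun ξ : Plane => (weight s ξ : ℂ))
      (TemperedDistribution.smulLeftCLM CVec (fun ξ : Plane => (weight r ξ : ℂ)) u)
    = TemperedDistribution.smulLeftCLM CVec (fun ξ : Plane => (weight (r + s) ξ : ℂ)) u := by
  rw [TemperedDistribution.smulLeftCLM_smulLeftCLM_apply (weight_hasTemperateGrowth r)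
    (weight_hasTemperateGrowth s)]
  congr 2
  ext ξ
  simp [← weight_mul]

theorem weightedFourier_bessel (s r : ℝ) (u : Distr) :
    weightedFourier s (bessel r u) = weightedFourier (r + s) u := by
  simp only [weightedFourier, bessel, TemperedDistribution.fourierMultiplierCLM_apply,
    fourier_fourierInv_eq, smulLeft_weight]

theorem weightedFourier_smul (s c : ℝ) (u : Distr) :
    weightedFourier s (c • u) = c • weightedFourier s u := by
  have h : ∀ w : Distr, c • w = (c : ℂ) • w := fun w => by
    ext φ i; simp
  simp [weightedFourier, FourierTransform.fourier_smul, h]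

/-- Real-valued divergence-free tempered distributions. -/
def solenoidal : Submodule ℝ Distr where
  carrier := {u | IsRealValued u ∧ IsDivFree u}
  zero_mem' := by
    refine ⟨fun φ _ i => by simp, fun φ => by simp⟩
  add_mem' := by
    rintro u v ⟨hu, hu'⟩ ⟨hv, hv'⟩
    refine ⟨fun φ hφ i => by simp [hu φ hφ i, hv φ hφ i], fun φ => ?_⟩
    have h1 := hu' φ
    have h2 := hv' φ
    simp only [Fin.sum_univ_two, TemperedDistribution.lineDerivOp_apply_apply, _root_.add_apply,
      PiLp.add_apply] at h1 h2 ⊢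
    linear_combination h1 + h2
  smul_mem' := by
    rintro c u ⟨hu, hu'⟩
    refine ⟨fun φ hφ i => by simp [hu φ hφ i], fun φ => ?_⟩
    have h1 := hu' φ
    simp only [Fin.sum_univ_two, TemperedDistribution.lineDerivOp_apply_apply, _root_.smul_apply,
      PiLp.smul_apply] at h1 ⊢
    rw [← smul_add, h1, smul_zero]

theorem isClosed_solenoidal : IsClosed (solenoidal : Set Distr) := by
  have hc : ∀ (φ : 𝓢(Plane, ℂ)) (i : Fin 2), Continuous (fun u : Distr => u φ i) := fun φ i =>
    (EuclideanSpace.proj i : CVec →L[ℂ] ℂ).continuous.comp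
      (PointwiseConvergenceCLM.evalCLM (RingHom.id ℂ) CVec φ).continuous
  have h : (solenoidal : Set Distr) =
      (⋂ φ : 𝓢(Plane, ℂ), ⋂ (_ : ∀ x, (φ x).im = 0), ⋂ i : Fin 2, {u : Distr | (u φ i).im = 0}) ∩
      ⋂ φ : 𝓢(Plane, ℂ), {u : Distr |
        ∑ i : Fin 2, (∂_{(EuclideanSpace.single i (1 : ℝ) : Plane)} u) φ i = 0} := by
    ext u
    simp [solenoidal, IsRealValued, IsDivFree]
  rw [h]
  refine IsClosed.inter ?_ ?_
  · refine isClosed_iInter fun φ => isClosed_iInter fun _ => isClosed_iInter fun i => ?_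
    exact isClosed_eq (Complex.continuous_im.comp (hc φ i)) continuous_const
  · refine isClosed_iInter fun φ => isClosed_eq ?_ continuous_const
    refine continuous_finsetSum _ fun i _ => ?_
    exact hc (-∂_{(EuclideanSpace.single i (1 : ℝ) : Plane)} φ) i

theorem bessel_schwartz_real (s : ℝ) (φ : 𝓢(Plane, ℂ)) (hφ : ∀ x, (φ x).im = 0) (x : Plane) :
    ((𝓕 (SchwartzMap.smulLeftCLM ℂ (fun ξ : Plane => (weight s ξ : ℂ)) (𝓕⁻ φ)) :
      𝓢(Plane, ℂ)) x).im = 0 := by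
  have h1 : ∀ ξ : Plane, (starRingEnd ℂ) ((𝓕⁻ φ : 𝓢(Plane, ℂ)) ξ) = (𝓕⁻ φ : 𝓢(Plane, ℂ)) (-ξ) := by
    intro ξ
    simp only [SchwartzMap.fourierInv_coe, Real.fourierInv_eq', ← integral_conj]
    refine integral_congr_ae (ae_of_all _ fun y => ?_)
    have : (starRingEnd ℂ) (φ y) = φ y := Complex.conj_eq_iff_im.mpr (hφ y)
    simp [this, ← Complex.exp_conj, Complex.conj_ofNat]
  rw [← Complex.conj_eq_iff_im]
  simp only [SchwartzMap.fourier_coe, Real.fourier_eq', ← integral_conj]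
  rw [← integral_neg_eq_self]
  refine integral_congr_ae (ae_of_all _ fun ξ => ?_)
  simp [weight_hasTemperateGrowth, ← Complex.exp_conj, h1, weight_neg, Complex.conj_ofNat]

theorem IsRealValued.bessel {u : Distr} (hu : IsRealValued u) (s : ℝ) :
    IsRealValued (bessel s u) := by
  intro φ hφ i
  exact hu _ (bessel_schwartz_real s φ hφ) i

theorem IsDivFree.bessel {u : Distr} (hu : IsDivFree u) (s : ℝ) : IsDivFree (bessel s u) := by
  have hcomm : ∀ m : Plane, ∂_{m} (HyperNS.bessel s u) = HyperNS.bessel s (∂_{m} u) := by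
    intro m
    have hm : (fun ξ : Plane => ((inner ℝ ξ m : ℝ) : ℂ)).HasTemperateGrowth := by fun_prop
    simp only [TemperedDistribution.lineDeriv_eq_fourierMultiplierCLM, HyperNS.bessel, map_smul]
    rw [TemperedDistribution.fourierMultiplierCLM_fourierMultiplierCLM_apply
      (weight_hasTemperateGrowth s) hm,
      TemperedDistribution.fourierMultiplierCLM_fourierMultiplierCLM_apply
      hm (weight_hasTemperateGrowth s),
      mul_comm (fun ξ : Plane => (weight s ξ : ℂ))]
  intro φ
  simp only [hcomm]
  exact hu _

theorem toDistr_smul (c : ℝ) (f : L2) : ((c • f : L2) : Distr) = c • (f : Distr) := by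
  have h := (Lp.toTemperedDistributionCLM CVec (volume : Measure Plane) 2).map_smul (c : ℂ) f
  have h1 : ((c : ℂ) • f : L2) = c • f := by
    ext1
    filter_upwards [Lp.coeFn_smul (c : ℂ) f, Lp.coeFn_smul c f] with x h2 h3
    rw [h2, h3]; simp
  have h2 : ∀ w : Distr, c • w = (c : ℂ) • w := fun w => by ext φ i; simp
  rw [h2, ← h1]
  exact h

theorem toDistr_zero : ((0 : L2) : Distr) = 0 :=
  (Lp.toTemperedDistributionCLM CVec (volume : Measure Plane) 2).map_zero

theorem toDistr_add (f g : L2) : ((f + g : L2) : Distr) = (f : Distr) + (g : Distr) :=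
  (Lp.toTemperedDistributionCLM CVec (volume : Measure Plane) 2).map_add f g

theorem toDistr_injective : Function.Injective (fun f : L2 => (f : Distr)) :=
  LinearMap.ker_eq_bot.mp
    (Lp.ker_toTemperedDistributionCLM_eq_bot (F := CVec) (μ := (volume : Measure Plane)) (p := 2))

theorem continuous_toDistr : Continuous (fun f : L2 => (f : Distr)) :=
  (Lp.toTemperedDistributionCLM CVec (volume : Measure Plane) 2).continuous

/-- The divergence-free Sobolev space `H^s` as a set of tempered distributions: `u` is real-valued
and divergence-free, and `x ↦ (1 + |x|²)^(s/2) 𝓕[u](x)` is square integrable. -/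
def sobolevSubmodule (s : ℝ) : Submodule ℝ Distr where
  carrier := {u | u ∈ solenoidal ∧ ∃ f : L2, weightedFourier s u = f}
  zero_mem' := ⟨solenoidal.zero_mem, 0, by
    have h : weightedFourier s 0 = 0 := by
      simp [weightedFourier, FourierTransform.fourier_zero]
    exact h.trans toDistr_zero.symm⟩
  add_mem' := by
    rintro u v ⟨hu, f, hf⟩ ⟨hv, g, hg⟩
    exact ⟨solenoidal.add_mem hu hv, f + g, by rw [weightedFourier_add, hf, hg, toDistr_add]⟩
  smul_mem' := by
    rintro c u ⟨hu, f, hf⟩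
    exact ⟨solenoidal.smul_mem c hu, c • f, by rw [weightedFourier_smul, hf, toDistr_smul]⟩

/-- The Hilbert space `H^s` of divergence-free vector fields; its norm is defined below. -/
def Sob (s : ℝ) : Type := sobolevSubmodule s

namespace Sob

variable {s : ℝ}

instance : AddCommGroup (Sob s) := inferInstanceAs (AddCommGroup (sobolevSubmodule s))

instance : Module ℝ (Sob s) := inferInstanceAs (Module ℝ (sobolevSubmodule s))

/-- The underlying tempered distribution. -/
def toDistr : Sob s →ₗ[ℝ] Distr := (sobolevSubmodule s).subtype

instance : CoeOut (Sob s) Distr := ⟨fun u => toDistr u⟩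

/-- The function `x ↦ (1 + |x|²)^(s/2) 𝓕[u](x)` in `L²`. -/
def fourierRep : Sob s →ₗ[ℝ] L2 where
  toFun u := u.2.2.choose
  map_add' u v := by
    refine toDistr_injective ?_
    simp only [toDistr_add]
    rw [← (u + v).2.2.choose_spec, ← u.2.2.choose_spec, ← v.2.2.choose_spec]
    exact weightedFourier_add s _ _
  map_smul' c u := by
    refine toDistr_injective ?_
    simp only [toDistr_smul, RingHom.id_apply]
    rw [← (c • u).2.2.choose_spec, ← u.2.2.choose_spec]
    exact weightedFourier_smul s c _

theorem fourierRep_spec (u : Sob s) : weightedFourier s (u : Distr) = (fourierRep u : L2) :=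
  u.2.2.choose_spec

theorem weightedFourier_injective (s : ℝ) : Function.Injective (weightedFourier s) := by
  intro u v h
  have h1 := congrArg (fun w => 𝓕⁻ (TemperedDistribution.smulLeftCLM CVec
    (fun ξ : Plane => (weight (-s) ξ : ℂ)) w)) h
  simpa [weightedFourier, smulLeft_weight] using h1

theorem fourierRep_injective : Function.Injective (fourierRep : Sob s →ₗ[ℝ] L2) := by
  intro u v h
  apply Subtype.ext
  apply weightedFourier_injective s
  exact (fourierRep_spec u).trans ((congrArg (fun f : L2 => (f : Distr)) h).trans
    (fourierRep_spec v).symm)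

/-- The norm of `H^s`: `‖u‖² = ∫ (1 + |x|²)^s |𝓕[u](x)|² dx`. -/
instance : NormedAddCommGroup (Sob s) :=
  NormedAddCommGroup.induced (Sob s) L2 fourierRep fourierRep_injective

instance : NormedSpace ℝ (Sob s) := NormedSpace.induced ℝ (Sob s) L2 fourierRep

theorem norm_def (u : Sob s) : ‖u‖ = ‖fourierRep u‖ := rfl

instance : CompleteSpace (Sob s) := by
  have hiso : Isometry (fourierRep : Sob s → L2) :=
    AddMonoidHomClass.isometry_of_norm (fourierRep : Sob s →ₗ[ℝ] L2) fun _ => rfl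
  let back : L2 → Distr := fun f => 𝓕⁻ (TemperedDistribution.smulLeftCLM CVec
    (fun ξ : Plane => (weight (-s) ξ : ℂ)) (f : Distr))
  have hback : Continuous back :=
    continuous_fourierInv.comp ((TemperedDistribution.smulLeftCLM CVec _).continuous.comp
      continuous_toDistr)
  have hrange : Set.range (fourierRep : Sob s → L2) = back ⁻¹' (solenoidal : Set Distr) := by
    ext f
    constructor
    · rintro ⟨u, rfl⟩
      have : back (fourierRep u) = (u : Distr) := by
        simp only [back, ← fourierRep_spec]
        simp [weightedFourier, smulLeft_weight]
      rw [Set.mem_preimage, this]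
      exact u.2.1
    · intro hf
      have hw : weightedFourier s (back f) = f := by
        simp [back, weightedFourier, smulLeft_weight]
      refine ⟨⟨back f, hf, f, hw⟩, toDistr_injective ?_⟩
      exact (fourierRep_spec _).symm.trans hw
  exact (completeSpace_iff_isComplete_range hiso.isUniformInducing).mpr
    (hrange ▸ (isClosed_solenoidal.preimage hback).isComplete)

/-- The duality product between `H^{-s}` and `H^s`, `⟨y, u⟩ = ∫ 𝓕[y](x) · 𝓕[u](x) dx`, where the
dot is the Hermitian product (the two weights cancel in the integral). -/
def pairing (y : Sob (-s)) (u : Sob s) : ℝ := (inner ℂ (fourierRep y) (fourierRep u) : ℂ).re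

/-- The power `A^α` of the Stokes operator, `A^α u = 𝓕⁻¹[(1 + |x|²)^α 𝓕[u]]`, as a map from
`H^r` to `H^s` with `r = s + 2α`. -/
def stokesPow (α : ℝ) {r s : ℝ} (h : r = s + 2 * α) : Sob r →ₗ[ℝ] Sob s where
  toFun u := ⟨bessel (2 * α) (u : Distr), ⟨u.2.1.1.bessel _, u.2.1.2.bessel _⟩, fourierRep u, by
    rw [weightedFourier_bessel, ← fourierRep_spec, show 2 * α + s = r by rw [h, add_comm]]⟩
  map_add' u v := Subtype.ext (by
    change bessel (2 * α) (toDistr (u + v)) =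
      bessel (2 * α) (toDistr u) + bessel (2 * α) (toDistr v)
    rw [map_add, map_add])
  map_smul' c u := Subtype.ext (by
    have h : ∀ w : Distr, c • w = (c : ℂ) • w := fun w => by ext φ i; simp
    change bessel (2 * α) (toDistr (c • u)) = c • bessel (2 * α) (toDistr u)
    rw [map_smul, h, map_smul, ← h])

end Sob

/-- The space `H = H⁰` of real divergence-free fields, inside `L²`. -/
def solenoidalL2 : Submodule ℝ L2 where
  carrier := {f | (f : Distr) ∈ solenoidal}
  zero_mem' := by
    simp [toDistr_zero]
  add_mem' := by
    intro f g hf hg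
    simpa [toDistr_add] using solenoidal.add_mem hf hg
  smul_mem' := by
    intro c f hf
    simpa [toDistr_smul] using solenoidal.smul_mem c hf

instance : CompleteSpace solenoidalL2 :=
  (isClosed_solenoidal.preimage continuous_toDistr).isComplete.completeSpace_coe

/-- The Leray projector: the orthogonal projection onto the divergence-free fields in `L²`. -/
def leray : L2 →L[ℝ] L2 := solenoidalL2.starProjection

open Classical in
/-- The square integrable function that represents the distribution `u`, when there is one. -/
def l2Fun (u : Distr) : Plane → CVec := if h : ∃ f : L2, u = (f : Distr) then h.choose else 0

/-- The field `(u · ∇) v = ∑ᵢ uᵢ ∂ᵢ v`, for `u`, `∂₁ v` and `∂₂ v` square integrable. -/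
def convection (u v : Distr) : Plane → CVec := fun x =>
  ∑ i : Fin 2, l2Fun u x i • l2Fun (∂_{(EuclideanSpace.single i (1 : ℝ) : Plane)} v) x

open Classical in
/-- The bilinear map `B(u, v) = Π (u · ∇) v`, for `(u · ∇) v` square integrable.  This is the case
for all `u` and `v` in `H^s` with `s > 1`, where `u` is bounded and `∇v` is square integrable. -/
def bilinB (u v : Distr) : Distr :=
  if h : MemLp (convection u v) 2 (volume : Measure Plane) then (leray h.toLp : Distr) else 0

/-- `v ∈ C(ℝ₊; H^{2α}) ∩ L²_loc(ℝ₊; H^{3α})` solves `v' + ν A^α v + B(v + z) = 0`, `v(0) = x`, in the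
strong sense: `v(t) + ν ∫₀ᵗ A^α v(s) ds + ∫₀ᵗ B(v(s) + z(s)) ds = x` for all `t ≥ 0`, with Bochner
integrals in `H^α`.  Here `w` is `v` as a (class of) `H^{3α}`-valued function, and `b` is
`s ↦ B(v(s) + z(s))` as an `H^α`-valued function. -/
def IsSolution (ν α : ℝ) (z : C(ℝ≥0, Sob (2 * α))) (x : Sob (2 * α))
    (v : C(ℝ≥0, Sob (2 * α))) : Prop :=
  ∃ (w : ℝ → Sob (3 * α)) (b : ℝ → Sob α),
    (∀ T : ℝ, MemLp w 2 (volume.restrict (Set.Icc 0 T))) ∧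
    (∀ᵐ s ∂(volume.restrict (Set.Ici (0 : ℝ))), (w s : Distr) = v s.toNNReal) ∧
    (∀ s : ℝ≥0, (b s : Distr) = bilinB (v s + z s : Sob (2 * α)) (v s + z s : Sob (2 * α))) ∧
    (∀ T : ℝ, IntegrableOn b (Set.Icc 0 T)) ∧
    ∀ t : ℝ≥0,
      (v t : Distr)
        + ((ν • ∫ s in (0 : ℝ)..t, Sob.stokesPow α (show 3 * α = α + 2 * α by ring) (w s) :
            Sob α) : Distr)
        + ((∫ s in (0 : ℝ)..t, b s : Sob α) : Distr)
      = (x : Distr)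

open Classical in
/-- The solution map `(x, z) ↦ 𝒱(x, z)`. -/
def solutionMap (ν α : ℝ) (x : Sob (2 * α)) (z : C(ℝ≥0, Sob (2 * α))) : C(ℝ≥0, Sob (2 * α)) :=
  if h : ∃ v, IsSolution ν α z x v then h.choose else 0

/-- The restriction of `v ∈ C(ℝ₊; H^s)` to `[0, T]`, as an element of `C([0, T]; H^s_w)`, where
`H^s_w` is `H^s` with its weak topology.  The topology of the target is the one of uniform
convergence on `[0, T]` (the compact-open topology). -/
def restrictWeak {s : ℝ} (T : ℝ≥0) (v : C(ℝ≥0, Sob s)) :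
    C(Set.Icc (0 : ℝ≥0) T, WeakSpace ℝ (Sob s)) where
  toFun t := toWeakSpace ℝ (Sob s) (v t)
  continuous_toFun :=
    (toWeakSpaceCLM ℝ (Sob s)).continuous.comp (v.continuous.comp continuous_subtype_val)

end HyperNS

end

/-!
The equation is `v' + ν Λ² v + Λ b(v + z, v + z) = 0` in a Hilbert space, where `Λ = (1 - Δ)^(α/2)`
and `b` is one order better than the convection term.  On the Fourier side `H^{2α}` becomes a closed
subspace of `L²(ℝ²; ℂ²)`, whatever the order, and `Λ` a multiplication operator; it enters through
its inverse `J` and its spectral cutoffs (`FrequencyScale`).  Most of the proof takes place in this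
abstract setting, for a bilinear map `B` with the properties listed in `Nonlinearity`.

*Linear equation.*  The energy estimate bounds a solution by its datum and by the `L²` norm in time of
a forcing one order below.  It holds for the spectral cutoffs, where all operators are bounded, and
passes to the limit; this gives existence, uniqueness, maximal regularity (the `L²` bound in
`H^{3α}`), and continuity for weak convergence even if the forcing converges weakly only.

*Well-posedness.*  Since `α > 1`, `H^α` is an algebra, so that `B` is bounded and Picard iteration
solves the equation with a truncated nonlinearity (`exists_feedback`).  The truncation is removed by an
a priori bound (`exists_bound`).  Because `⟨(u · ∇) v, v⟩ = 0`, the solution is bounded in `L²`, and in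
mean square in `H^α`.  As `‖B(u, v)‖` is bounded by the product of the norm of `u` in `H^α` and that of
`v` in `H^{2α}`, Gronwall's inequality in `H^{2α}` then has an integrable coefficient.

*Weak continuity.*  If the data converge weakly, the solutions are bounded uniformly, and their
difference `w` to the limit solution solves a linear Volterra equation whose coefficients depend on
`n` but are bounded.  Weakly null frequency data give fields that tend to zero pointwise, so `B` maps a
weakly null sequence and a bounded one to a sequence that is weakly null in a larger space.  Thus each
step of the Volterra iteration produces weakly null sequences, while the remainder after `k` steps has
square `O(cᵏ / k!)` uniformly in `n`: no compactness, which fails on the whole plane, is needed.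
Equicontinuity in time against the dense range of `J²` makes the convergence uniform on `[0, T]`
(`eventually_inner_sub_le`).

The remaining lemmas verify the properties of the convection term (`exists_nonlinearity`) and translate
the Bochner-integrated equation in `H^α` to the Fourier side and back (`equation_iff`).
-/

noncomputable section

namespace HyperNS

open Set InnerProductSpace

/-! ### Frequency scales and linear equations with bounded generators -/

section Linear

variable {X : Type*} [NormedAddCommGroup X] [InnerProductSpace ℝ X]

/-- A positive, possibly unbounded, self-adjoint operator `Λ ≥ 1` on `X`, given through its bounded
inverse `J`, its spectral cutoffs `P n` and the bounded operators `Λ n = Λ P n`. -/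
structure FrequencyScale (X : Type*) [NormedAddCommGroup X] [InnerProductSpace ℝ X] where
  /-- The inverse of `Λ`. -/
  J : X →L[ℝ] X
  /-- The truncation of `Λ` to the spectral subspace number `n`. -/
  Λ : ℕ → X →L[ℝ] X
  /-- The projection on the spectral subspace number `n`. -/
  P : ℕ → X →L[ℝ] X
  J_symm : ∀ x y, ⟪J x, y⟫_ℝ = ⟪x, J y⟫_ℝ
  Λ_symm : ∀ n x y, ⟪Λ n x, y⟫_ℝ = ⟪x, Λ n y⟫_ℝ
  J_Λ : ∀ n x, J (Λ n x) = P n x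
  Λ_J : ∀ n x, Λ n (J x) = P n x
  Λ_P : ∀ n m x, n ≤ m → Λ m (P n x) = Λ n x
  P_Λ : ∀ n m x, n ≤ m → P n (Λ m x) = Λ n x
  P_P : ∀ n m x, n ≤ m → P m (P n x) = P n x
  P_tendsto : ∀ x, Tendsto (fun n => P n x) atTop (𝓝 x)
  norm_P_le : ∀ n x, ‖P n x‖ ≤ ‖x‖
  norm_J_le : ∀ x, ‖J x‖ ≤ ‖x‖

namespace FrequencyScale

variable (S : FrequencyScale X)

theorem P_symm (n : ℕ) (x y : X) : ⟪S.P n x, y⟫_ℝ = ⟪x, S.P n y⟫_ℝ := by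
  rw [← S.J_Λ, S.J_symm, S.Λ_symm, S.Λ_J]

theorem J_injective {x : X} (h : S.J x = 0) : x = 0 := by
  refine tendsto_nhds_unique (S.P_tendsto x) ?_
  simp [← S.Λ_J, h]

theorem J_P (n : ℕ) (x : X) : S.J (S.P n x) = S.P n (S.J x) := by
  rw [← S.Λ_J, S.J_Λ, ← S.J_Λ n (S.J x), S.Λ_J]

theorem Λ_P_self (n : ℕ) (x : X) : S.Λ n (S.P n x) = S.Λ n x := S.Λ_P n n x le_rfl

theorem P_Λ_self (n : ℕ) (x : X) : S.P n (S.Λ n x) = S.Λ n x := S.P_Λ n n x le_rfl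

end FrequencyScale

/-- Energy inequality for `D' + ν Λ² D + Λ g = 0` with a bounded symmetric operator `Λ`: pairing the
equation with `D` and absorbing half of the dissipation. -/
theorem energy_le {ν : ℝ} (hν : 0 < ν) {Λ : X →L[ℝ] X} (hΛ : ∀ x y, ⟪Λ x, y⟫_ℝ = ⟪x, Λ y⟫_ℝ)
    [CompleteSpace X] {D g : ℝ → X} (hD : Continuous D) (hg : Continuous g) {D0 : X} {T : ℝ}
    (h : ∀ t ∈ Icc 0 T, D t = D0 - ∫ s in (0 : ℝ)..t, (ν • Λ (Λ (D s)) + Λ (g s))) :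
    ∀ t ∈ Icc 0 T, ‖D t‖ ^ 2 + ν * ∫ s in (0 : ℝ)..t, ‖Λ (D s)‖ ^ 2
      ≤ ‖D0‖ ^ 2 + ν⁻¹ * ∫ s in (0 : ℝ)..t, ‖g s‖ ^ 2 := by
  set E : ℝ → X := fun t => D0 - ∫ s in (0 : ℝ)..t, (ν • Λ (Λ (D s)) + Λ (g s)) with hE
  have hc : Continuous fun s => ν • Λ (Λ (D s)) + Λ (g s) := by fun_prop
  have hEd : ∀ t, HasDerivAt E (-(ν • Λ (Λ (D t)) + Λ (g t))) t := fun t =>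
    (hc.integral_hasStrictDerivAt 0 t).hasDerivAt.const_sub D0
  have hc1 : Continuous fun s => ‖Λ (D s)‖ ^ 2 := by fun_prop
  have hc2 : Continuous fun s => ‖g s‖ ^ 2 := by fun_prop
  set F : ℝ → ℝ := fun t => ‖E t‖ ^ 2 + ν * (∫ s in (0 : ℝ)..t, ‖Λ (D s)‖ ^ 2)
    - ν⁻¹ * ∫ s in (0 : ℝ)..t, ‖g s‖ ^ 2 with hF
  have hFd : ∀ t, HasDerivAt F (2 * ⟪E t, -(ν • Λ (Λ (D t)) + Λ (g t))⟫_ℝ + ν * ‖Λ (D t)‖ ^ 2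
      - ν⁻¹ * ‖g t‖ ^ 2) t := fun t =>
    (((hEd t).norm_sq).add ((hc1.integral_hasStrictDerivAt 0 t).hasDerivAt.const_mul ν)).sub
      ((hc2.integral_hasStrictDerivAt 0 t).hasDerivAt.const_mul ν⁻¹)
  intro t ht
  have hanti : AntitoneOn F (Icc 0 T) := by
    refine antitoneOn_of_deriv_nonpos (convex_Icc 0 T)
      (fun s _ => (hFd s).continuousAt.continuousWithinAt)
      (fun s _ => (hFd s).differentiableAt.differentiableWithinAt) fun s hs => ?_
    rw [interior_Icc] at hs
    rw [(hFd s).deriv, hE]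
    simp only
    rw [← h s ⟨hs.1.le, hs.2.le⟩, inner_neg_right, inner_add_right, inner_smul_right,
      ← hΛ (D s) (Λ (D s)), ← hΛ (D s) (g s), real_inner_self_eq_norm_sq]
    have h1 := neg_le_of_abs_le (abs_real_inner_le_norm (Λ (D s)) (g s))
    have h2 : 0 ≤ ν * (‖Λ (D s)‖ - ν⁻¹ * ‖g s‖) ^ 2 := by positivity
    have h3 : ν * (‖Λ (D s)‖ - ν⁻¹ * ‖g s‖) ^ 2
        = ν * ‖Λ (D s)‖ ^ 2 - 2 * (‖Λ (D s)‖ * ‖g s‖) + ν⁻¹ * ‖g s‖ ^ 2 := by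
      field_simp; ring
    nlinarith
  have h0 := hanti ⟨le_rfl, ht.1.trans ht.2⟩ ht ht.1
  simp only [hF, hE, intervalIntegral.integral_same, mul_zero, sub_zero, add_zero] at h0
  rw [← h t ht] at h0
  linarith

/-- Gronwall's inequality in integral form with a continuous coefficient. -/
theorem gronwall_integral {φ a : ℝ → ℝ} (hφ : Continuous φ) (ha : Continuous a) (ha0 : ∀ t, 0 ≤ a t)
    {c T : ℝ} (h : ∀ t ∈ Icc 0 T, φ t ≤ c + ∫ s in (0 : ℝ)..t, a s * φ s) :
    ∀ t ∈ Icc 0 T, φ t ≤ c * Real.exp (∫ s in (0 : ℝ)..t, a s) := by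
  have hc : Continuous fun s => a s * φ s := by fun_prop
  have h1 : ∀ t, HasDerivAt (fun t => c + ∫ s in (0 : ℝ)..t, a s * φ s) (a t * φ t) t := fun t =>
    (hc.integral_hasStrictDerivAt 0 t).hasDerivAt.const_add c
  have h2 : ∀ t, HasDerivAt (fun t => Real.exp (-∫ s in (0 : ℝ)..t, a s))
      (Real.exp (-∫ s in (0 : ℝ)..t, a s) * -a t) t := fun t =>
    (ha.integral_hasStrictDerivAt 0 t).hasDerivAt.neg.exp
  have hanti : AntitoneOn (fun t => (c + ∫ s in (0 : ℝ)..t, a s * φ s) *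
      Real.exp (-∫ s in (0 : ℝ)..t, a s)) (Icc 0 T) := by
    refine antitoneOn_of_deriv_nonpos (convex_Icc 0 T)
      (fun s _ => ((h1 s).mul (h2 s)).continuousAt.continuousWithinAt)
      (fun s _ => ((h1 s).mul (h2 s)).differentiableAt.differentiableWithinAt) fun s hs => ?_
    rw [interior_Icc] at hs
    have h5 := ((h1 s).mul (h2 s)).deriv
    simp only [Pi.mul_def] at h5
    rw [h5]
    have h3 := h s ⟨hs.1.le, hs.2.le⟩
    have h4 := mul_nonneg (mul_nonneg (ha0 s) (Real.exp_nonneg (-∫ r in (0 : ℝ)..s, a r)))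
      (sub_nonneg.2 h3)
    nlinarith
  intro t ht
  have h0 := hanti ⟨le_rfl, ht.1.trans ht.2⟩ ht ht.1
  simp only [intervalIntegral.integral_same, neg_zero, Real.exp_zero, add_zero, mul_one] at h0
  rw [Real.exp_neg, ← div_eq_mul_inv, div_le_iff₀ (Real.exp_pos _)] at h0
  exact (h t ht).trans h0

/-- The solution of the linear equation `u' + G u + g = 0`, `u(0) = u₀` with bounded `G`, by variation
of constants. -/
def expSol (G : X →L[ℝ] X) (g : ℝ → X) (u0 : X) (t : ℝ) : X :=
  NormedSpace.exp (t • -G) (u0 - ∫ s in (0 : ℝ)..t, NormedSpace.exp (s • G) (g s))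

variable [CompleteSpace X]

theorem continuous_exp_smul (G : X →L[ℝ] X) : Continuous fun t : ℝ => NormedSpace.exp (t • G) :=
  continuous_iff_continuousAt.2 fun t => (hasDerivAt_exp_smul_const (𝕂 := ℝ) G t).continuousAt

theorem hasDerivAt_expSol (G : X →L[ℝ] X) {g : ℝ → X} (hg : Continuous g) (u0 : X) (t : ℝ) :
    HasDerivAt (expSol G g u0) (-(G (expSol G g u0 t) + g t)) t := by
  have hc : Continuous fun s => NormedSpace.exp (s • G) (g s) :=
    (continuous_exp_smul G).clm_apply hg
  have h1 : HasDerivAt (fun t => u0 - ∫ s in (0 : ℝ)..t, NormedSpace.exp (s • G) (g s))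
      (-(NormedSpace.exp (t • G) (g t))) t :=
    (hc.integral_hasStrictDerivAt 0 t).hasDerivAt.const_sub u0
  have h2 := (hasDerivAt_exp_smul_const' (𝕂 := ℝ) (-G) t).clm_apply h1
  refine h2.congr_deriv ?_
  have h3 : NormedSpace.exp (t • -G) * NormedSpace.exp (t • G) = 1 := by
    let : NormedAlgebra ℚ (X →L[ℝ] X) := NormedAlgebra.restrictScalars ℚ ℝ _
    rw [← NormedSpace.exp_add_of_commute (((Commute.refl G).neg_left.smul_left t).smul_right t)]
    simp
  have h4 := congrArg (fun L : X →L[ℝ] X => L (g t)) h3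
  simp only [mul_apply_eq_comp, one_apply_eq_self] at h4
  simp only [mul_apply_eq_comp, map_neg, h4, expSol, neg_apply]
  abel

theorem expSol_eq (G : X →L[ℝ] X) {g : ℝ → X} (hg : Continuous g) (u0 : X) (t : ℝ) :
    expSol G g u0 t = u0 - ∫ s in (0 : ℝ)..t, (G (expSol G g u0 s) + g s) := by
  have hu : Continuous (expSol G g u0) :=
    continuous_iff_continuousAt.2 fun t => (hasDerivAt_expSol G hg u0 t).continuousAt
  have hc : Continuous fun s => -(G (expSol G g u0 s) + g s) := by fun_prop
  have h := intervalIntegral.integral_eq_sub_of_hasDerivAt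
    (fun s (_ : s ∈ uIcc 0 t) => hasDerivAt_expSol G hg u0 s) (hc.intervalIntegrable _ _)
  rw [intervalIntegral.integral_neg] at h
  have h0 : expSol G g u0 0 = u0 := by simp [expSol]
  rw [h0] at h
  rw [sub_eq_add_neg, h]; abel

theorem continuous_expSol (G : X →L[ℝ] X) {g : ℝ → X} (hg : Continuous g) (u0 : X) :
    Continuous (expSol G g u0) :=
  continuous_iff_continuousAt.2 fun t => (hasDerivAt_expSol G hg u0 t).continuousAt

theorem map_expSol {G P : X →L[ℝ] X} (hPG : Commute P G) {g : ℝ → X} (hg : Continuous g) {u0 : X}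
    (hu0 : P u0 = u0) (hPg : ∀ s, P (g s) = g s) (t : ℝ) :
    P (expSol G g u0 t) = expSol G g u0 t := by
  have hc : Continuous fun s => NormedSpace.exp (s • G) (g s) :=
    (continuous_exp_smul G).clm_apply hg
  have h1 : ∀ (t : ℝ) (x : X), P (NormedSpace.exp (t • G) x) = NormedSpace.exp (t • G) (P x) :=
    fun t x => congrArg (fun L : X →L[ℝ] X => L x) ((hPG.smul_right t).exp_right)
  have h2 : ∀ (t : ℝ) (x : X), P (NormedSpace.exp (t • -G) x) = NormedSpace.exp (t • -G) (P x) :=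
    fun t x => congrArg (fun L : X →L[ℝ] X => L x) ((hPG.neg_right.smul_right t).exp_right)
  simp only [expSol, h2, map_sub, hu0]
  rw [← ContinuousLinearMap.intervalIntegral_comp_comm _ (hc.intervalIntegrable _ _)]
  simp only [h1, hPg]

end Linear

/-! ### The linear equation and its energy estimates -/

section Linear

variable {X : Type*} [NormedAddCommGroup X] [InnerProductSpace ℝ X] [CompleteSpace X]

theorem integral_mono_of_continuous {f g : ℝ → ℝ} (hf : Continuous f) (hg : Continuous g) {t : ℝ}
    (ht : 0 ≤ t) (h : ∀ s ∈ Icc 0 t, f s ≤ g s) :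
    ∫ s in (0 : ℝ)..t, f s ≤ ∫ s in (0 : ℝ)..t, g s :=
  intervalIntegral.integral_mono_on ht (hf.intervalIntegrable _ _) (hg.intervalIntegrable _ _) h

namespace FrequencyScale

variable (S : FrequencyScale X)

/-- The linear equation `u' + ν Λ² u + Λ f = 0`, `u(0) = u₀` on `[0, T]`, integrated in time and
multiplied by `J² = Λ⁻²`. -/
def IsLinearSolution (ν T : ℝ) (U f : ℝ → X) (U0 : X) : Prop :=
  ∀ t ∈ Icc 0 T, S.J (S.J (U t)) + ν • (∫ s in (0 : ℝ)..t, U s) + ∫ s in (0 : ℝ)..t, S.J (f s)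
    = S.J (S.J U0)

variable {S} {ν T : ℝ} {U f : ℝ → X} {U0 : X}

theorem IsLinearSolution.mono {T' : ℝ} (h : S.IsLinearSolution ν T U f U0) (hT : T' ≤ T) :
    S.IsLinearSolution ν T' U f U0 := fun t ht => h t ⟨ht.1, ht.2.trans hT⟩

theorem IsLinearSolution.congr {U' f' : ℝ → X} (h : S.IsLinearSolution ν T U f U0)
    (hU : ∀ t ∈ Icc 0 T, U' t = U t) (hf : ∀ t ∈ Icc 0 T, f' t = f t) :
    S.IsLinearSolution ν T U' f' U0 := by
  intro t ht
  have hm : ∀ s ∈ uIcc 0 t, s ∈ Icc 0 T := fun s hs => by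
    rw [uIcc_of_le ht.1] at hs; exact ⟨hs.1, hs.2.trans ht.2⟩
  have h1 : ∫ s in (0 : ℝ)..t, S.J (f' s) = ∫ s in (0 : ℝ)..t, S.J (f s) :=
    intervalIntegral.integral_congr fun s hs => by simp only [hf s (hm s hs)]
  rw [hU t ht, intervalIntegral.integral_congr (fun s hs => hU s (hm s hs)), h1]
  exact h t ht

theorem IsLinearSolution.sub {U' f' : ℝ → X} {U0' : X} (h : S.IsLinearSolution ν T U f U0)
    (h' : S.IsLinearSolution ν T U' f' U0') (hU : Continuous U) (hf : Continuous f)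
    (hU' : Continuous U') (hf' : Continuous f') :
    S.IsLinearSolution ν T (fun t => U t - U' t) (fun t => f t - f' t) (U0 - U0') := by
  intro t ht
  have h1 := h t ht
  have h2 := h' t ht
  have c1 : Continuous fun s => S.J (f s) := by fun_prop
  have c2 : Continuous fun s => S.J (f' s) := by fun_prop
  simp only [map_sub]
  rw [intervalIntegral.integral_sub (hU.intervalIntegrable _ _) (hU'.intervalIntegrable _ _),
    intervalIntegral.integral_sub (c1.intervalIntegrable _ _) (c2.intervalIntegrable _ _), ← h1,
    ← h2, smul_sub]
  abel

/-- The spectral cutoffs of a solution solve a linear equation with bounded operators. -/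
theorem IsLinearSolution.cutoff (h : S.IsLinearSolution ν T U f U0) (hU : Continuous U)
    (hf : Continuous f) (n : ℕ) : ∀ t ∈ Icc 0 T, S.P n (U t) = S.P n U0
      - ∫ s in (0 : ℝ)..t, (ν • S.Λ n (S.Λ n (S.P n (U s))) + S.Λ n (f s)) := by
  intro t ht
  have h1 := congrArg (fun x => S.Λ n (S.Λ n x)) (h t ht)
  have h2 : ∀ x, S.Λ n (S.Λ n (S.J (S.J x))) = S.P n x := fun x => by
    rw [S.Λ_J, S.Λ_P_self, S.Λ_J]
  have h3 : ∀ x, S.Λ n (S.Λ n (S.J x)) = S.Λ n x := fun x => by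
    rw [S.Λ_J, S.Λ_P_self]
  have c0 : Continuous fun s => S.J (f s) := by fun_prop
  have c1 : Continuous fun s => ν • S.Λ n (S.Λ n (U s)) := by fun_prop
  have c2 : Continuous fun s => S.Λ n (f s) := by fun_prop
  have c3 : Continuous fun s => S.Λ n (S.J (f s)) := by fun_prop
  have c4 : Continuous fun s => S.Λ n (U s) := by fun_prop
  simp only [map_add, h2, map_smul] at h1
  simp only [S.Λ_P_self]
  rw [intervalIntegral.integral_add (c1.intervalIntegrable _ _) (c2.intervalIntegrable _ _),
    intervalIntegral.integral_smul, ← h1,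
    ← ContinuousLinearMap.intervalIntegral_comp_comm _ (hU.intervalIntegrable _ _),
    ← ContinuousLinearMap.intervalIntegral_comp_comm _ (c4.intervalIntegrable _ _),
    ← ContinuousLinearMap.intervalIntegral_comp_comm _ (c0.intervalIntegrable _ _),
    ← ContinuousLinearMap.intervalIntegral_comp_comm _ (c3.intervalIntegrable _ _)]
  simp only [h3]
  abel

theorem IsLinearSolution.energy_cutoff (hν : 0 < ν) (h : S.IsLinearSolution ν T U f U0)
    (hU : Continuous U) (hf : Continuous f) (n : ℕ) : ∀ t ∈ Icc 0 T,
      ‖S.P n (U t)‖ ^ 2 + ν * ∫ s in (0 : ℝ)..t, ‖S.Λ n (U s)‖ ^ 2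
      ≤ ‖U0‖ ^ 2 + ν⁻¹ * ∫ s in (0 : ℝ)..t, ‖f s‖ ^ 2 := by
  intro t ht
  have h1 := energy_le hν (S.Λ_symm n) (D := fun t => S.P n (U t)) (g := f) (by fun_prop) hf
    (h.cutoff hU hf n) t ht
  simp only [S.Λ_P_self] at h1
  have h2 := S.norm_P_le n U0
  have h3 : ‖S.P n U0‖ ^ 2 ≤ ‖U0‖ ^ 2 := by gcongr
  linarith

theorem IsLinearSolution.norm_sq_le (hν : 0 < ν) (h : S.IsLinearSolution ν T U f U0)
    (hU : Continuous U) (hf : Continuous f) : ∀ t ∈ Icc 0 T,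
      ‖U t‖ ^ 2 ≤ ‖U0‖ ^ 2 + ν⁻¹ * ∫ s in (0 : ℝ)..t, ‖f s‖ ^ 2 := by
  intro t ht
  refine le_of_tendsto (((S.P_tendsto (U t)).norm).pow 2) (Eventually.of_forall fun n => ?_)
  refine le_trans (le_add_of_nonneg_right (mul_nonneg hν.le ?_)) (h.energy_cutoff hν hU hf n t ht)
  exact intervalIntegral.integral_nonneg ht.1 fun s _ => by positivity

theorem IsLinearSolution.unique {U' : ℝ → X} (hν : 0 < ν) (h : S.IsLinearSolution ν T U f U0)
    (h' : S.IsLinearSolution ν T U' f U0) (hU : Continuous U) (hU' : Continuous U')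
    (hf : Continuous f) : ∀ t ∈ Icc 0 T, U t = U' t := by
  intro t ht
  have h1 := (h.sub h' hU hf hU' hf).norm_sq_le hν (by fun_prop) (by fun_prop) t ht
  simp only [sub_self, norm_zero, ne_eq, OfNat.ofNat_ne_zero, not_false_eq_true, zero_pow,
    intervalIntegral.integral_zero, mul_zero, add_zero] at h1
  have h2 : ‖U t - U' t‖ = 0 := by nlinarith [norm_nonneg (U t - U' t)]
  exact sub_eq_zero.1 (norm_eq_zero.1 h2)

/-- The energy identity in the norm of `J² u`, two orders below the space of the solution. -/
theorem IsLinearSolution.low_energy (h : S.IsLinearSolution ν T U f U0) (hU : Continuous U)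
    (hf : Continuous f) : ∀ t ∈ Icc 0 T,
      ‖S.J (S.J (U t))‖ ^ 2 + 2 * ν * ∫ s in (0 : ℝ)..t, ‖S.J (U s)‖ ^ 2
      = ‖S.J (S.J U0)‖ ^ 2 - 2 * ∫ s in (0 : ℝ)..t, ⟪S.J (f s), S.J (S.J (U s))⟫_ℝ := by
  set E : ℝ → X := fun t => S.J (S.J U0) - ν • (∫ s in (0 : ℝ)..t, U s)
    - ∫ s in (0 : ℝ)..t, S.J (f s) with hE
  have hJf : Continuous fun s => S.J (f s) := by fun_prop
  have hEd : ∀ t, HasDerivAt E (-(ν • U t) - S.J (f t)) t := fun t =>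
    (((hU.integral_hasStrictDerivAt 0 t).hasDerivAt.const_smul ν).const_sub
      (S.J (S.J U0))).sub (hJf.integral_hasStrictDerivAt 0 t).hasDerivAt
  have hEc : Continuous E := continuous_iff_continuousAt.2 fun t => (hEd t).continuousAt
  intro t ht
  have hEU : ∀ s ∈ Icc 0 T, E s = S.J (S.J (U s)) := fun s hs => by
    rw [hE]; simp only; rw [← h s hs]; abel
  have hd : Continuous fun s => 2 * ⟪E s, -(ν • U s) - S.J (f s)⟫_ℝ := by fun_prop
  have h1 := intervalIntegral.integral_eq_sub_of_hasDerivAt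
    (fun s (_ : s ∈ uIcc 0 t) => (hEd s).norm_sq) (hd.intervalIntegrable _ _)
  have h2 : E 0 = S.J (S.J U0) := by simp [hE]
  rw [h2, hEU t ht] at h1
  have h3 : ∫ s in (0 : ℝ)..t, 2 * ⟪E s, -(ν • U s) - S.J (f s)⟫_ℝ
      = ∫ s in (0 : ℝ)..t, (-(2 * ν) * ‖S.J (U s)‖ ^ 2 - 2 * ⟪S.J (f s), S.J (S.J (U s))⟫_ℝ) := by
    refine intervalIntegral.integral_congr fun s hs => ?_
    rw [uIcc_of_le ht.1] at hs
    simp only [hEU s ⟨hs.1, hs.2.trans ht.2⟩]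
    rw [inner_sub_right, inner_neg_right, inner_smul_right, S.J_symm (S.J (U s)) (U s),
      real_inner_self_eq_norm_sq, real_inner_comm (S.J (f s))]
    ring
  have c1 : Continuous fun s => -(2 * ν) * ‖S.J (U s)‖ ^ 2 := by fun_prop
  have c2 : Continuous fun s => 2 * ⟪S.J (f s), S.J (S.J (U s))⟫_ℝ := by fun_prop
  rw [h3, intervalIntegral.integral_sub (c1.intervalIntegrable _ _) (c2.intervalIntegrable _ _),
    intervalIntegral.integral_const_mul, intervalIntegral.integral_const_mul] at h1
  linarith

end FrequencyScale
end Linear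

/-! ### Existence and maximal regularity for the linear equation -/

section Linear

variable {X : Type*} [NormedAddCommGroup X] [InnerProductSpace ℝ X] [CompleteSpace X]

theorem memLp_restrict_Icc {f : ℝ → X} (hf : Continuous f) (T : ℝ) :
    MemLp f 2 (volume.restrict (Icc 0 T)) := by
  obtain ⟨C, hC⟩ := isCompact_Icc.exists_bound_of_continuousOn (hf.continuousOn (s := Icc 0 T))
  exact MemLp.of_bound hf.aestronglyMeasurable C
    ((ae_restrict_iff' measurableSet_Icc).2 (ae_of_all _ hC))

namespace FrequencyScale

variable (S : FrequencyScale X) {ν T : ℝ} {U f : ℝ → X} {U0 : X}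

/-- The approximate solution, with data and generator cut off to the spectral subspace number `n`. -/
def approx (ν : ℝ) (f : ℝ → X) (U0 : X) (n : ℕ) : ℝ → X :=
  expSol (ν • (S.Λ n ∘L S.Λ n)) (fun s => S.Λ n (f s)) (S.P n U0)

variable {S} in
theorem continuous_approx (hf : Continuous f) (n : ℕ) : Continuous (S.approx ν f U0 n) :=
  continuous_expSol _ (by fun_prop) _

variable {S} in
theorem P_approx (hf : Continuous f) (n : ℕ) (t : ℝ) :
    S.P n (S.approx ν f U0 n t) = S.approx ν f U0 n t := by
  refine map_expSol ?_ (by fun_prop) (S.P_P n n _ le_rfl) (fun s => S.P_Λ_self n _) t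
  refine Commute.smul_right (ContinuousLinearMap.ext fun x => ?_) ν
  simp [mul_apply_eq_comp, S.P_Λ_self, S.Λ_P_self]

variable {S} in
theorem approx_eq (hf : Continuous f) (n : ℕ) (t : ℝ) : S.approx ν f U0 n t = S.P n U0
    - ∫ s in (0 : ℝ)..t, (ν • S.Λ n (S.Λ n (S.approx ν f U0 n s)) + S.Λ n (f s)) :=
  expSol_eq _ (by fun_prop) _ t

variable {S} in
/-- The cutoffs of a solution are the approximate solutions. -/
theorem IsLinearSolution.P_eq_approx (hν : 0 < ν) (h : S.IsLinearSolution ν T U f U0)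
    (hU : Continuous U) (hf : Continuous f) (n : ℕ) :
    ∀ t ∈ Icc 0 T, S.P n (U t) = S.approx ν f U0 n t := by
  intro t ht
  have ha := continuous_approx (S := S) (ν := ν) (U0 := U0) hf n
  have h1 := energy_le hν (S.Λ_symm n) (D := fun t => S.P n (U t) - S.approx ν f U0 n t)
    (g := fun _ => 0) (D0 := 0) (T := T) (by fun_prop) continuous_const (fun t ht => ?_) t ht
  · simp only [norm_zero, ne_eq, OfNat.ofNat_ne_zero, not_false_eq_true, zero_pow,
      intervalIntegral.integral_zero, mul_zero, add_zero] at h1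
    have h3 : 0 ≤ ∫ s in (0 : ℝ)..t, ‖S.Λ n (S.P n (U s) - S.approx ν f U0 n s)‖ ^ 2 :=
      intervalIntegral.integral_nonneg ht.1 fun s _ => by positivity
    have h4 := mul_nonneg hν.le h3
    have h2 : ‖S.P n (U t) - S.approx ν f U0 n t‖ = 0 := by
      nlinarith [norm_nonneg (S.P n (U t) - S.approx ν f U0 n t)]
    exact sub_eq_zero.1 (norm_eq_zero.1 h2)
  · have c1 : Continuous fun s => ν • S.Λ n (S.Λ n (S.P n (U s))) + S.Λ n (f s) := by fun_prop
    have c2 : Continuous fun s => ν • S.Λ n (S.Λ n (S.approx ν f U0 n s)) + S.Λ n (f s) := by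
      fun_prop
    have h5 : ∀ s, ν • S.Λ n (S.Λ n (S.P n (U s) - S.approx ν f U0 n s)) + S.Λ n 0
        = (ν • S.Λ n (S.Λ n (S.P n (U s))) + S.Λ n (f s))
          - (ν • S.Λ n (S.Λ n (S.approx ν f U0 n s)) + S.Λ n (f s)) := fun s => by
      simp only [map_sub, map_zero, smul_sub]; abel
    simp only [h5]
    rw [intervalIntegral.integral_sub (c1.intervalIntegrable _ _) (c2.intervalIntegrable _ _)]
    conv_lhs => rw [approx_eq hf n t, h.cutoff hU hf n t ht]
    abel

variable {S} in
/-- The approximate solutions form a Cauchy sequence, uniformly in time. -/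
theorem norm_approx_sub_le (hν : 0 < ν) (hf : Continuous f) {n m : ℕ} (hnm : n ≤ m) :
    ∀ t ∈ Icc 0 T, ‖S.approx ν f U0 m t - S.approx ν f U0 n t‖ ^ 2
      ≤ ‖U0 - S.P n U0‖ ^ 2 + ν⁻¹ * ∫ s in (0 : ℝ)..T, ‖f s - S.P n (f s)‖ ^ 2 := by
  intro t ht
  have ha := continuous_approx (S := S) (ν := ν) (U0 := U0) hf n
  have hb := continuous_approx (S := S) (ν := ν) (U0 := U0) hf m
  have hΛ : ∀ s, S.Λ n (S.approx ν f U0 n s) = S.Λ m (S.approx ν f U0 n s) := fun s => by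
    rw [← S.Λ_P n m _ hnm, P_approx hf]
  have hΛ' : ∀ s, S.Λ n (S.Λ m (S.approx ν f U0 n s)) = S.Λ m (S.Λ m (S.approx ν f U0 n s)) :=
    fun s => by
      rw [← hΛ s, ← S.Λ_P n m _ hnm, S.P_Λ_self]
  have hP : ∀ x, ‖S.P m x - S.P n x‖ ≤ ‖x - S.P n x‖ := fun x => by
    have := S.norm_P_le m (x - S.P n x)
    rwa [map_sub, S.P_P n m x hnm] at this
  have h1 := energy_le hν (S.Λ_symm m) (D := fun t => S.approx ν f U0 m t - S.approx ν f U0 n t)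
    (g := fun s => S.P m (f s) - S.P n (f s)) (D0 := S.P m U0 - S.P n U0) (T := T) (by fun_prop)
    (by fun_prop) (fun t ht => ?_) t ht
  · have h3 : 0 ≤ ∫ s in (0 : ℝ)..t, ‖S.Λ m (S.approx ν f U0 m s - S.approx ν f U0 n s)‖ ^ 2 :=
      intervalIntegral.integral_nonneg ht.1 fun s _ => by positivity
    have h4 := mul_nonneg hν.le h3
    have h5 : ∫ s in (0 : ℝ)..t, ‖S.P m (f s) - S.P n (f s)‖ ^ 2
        ≤ ∫ s in (0 : ℝ)..T, ‖f s - S.P n (f s)‖ ^ 2 := by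
      have c1 : Continuous fun s => ‖S.P m (f s) - S.P n (f s)‖ ^ 2 := by fun_prop
      have c2 : Continuous fun s => ‖f s - S.P n (f s)‖ ^ 2 := by fun_prop
      refine (integral_mono_of_continuous c1 c2 ht.1 fun s _ => ?_).trans
        (intervalIntegral.integral_mono_interval le_rfl ht.1 ht.2
          (ae_of_all _ fun s => by positivity) (c2.intervalIntegrable _ _))
      have := hP (f s)
      gcongr
    have h6 : ‖S.P m U0 - S.P n U0‖ ^ 2 ≤ ‖U0 - S.P n U0‖ ^ 2 := by
      have := hP U0
      gcongr
    have h7 := mul_le_mul_of_nonneg_left h5 (inv_nonneg.2 hν.le)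
    linarith
  · have c1 : Continuous fun s => ν • S.Λ m (S.Λ m (S.approx ν f U0 m s)) + S.Λ m (f s) := by
      fun_prop
    have c2 : Continuous fun s => ν • S.Λ n (S.Λ n (S.approx ν f U0 n s)) + S.Λ n (f s) := by
      fun_prop
    have h5 : ∀ s, ν • S.Λ m (S.Λ m (S.approx ν f U0 m s - S.approx ν f U0 n s))
          + S.Λ m (S.P m (f s) - S.P n (f s))
        = (ν • S.Λ m (S.Λ m (S.approx ν f U0 m s)) + S.Λ m (f s))
          - (ν • S.Λ n (S.Λ n (S.approx ν f U0 n s)) + S.Λ n (f s)) := fun s => by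
      simp only [map_sub, smul_sub, hΛ, hΛ', S.Λ_P n m _ hnm, S.Λ_P_self]; abel
    simp only [h5]
    rw [intervalIntegral.integral_sub (c1.intervalIntegrable _ _) (c2.intervalIntegrable _ _)]
    conv_lhs => rw [approx_eq hf n t, approx_eq hf m t]
    abel

theorem tendsto_integral_sub_P (hf : Continuous f) (T : ℝ) :
    Tendsto (fun n => ∫ s in (0 : ℝ)..T, ‖f s - S.P n (f s)‖ ^ 2) atTop (𝓝 0) := by
  have hb : Continuous fun s => 4 * ‖f s‖ ^ 2 := by fun_prop
  have h := intervalIntegral.tendsto_integral_filter_of_dominated_convergence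
    (μ := volume) (a := 0) (b := T) (l := atTop)
    (F := fun n s => ‖f s - S.P n (f s)‖ ^ 2) (f := fun _ => (0 : ℝ)) (fun s => 4 * ‖f s‖ ^ 2)
    (Eventually.of_forall fun n => by
      have : Continuous fun s => ‖f s - S.P n (f s)‖ ^ 2 := by fun_prop
      exact this.aestronglyMeasurable)
    (Eventually.of_forall fun n => ae_of_all _ fun s _ => by
      have h1 := norm_sub_le (f s) (S.P n (f s))
      have h2 := S.norm_P_le n (f s)
      have h3 : ‖f s - S.P n (f s)‖ ≤ 2 * ‖f s‖ := by linarith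
      rw [Real.norm_of_nonneg (by positivity)]
      calc ‖f s - S.P n (f s)‖ ^ 2 ≤ (2 * ‖f s‖) ^ 2 := by gcongr
        _ = _ := by ring)
    (hb.intervalIntegrable _ _)
    (ae_of_all _ fun s _ => by
      have h1 := ((tendsto_const_nhds (x := f s)).sub (S.P_tendsto (f s))).norm.pow 2
      simpa using h1)
  simpa using h

/-- Existence for the linear equation, as the uniform limit of the approximate solutions. -/
theorem exists_isLinearSolution (hν : 0 < ν) (hT : 0 ≤ T) (hf : Continuous f) (U0 : X) :
    ∃ U, Continuous U ∧ S.IsLinearSolution ν T U f U0 := by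
  let u : ℕ → C(Icc (0 : ℝ) T, X) := fun n =>
    ⟨fun t => S.approx ν f U0 n t, (continuous_approx hf n).comp continuous_subtype_val⟩
  let δ : ℕ → ℝ := fun n => Real.sqrt (‖U0 - S.P n U0‖ ^ 2
    + ν⁻¹ * ∫ s in (0 : ℝ)..T, ‖f s - S.P n (f s)‖ ^ 2)
  have hδ : Tendsto δ atTop (𝓝 0) := by
    have h1 := ((tendsto_const_nhds (x := U0)).sub (S.P_tendsto U0)).norm.pow 2
    have h2 := (S.tendsto_integral_sub_P hf T).const_mul ν⁻¹
    simpa using (h1.add h2).sqrt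
  have hdist : ∀ n m, n ≤ m → dist (u n) (u m) ≤ δ n := by
    intro n m hnm
    refine (ContinuousMap.dist_le (Real.sqrt_nonneg _)).2 fun t => ?_
    rw [dist_comm, dist_eq_norm]
    exact Real.le_sqrt_of_sq_le (norm_approx_sub_le hν hf hnm t t.2)
  have hc : CauchySeq u := cauchySeq_of_le_tendsto_0' δ hdist hδ
  obtain ⟨v, hv⟩ := cauchySeq_tendsto_of_complete hc
  obtain ⟨M, hM⟩ := (Metric.isBounded_range_of_tendsto u hv).exists_norm_le
  have hu : ∀ t ∈ Icc 0 T, Tendsto (fun n => S.approx ν f U0 n t) atTop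
      (𝓝 (IccExtend hT v t)) := fun t ht => by
    rw [IccExtend_of_mem hT v ht]
    exact ((continuous_eval_const (F := C(Icc (0 : ℝ) T, X)) (⟨t, ht⟩ : Icc (0 : ℝ) T)).tendsto v).comp hv
  refine ⟨IccExtend hT v, v.continuous.Icc_extend', fun t ht => ?_⟩
  have hsub : ∀ s ∈ uIoc 0 t, s ∈ Icc 0 T := fun s hs => by
    rw [uIoc_of_le ht.1] at hs; exact ⟨hs.1.le, hs.2.trans ht.2⟩
  have hi1 : Tendsto (fun n => ∫ s in (0 : ℝ)..t, S.approx ν f U0 n s) atTop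
      (𝓝 (∫ s in (0 : ℝ)..t, IccExtend hT v s)) := by
    refine intervalIntegral.tendsto_integral_filter_of_dominated_convergence (fun _ => M)
      (Eventually.of_forall fun n => (continuous_approx hf n).aestronglyMeasurable)
      (Eventually.of_forall fun n => ae_of_all _ fun s hs => ?_) (by simp)
      (ae_of_all _ fun s hs => hu s (hsub s hs))
    exact ((u n).norm_coe_le_norm ⟨s, hsub s hs⟩).trans (hM _ ⟨n, rfl⟩)
  have hi2 : Tendsto (fun n => ∫ s in (0 : ℝ)..t, S.P n (S.J (f s))) atTop
      (𝓝 (∫ s in (0 : ℝ)..t, S.J (f s))) := by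
    have hb : Continuous fun s => ‖f s‖ := by fun_prop
    refine intervalIntegral.tendsto_integral_filter_of_dominated_convergence (fun s => ‖f s‖)
      (Eventually.of_forall fun n => ?_)
      (Eventually.of_forall fun n => ae_of_all _ fun s hs => ?_) (hb.intervalIntegrable _ _)
      (ae_of_all _ fun s hs => S.P_tendsto _)
    · have : Continuous fun s => S.P n (S.J (f s)) := by fun_prop
      exact this.aestronglyMeasurable
    · exact (S.norm_P_le n _).trans (S.norm_J_le _)
  have heq : ∀ n, S.J (S.J (S.approx ν f U0 n t)) + ν • (∫ s in (0 : ℝ)..t, S.approx ν f U0 n s)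
      + ∫ s in (0 : ℝ)..t, S.P n (S.J (f s)) = S.J (S.J (S.P n U0)) := by
    intro n
    have h1 := congrArg (fun x => S.J (S.J x)) (approx_eq (S := S) (ν := ν) (U0 := U0) hf n t)
    have ha := continuous_approx (S := S) (ν := ν) (U0 := U0) hf n
    have c1 : Continuous fun s => ν • S.Λ n (S.Λ n (S.approx ν f U0 n s)) + S.Λ n (f s) := by
      fun_prop
    have c2 : Continuous fun s => S.J (ν • S.Λ n (S.Λ n (S.approx ν f U0 n s)) + S.Λ n (f s)) := by
      fun_prop
    have c3 : Continuous fun s => ν • S.approx ν f U0 n s := by fun_prop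
    have c4 : Continuous fun s => S.P n (S.J (f s)) := by fun_prop
    simp only [map_sub] at h1
    rw [← ContinuousLinearMap.intervalIntegral_comp_comm _ (c1.intervalIntegrable _ _),
      ← ContinuousLinearMap.intervalIntegral_comp_comm _ (c2.intervalIntegrable _ _)] at h1
    simp only [map_add, map_smul, S.J_Λ, S.J_P, P_approx hf] at h1
    rw [intervalIntegral.integral_add (c3.intervalIntegrable _ _) (c4.intervalIntegrable _ _),
      intervalIntegral.integral_smul] at h1
    rw [h1, S.J_P, S.J_P]
    abel
  refine tendsto_nhds_unique ?_ ((S.J.continuous.comp S.J.continuous).tendsto U0 |>.comp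
    (S.P_tendsto U0))
  refine Tendsto.congr heq ?_
  exact (((S.J.continuous.comp S.J.continuous).tendsto _ |>.comp (hu t ht)).add
    (hi1.const_smul ν)).add hi2

variable {S} in
/-- Maximal regularity: a solution lies in the domain of `Λ` for almost every time, and `W = Λ U` is
square integrable.  The energy estimate bounds `Λ n U` in mean square, uniformly in `n`, and by
orthogonality `Λ n x` converges as soon as its norms are bounded. -/
theorem IsLinearSolution.exists_regular (hν : 0 < ν) (h : S.IsLinearSolution ν T U f U0)
    (hT : 0 ≤ T) (hU : Continuous U) (hf : Continuous f) :
    ∃ W : ℝ → X, MemLp W 2 (volume.restrict (Icc 0 T)) ∧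
      (∀ᵐ s ∂(volume.restrict (Icc 0 T)), S.J (W s) = U s) := by
  set μ : Measure ℝ := volume.restrict (Icc 0 T) with hμ
  set K : ℝ := ν⁻¹ * (‖U0‖ ^ 2 + ν⁻¹ * ∫ s in (0 : ℝ)..T, ‖f s‖ ^ 2) with hK
  have hmeas : ∀ n, Continuous fun s => S.Λ n (U s) := fun n => by fun_prop
  have hK0 : ∀ n, ∫ s in (0 : ℝ)..T, ‖S.Λ n (U s)‖ ^ 2 ≤ K := fun n => by
    have h1 := h.energy_cutoff hν hU hf n T ⟨hT, le_rfl⟩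
    rw [hK, ← div_eq_inv_mul, le_div_iff₀ hν]
    nlinarith [sq_nonneg ‖S.P n (U T)‖]
  have hnorm : ∀ n, eLpNorm (fun s => S.Λ n (U s)) 2 μ ≤ (Real.toNNReal (Real.sqrt K) : ℝ≥0∞) := by
    intro n
    have hm : MemLp (fun s => S.Λ n (U s)) 2 μ :=
      memLp_restrict_Icc (hmeas n) T
    rw [hm.eLpNorm_eq_integral_rpow_norm (by norm_num) (by norm_num), ENNReal.ofReal]
    gcongr
    simp only [ENNReal.toReal_ofNat, Real.rpow_ofNat]
    rw [hμ, integral_Icc_eq_integral_Ioc, ← intervalIntegral.integral_of_le hT, Real.sqrt_eq_rpow,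
      one_div]
    exact Real.rpow_le_rpow (intervalIntegral.integral_nonneg hT fun s _ => by positivity) (hK0 n)
      (by norm_num)
  have hbdd := ae_bdd_liminf_atTop_of_eLpNorm_bdd (μ := μ) (p := 2) (by norm_num)
    (f := fun n s => ‖S.Λ n (U s)‖) (fun n => (hmeas n).norm.measurable)
    (fun n => (eLpNorm_norm _).trans_le (hnorm n))
  simp only [enorm_norm] at hbdd
  -- the increments of `Λ n x` are orthogonal
  have hmono : ∀ x n m, n ≤ m → ‖S.Λ m x - S.Λ n x‖ ^ 2 = ‖S.Λ m x‖ ^ 2 - ‖S.Λ n x‖ ^ 2 := by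
    intro x n m hnm
    have h1 : ⟪S.Λ m x, S.Λ n x⟫_ℝ = ‖S.Λ n x‖ ^ 2 := by
      rw [← S.P_Λ_self n x, ← S.P_symm, S.P_Λ n m x hnm, real_inner_self_eq_norm_sq, S.P_Λ_self]
    rw [norm_sub_sq_real, h1]; ring
  have hle : ∀ x n m, n ≤ m → ‖S.Λ n x‖ ≤ ‖S.Λ m x‖ := fun x n m hnm => by
    have h1 := hmono x n m hnm
    exact le_of_sq_le_sq (by nlinarith [sq_nonneg ‖S.Λ m x - S.Λ n x‖]) (norm_nonneg _)
  have hconv : ∀ᵐ s ∂μ, ∃ w, Tendsto (fun n => S.Λ n (U s)) atTop (𝓝 w) := by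
    filter_upwards [hbdd] with s hs
    have hmo : Monotone fun n => ‖S.Λ n (U s)‖ₑ := fun n m hnm => by
      simp only [← ofReal_norm]
      exact ENNReal.ofReal_le_ofReal (hle _ n m hnm)
    rw [(tendsto_atTop_iSup hmo).liminf_eq] at hs
    have hbd : ∀ n, ‖S.Λ n (U s)‖ ≤ (⨆ n, ‖S.Λ n (U s)‖ₑ).toReal := fun n => by
      rw [← toReal_enorm]
      exact ENNReal.toReal_mono hs.ne (le_iSup (fun n => ‖S.Λ n (U s)‖ₑ) n)
    have hmo2 : Monotone fun n => ‖S.Λ n (U s)‖ ^ 2 := fun n m hnm => by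
      have := hle (U s) n m hnm
      simp only; gcongr
    have hlim := tendsto_atTop_ciSup hmo2 ⟨(⨆ n, ‖S.Λ n (U s)‖ₑ).toReal ^ 2, by
      rintro _ ⟨n, rfl⟩
      have := hbd n
      simp only; gcongr⟩
    set L := ⨆ n, ‖S.Λ n (U s)‖ ^ 2 with hL
    refine cauchySeq_tendsto_of_complete (cauchySeq_of_le_tendsto_0'
      (fun n => Real.sqrt (L - ‖S.Λ n (U s)‖ ^ 2)) (fun n m hnm => ?_) ?_)
    · rw [dist_comm, dist_eq_norm]
      refine Real.le_sqrt_of_sq_le ?_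
      rw [hmono _ n m hnm]
      have := hmo2.ge_of_tendsto hlim m
      linarith
    · have := (tendsto_const_nhds (x := L)).sub hlim
      simpa using this.sqrt
  obtain ⟨W, hWm, hW⟩ := exists_stronglyMeasurable_limit_of_tendsto_ae
    (fun n => (hmeas n).stronglyMeasurable.aestronglyMeasurable) hconv
  refine ⟨W, ⟨hWm.aestronglyMeasurable, ?_⟩, ?_⟩
  · refine lt_of_le_of_lt (Lp.eLpNorm_lim_le_liminf_eLpNorm
      (fun n => (hmeas n).stronglyMeasurable.aestronglyMeasurable) W hW) ?_
    refine lt_of_le_of_lt (liminf_le_of_frequently_le' (Frequently.of_forall hnorm))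
      ENNReal.coe_lt_top
  · filter_upwards [hW] with s hs
    have h1 := (S.J.continuous.tendsto _).comp hs
    refine tendsto_nhds_unique h1 ?_
    simpa only [Function.comp_def, S.J_Λ] using S.P_tendsto (U s)

end FrequencyScale
end Linear

/-! ### Weakly null sequences and the a priori bound -/

section Linear

variable {X : Type*} [NormedAddCommGroup X] [InnerProductSpace ℝ X] [CompleteSpace X]

/-- The sequence `x` converges weakly to `0`. -/
def WeakNull (x : ℕ → X) : Prop := ∀ y, Tendsto (fun n => ⟪y, x n⟫_ℝ) atTop (𝓝 0)

theorem WeakNull.map {Y : Type*} [NormedAddCommGroup Y] [InnerProductSpace ℝ Y] [CompleteSpace Y]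
    {x : ℕ → X} (h : WeakNull x) (L : X →L[ℝ] Y) : WeakNull fun n => L (x n) :=
  fun y => by simpa only [← ContinuousLinearMap.adjoint_inner_left] using h (L.adjoint y)

theorem WeakNull.sub {x y : ℕ → X} (hx : WeakNull x) (hy : WeakNull y) :
    WeakNull fun n => x n - y n :=
  fun z => by simpa only [inner_sub_right, sub_zero] using (hx z).sub (hy z)

theorem WeakNull.add {x y : ℕ → X} (hx : WeakNull x) (hy : WeakNull y) :
    WeakNull fun n => x n + y n :=
  fun z => by simpa only [inner_add_right, add_zero] using (hx z).add (hy z)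

/-- Weak convergence passes through approximation by weakly null sequences. -/
theorem WeakNull.of_approx {x : ℕ → X}
    (h : ∀ ε > 0, ∃ a : ℕ → X, WeakNull a ∧ ∀ n, ‖x n - a n‖ ≤ ε) : WeakNull x := by
  intro y
  rw [Metric.tendsto_atTop]
  intro ε hε
  obtain ⟨a, ha, hxa⟩ := h (ε / (2 * (‖y‖ + 1))) (by positivity)
  obtain ⟨N, hN⟩ := Metric.tendsto_atTop.1 (ha y) (ε / 2) (by positivity)
  refine ⟨N, fun n hn => ?_⟩
  have h1 := hN n hn
  rw [Real.dist_0_eq_abs] at h1 ⊢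
  have h2 : ⟪y, x n⟫_ℝ = ⟪y, x n - a n⟫_ℝ + ⟪y, a n⟫_ℝ := by rw [← inner_add_right]; simp
  have h3 : |⟪y, x n - a n⟫_ℝ| ≤ ε / 2 := by
    refine (abs_real_inner_le_norm _ _).trans ?_
    calc ‖y‖ * ‖x n - a n‖ ≤ (‖y‖ + 1) * (ε / (2 * (‖y‖ + 1))) := by
          gcongr
          · linarith
          · exact hxa n
      _ = ε / 2 := by field_simp
  rw [h2]
  refine (abs_add_le _ _).trans_lt ?_
  linarith

/-- For bounded sequences, weak convergence may be tested on the spectral cutoffs. -/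
theorem WeakNull.of_P (S : FrequencyScale X) {x : ℕ → X} {M : ℝ} (hM : ∀ n, ‖x n‖ ≤ M)
    (h : ∀ N, WeakNull fun n => S.P N (x n)) : WeakNull x := by
  intro y
  rw [Metric.tendsto_atTop]
  intro ε hε
  have hM0 : 0 ≤ M := (norm_nonneg _).trans (hM 0)
  have h0 := ((tendsto_const_nhds (x := y)).sub (S.P_tendsto y)).norm
  rw [sub_self, norm_zero] at h0
  obtain ⟨N, hN⟩ := (h0.eventually (gt_mem_nhds (show 0 < ε / (2 * (M + 1)) by positivity))).exists
  obtain ⟨n0, hn0⟩ := Metric.tendsto_atTop.1 (h N y) (ε / 2) (by positivity)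
  refine ⟨n0, fun n hn => ?_⟩
  have h1 := hn0 n hn
  rw [Real.dist_0_eq_abs] at h1 ⊢
  have h2 : ⟪y, x n⟫_ℝ = ⟪y - S.P N y, x n⟫_ℝ + ⟪y, S.P N (x n)⟫_ℝ := by
    rw [← S.P_symm, ← inner_add_left]; simp
  have h3 : |⟪y - S.P N y, x n⟫_ℝ| ≤ ε / 2 := by
    refine (abs_real_inner_le_norm _ _).trans ?_
    calc ‖y - S.P N y‖ * ‖x n‖ ≤ (ε / (2 * (M + 1))) * (M + 1) := by
          gcongr
          linarith [hM n]
      _ = ε / 2 := by field_simp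
  rw [h2]
  refine (abs_add_le _ _).trans_lt ?_
  linarith

namespace FrequencyScale

variable {S : FrequencyScale X} {ν T : ℝ}

/-- The solution of the linear equation depends on data and forcing continuously for weak
convergence, even if the forcing converges weakly two derivatives below the space of the solution. -/
theorem IsLinearSolution.weakNull (hν : 0 < ν) {U f : ℕ → ℝ → X} {U0 : ℕ → X}
    (h : ∀ n, S.IsLinearSolution ν T (U n) (f n) (U0 n)) (hU : ∀ n, Continuous (U n))
    (hf : ∀ n, Continuous (f n)) {M : ℝ} (hM : ∀ n, ∀ t ∈ Icc 0 T, ‖f n t‖ ≤ M)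
    {M' : ℝ} (hM' : ∀ n, ∀ t ∈ Icc 0 T, ‖U n t‖ ≤ M')
    (h0 : WeakNull U0) (hfw : ∀ t ∈ Icc 0 T, WeakNull fun n => S.J (f n t)) :
    ∀ t ∈ Icc 0 T, WeakNull fun n => U n t := by
  intro t ht
  refine WeakNull.of_P S (fun n => hM' n t ht) fun N => ?_
  -- the cutoffs are given by variation of constants
  simp only [(h _).P_eq_approx hν (hU _) (hf _) N t ht, approx, expSol]
  set G := ν • (S.Λ N ∘L S.Λ N) with hG
  refine WeakNull.map (WeakNull.sub (h0.map (S.P N)) fun y => ?_) _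
  have hc : ∀ n, Continuous fun s => NormedSpace.exp (s • G) (S.Λ N (f n s)) := fun n =>
    (continuous_exp_smul G).clm_apply (by have := hf n; fun_prop)
  obtain ⟨E, hE⟩ := isCompact_Icc.exists_bound_of_continuousOn
    ((continuous_exp_smul G).continuousOn (s := Icc 0 T))
  have hin : ∀ n, ⟪y, ∫ s in (0 : ℝ)..t, NormedSpace.exp (s • G) (S.Λ N (f n s))⟫_ℝ
      = ∫ s in (0 : ℝ)..t, ⟪y, NormedSpace.exp (s • G) (S.Λ N (f n s))⟫_ℝ := fun n =>
    ((innerSL ℝ y).intervalIntegral_comp_comm ((hc n).intervalIntegrable _ _)).symm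
  simp only [hin]
  have hsub : ∀ s ∈ uIoc 0 t, s ∈ Icc 0 T := fun s hs => by
    rw [uIoc_of_le ht.1] at hs; exact ⟨hs.1.le, hs.2.trans ht.2⟩
  have hlim := intervalIntegral.tendsto_integral_filter_of_dominated_convergence
    (μ := volume) (a := 0) (b := t) (l := atTop)
    (F := fun n s => ⟪y, NormedSpace.exp (s • G) (S.Λ N (f n s))⟫_ℝ) (f := fun _ => (0 : ℝ))
    (fun _ => ‖y‖ * (E * (‖S.Λ N‖ * M)))
    (Eventually.of_forall fun n => ((continuous_const).inner (hc n)).aestronglyMeasurable)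
    (Eventually.of_forall fun n => ae_of_all _ fun s hs => by
      refine (norm_inner_le_norm _ _).trans ?_
      gcongr
      refine (ContinuousLinearMap.le_opNorm _ _).trans ?_
      have h1 := hE s (hsub s hs)
      gcongr
      · exact (norm_nonneg _).trans h1
      · refine (ContinuousLinearMap.le_opNorm _ _).trans ?_
        gcongr
        exact hM n s (hsub s hs))
    (by simp)
    (ae_of_all _ fun s hs => by
      have h1 := ((hfw s (hsub s hs)).map (NormedSpace.exp (s • G) ∘L S.Λ N ∘L S.Λ N)) y
      simpa only [ContinuousLinearMap.comp_apply, S.Λ_J, S.Λ_P_self] using h1)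
  simpa using hlim

/-- A quadratic nonlinearity `B` on the space `X`, with values one order below (in `Λ X`, identified
with `X`), that is estimated and cancels like the convection term of the two-dimensional Navier-Stokes
equations.  The range of `Q` is the space of divergence-free fields. -/
structure Nonlinearity (S : FrequencyScale X) where
  /-- The projection on the divergence-free fields. -/
  Q : X →L[ℝ] X
  /-- The convection term. -/
  B : X →L[ℝ] X →L[ℝ] X
  /-- The constant in the estimates. -/
  C : ℝ
  C_nonneg : 0 ≤ C
  Q_J : ∀ x, Q (S.J x) = S.J (Q x)
  Q_B : ∀ x y, Q (B x y) = B x y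
  norm_B_le : ∀ x y, ‖B x y‖ ≤ C * ‖S.J x‖ * ‖y‖
  cancel : ∀ x y, Q x = x → Q y = y → ⟪S.J (B x y), S.J (S.J y)⟫_ℝ = 0
  low_le : ∀ x y z, |⟪S.J (B x y), S.J (S.J z)⟫_ℝ| ≤ C * ‖S.J (S.J x)‖ * ‖y‖ * ‖S.J (S.J z)‖
  weakNull_left : ∀ (x y : ℕ → X) (M : ℝ), WeakNull x → (∀ n, ‖x n‖ ≤ M) → (∀ n, ‖y n‖ ≤ M) →
    WeakNull fun n => S.J (B (x n) (y n))
  weakNull_right : ∀ (x y : ℕ → X) (M : ℝ), WeakNull y → (∀ n, ‖x n‖ ≤ M) → (∀ n, ‖y n‖ ≤ M) →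
    WeakNull fun n => S.J (B (x n) (y n))

namespace Nonlinearity

variable (N : Nonlinearity S)

theorem norm_B_le' (x y : X) : ‖N.B x y‖ ≤ N.C * ‖x‖ * ‖y‖ := by
  refine (N.norm_B_le x y).trans ?_
  have := N.C_nonneg
  have := S.norm_J_le x
  gcongr

theorem norm_B_sub_le (x y : X) : ‖N.B x x - N.B y y‖ ≤ N.C * (‖x‖ + ‖y‖) * ‖x - y‖ := by
  have h1 : N.B x x - N.B y y = N.B (x - y) x + N.B y (x - y) := by
    simp only [map_sub, sub_apply]; abel
  rw [h1]
  refine (norm_add_le _ _).trans ?_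
  have h2 := N.norm_B_le' (x - y) x
  have h3 := N.norm_B_le' y (x - y)
  linarith

/-- Solutions with divergence-free data and forcing are divergence-free. -/
theorem Q_eq_self {U f : ℝ → X} {U0 : X} (hν : 0 < ν) (h : S.IsLinearSolution ν T U f U0)
    (hU : Continuous U) (hf : Continuous f) (hQf : ∀ t, N.Q (f t) = f t) (hQ0 : N.Q U0 = U0) :
    ∀ t ∈ Icc 0 T, N.Q (U t) = U t := by
  have h' : S.IsLinearSolution ν T (fun t => N.Q (U t)) f U0 := by
    intro t ht
    have h1 := congrArg N.Q (h t ht)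
    have c0 : Continuous fun s => S.J (f s) := by fun_prop
    rw [map_add, map_add, map_smul,
      ← ContinuousLinearMap.intervalIntegral_comp_comm _ (hU.intervalIntegrable _ _),
      ← ContinuousLinearMap.intervalIntegral_comp_comm _ (c0.intervalIntegrable _ _)] at h1
    simpa only [N.Q_J, hQf, hQ0] using h1
  exact h'.unique hν h (by fun_prop) hU hf

/-- A priori bound, uniform in the factor `θ` that truncates the nonlinearity.  The cancellation gives
a bound for `J² U` at each time and for `J U` in mean square; with the latter, Gronwall's
inequality for `U` has an integrable coefficient. -/
theorem exists_bound (hν : 0 < ν) (hT : 0 ≤ T) {Z : ℝ → X} (hZ : Continuous Z)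
    (hQZ : ∀ t, N.Q (Z t) = Z t) (R : ℝ) :
    ∃ K, 0 ≤ K ∧ ∀ (U0 : X) (U : ℝ → X) (θ : ℝ → ℝ), ‖U0‖ ≤ R → N.Q U0 = U0 → Continuous U →
      Continuous θ → (∀ t, 0 ≤ θ t) → (∀ t, θ t ≤ 1) →
      S.IsLinearSolution ν T U (fun s => θ s • N.B (U s + Z s) (U s + Z s)) U0 →
      ∀ t ∈ Icc 0 T, ‖U t‖ ≤ K := by
  obtain ⟨M, hM⟩ := isCompact_Icc.exists_bound_of_continuousOn (hZ.continuousOn (s := Icc 0 T))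
  have hM0 : 0 ≤ M := (norm_nonneg _).trans (hM 0 ⟨le_rfl, hT⟩)
  have hC := N.C_nonneg
  set c1 := R ^ 2 + 2 * N.C * M ^ 3 * T with hc1
  set K1 := c1 * Real.exp (4 * N.C * M * T) with hK1
  set K2 := c1 + 4 * N.C * M * T * K1 with hK2
  set K3 := 2 * ν⁻¹ * N.C ^ 2 * (K2 / ν + 2 * T * M ^ 2) with hK3
  have hc10 : 0 ≤ c1 := by positivity
  refine ⟨Real.sqrt ((R ^ 2 + M ^ 2) * Real.exp K3), Real.sqrt_nonneg _, ?_⟩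
  intro U0 U θ hU0 hQ0 hU hθ hθ0 hθ1 h
  set f : ℝ → X := fun s => θ s • N.B (U s + Z s) (U s + Z s) with hf
  have hBc : Continuous fun s => N.B (U s + Z s) (U s + Z s) := by fun_prop
  have hfc : Continuous f := by fun_prop
  have hQU : ∀ t ∈ Icc 0 T, N.Q (U t) = U t :=
    N.Q_eq_self hν h hU hfc (fun t => by simp only [hf, map_smul, N.Q_B]) hQ0
  have hU02 : ‖U0‖ ^ 2 ≤ R ^ 2 := by gcongr
  -- the energy estimate two orders below
  have hin : ∀ s ∈ Icc 0 T, -⟪S.J (f s), S.J (S.J (U s))⟫_ℝ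
      ≤ 2 * N.C * M * ‖S.J (S.J (U s))‖ ^ 2 + N.C * M ^ 3 := by
    intro s hs
    have e1 : ⟪S.J (f s), S.J (S.J (U s))⟫_ℝ
        = θ s * ⟪S.J (N.B (U s + Z s) (Z s)), S.J (S.J (U s))⟫_ℝ := by
      have e2 := N.cancel (U s + Z s) (U s) (by rw [map_add, hQU s hs, hQZ]) (hQU s hs)
      simp only [hf, map_smul, real_inner_smul_left]
      rw [map_add (N.B (U s + Z s)), map_add, inner_add_left, e2, zero_add]
    have e3 := N.low_le (U s + Z s) (Z s) (U s)
    have e4 : ‖S.J (S.J (U s + Z s))‖ ≤ ‖S.J (S.J (U s))‖ + M := by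
      rw [map_add, map_add]
      exact (norm_add_le _ _).trans (add_le_add le_rfl
        (((S.norm_J_le _).trans (S.norm_J_le _)).trans (hM s hs)))
    set a := ‖S.J (S.J (U s))‖ with ha
    have ha0 : 0 ≤ a := norm_nonneg _
    have e5 : N.C * ‖S.J (S.J (U s + Z s))‖ * ‖Z s‖ * a ≤ N.C * (a + M) * M * a := by
      have := hM s hs
      gcongr
    have e6 : N.C * (a + M) * M * a ≤ 2 * N.C * M * a ^ 2 + N.C * M ^ 3 := by
      have : 0 ≤ N.C * M * (a ^ 2 - M * a + M ^ 2) := by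
        have : 0 ≤ a ^ 2 - M * a + M ^ 2 := by nlinarith [sq_nonneg (a - M), mul_nonneg ha0 hM0]
        positivity
      nlinarith
    rw [e1, ← mul_neg]
    refine le_trans ?_ (e5.trans e6)
    calc θ s * -⟪S.J (N.B (U s + Z s) (Z s)), S.J (S.J (U s))⟫_ℝ
        ≤ 1 * |⟪S.J (N.B (U s + Z s) (Z s)), S.J (S.J (U s))⟫_ℝ| :=
          (mul_le_mul_of_nonneg_left (neg_le_abs _) (hθ0 s)).trans
            (mul_le_mul_of_nonneg_right (hθ1 s) (abs_nonneg _))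
      _ ≤ _ := by rw [one_mul]; exact e3
  have cφ : Continuous fun s => ‖S.J (S.J (U s))‖ ^ 2 := by fun_prop
  have cin : Continuous fun s => ⟪S.J (f s), S.J (S.J (U s))⟫_ℝ := by fun_prop
  have cJ : Continuous fun s => ‖S.J (U s)‖ ^ 2 := by fun_prop
  have hCM : 0 ≤ 4 * N.C * M := by positivity
  have hen : ∀ t ∈ Icc 0 T, ‖S.J (S.J (U t))‖ ^ 2 + 2 * ν * ∫ s in (0 : ℝ)..t, ‖S.J (U s)‖ ^ 2
      ≤ c1 + ∫ s in (0 : ℝ)..t, 4 * N.C * M * ‖S.J (S.J (U s))‖ ^ 2 := by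
    intro t ht
    rw [h.low_energy hU hfc t ht]
    have e1 : ∫ s in (0 : ℝ)..t, -⟪S.J (f s), S.J (S.J (U s))⟫_ℝ
        ≤ ∫ s in (0 : ℝ)..t, (2 * N.C * M * ‖S.J (S.J (U s))‖ ^ 2 + N.C * M ^ 3) :=
      integral_mono_of_continuous cin.neg (by fun_prop) ht.1
        fun s hs => hin s ⟨hs.1, hs.2.trans ht.2⟩
    have c2 : Continuous fun s => 2 * N.C * M * ‖S.J (S.J (U s))‖ ^ 2 := by fun_prop
    rw [intervalIntegral.integral_neg, intervalIntegral.integral_add (c2.intervalIntegrable _ _)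
      (by simp), intervalIntegral.integral_const_mul, intervalIntegral.integral_const,
      smul_eq_mul, sub_zero] at e1
    rw [intervalIntegral.integral_const_mul]
    have e2 : ‖S.J (S.J U0)‖ ^ 2 ≤ R ^ 2 := by
      have := ((S.norm_J_le _).trans (S.norm_J_le U0)).trans hU0
      gcongr
    have e3 : t * (N.C * M ^ 3) ≤ T * (N.C * M ^ 3) := by
      have := ht.2
      gcongr
    rw [hc1]
    linarith
  have hφ1 : ∀ t ∈ Icc 0 T, ‖S.J (S.J (U t))‖ ^ 2 ≤ K1 := by
    intro t ht
    refine (gronwall_integral cφ (continuous_const (y := 4 * N.C * M)) (fun _ => hCM)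
      (c := c1) (T := T) (fun t ht => ?_) t ht).trans ?_
    · refine le_trans (le_add_of_nonneg_right (mul_nonneg (by positivity)
        (intervalIntegral.integral_nonneg ht.1 fun s _ => by positivity))) (hen t ht)
    · rw [hK1, intervalIntegral.integral_const, smul_eq_mul, sub_zero, mul_comm t]
      have := ht.2
      gcongr
  have hJ : ∀ t ∈ Icc 0 T, ∫ s in (0 : ℝ)..t, ‖S.J (U s)‖ ^ 2 ≤ K2 / (2 * ν) := by
    intro t ht
    rw [le_div_iff₀ (by positivity)]
    have e1 := hen t ht
    have e2 : ∫ s in (0 : ℝ)..t, 4 * N.C * M * ‖S.J (S.J (U s))‖ ^ 2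
        ≤ ∫ s in (0 : ℝ)..t, 4 * N.C * M * K1 :=
      integral_mono_of_continuous (by fun_prop) continuous_const ht.1 fun s hs => by
        have := hφ1 s ⟨hs.1, hs.2.trans ht.2⟩
        gcongr
    rw [intervalIntegral.integral_const, smul_eq_mul, sub_zero] at e2
    have e3 : t * (4 * N.C * M * K1) ≤ T * (4 * N.C * M * K1) := by
      have := ht.2
      gcongr
    have e4 := sq_nonneg ‖S.J (S.J (U t))‖
    rw [hK2]
    linarith [sq_nonneg ‖S.J (S.J (U t))‖]
  -- the energy estimate in the space of the solution
  intro t ht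
  set a : ℝ → ℝ := fun s => 2 * ν⁻¹ * N.C ^ 2 * ‖S.J (U s + Z s)‖ ^ 2 with ha
  have cψ : Continuous fun s => ‖U s‖ ^ 2 + M ^ 2 := by fun_prop
  have ca : Continuous a := by fun_prop
  have ha0 : ∀ s, 0 ≤ a s := fun s => by positivity
  have hfa : ∀ s ∈ Icc 0 T, ν⁻¹ * ‖f s‖ ^ 2 ≤ a s * (‖U s‖ ^ 2 + M ^ 2) := by
    intro s hs
    have e1 : ‖f s‖ ≤ N.C * ‖S.J (U s + Z s)‖ * ‖U s + Z s‖ := by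
      simp only [hf, norm_smul, Real.norm_of_nonneg (hθ0 s)]
      refine le_trans ?_ (N.norm_B_le _ _)
      exact mul_le_of_le_one_left (norm_nonneg _) (hθ1 s)
    have e2 : ‖U s + Z s‖ ^ 2 ≤ 2 * (‖U s‖ ^ 2 + M ^ 2) := by
      have e3 : ‖U s + Z s‖ ≤ ‖U s‖ + M := (norm_add_le _ _).trans (add_le_add le_rfl (hM s hs))
      calc ‖U s + Z s‖ ^ 2 ≤ (‖U s‖ + M) ^ 2 := by gcongr
        _ ≤ _ := by nlinarith [sq_nonneg (‖U s‖ - M)]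
    calc ν⁻¹ * ‖f s‖ ^ 2 ≤ ν⁻¹ * (N.C * ‖S.J (U s + Z s)‖ * ‖U s + Z s‖) ^ 2 := by gcongr
      _ = ν⁻¹ * N.C ^ 2 * ‖S.J (U s + Z s)‖ ^ 2 * ‖U s + Z s‖ ^ 2 := by ring
      _ ≤ ν⁻¹ * N.C ^ 2 * ‖S.J (U s + Z s)‖ ^ 2 * (2 * (‖U s‖ ^ 2 + M ^ 2)) := by gcongr
      _ = _ := by rw [ha]; ring
  have hψ := gronwall_integral cψ ca ha0 (c := R ^ 2 + M ^ 2) (T := T) (fun t ht => by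
    have e1 := h.norm_sq_le hν hU hfc t ht
    have cf : Continuous fun s => ν⁻¹ * ‖f s‖ ^ 2 := by fun_prop
    have e2 := integral_mono_of_continuous cf (by fun_prop : Continuous fun s =>
      a s * (‖U s‖ ^ 2 + M ^ 2)) ht.1 fun s hs => hfa s ⟨hs.1, hs.2.trans ht.2⟩
    rw [intervalIntegral.integral_const_mul] at e2
    linarith) t ht
  have hA : ∫ s in (0 : ℝ)..t, a s ≤ K3 := by
    have e1 : ∫ s in (0 : ℝ)..t, ‖S.J (U s + Z s)‖ ^ 2
        ≤ ∫ s in (0 : ℝ)..t, (2 * ‖S.J (U s)‖ ^ 2 + 2 * M ^ 2) :=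
      integral_mono_of_continuous (by fun_prop) (by fun_prop) ht.1 fun s hs => by
        have e3 : ‖S.J (U s + Z s)‖ ≤ ‖S.J (U s)‖ + M := by
          rw [map_add]
          exact (norm_add_le _ _).trans (add_le_add le_rfl
            ((S.norm_J_le _).trans (hM s ⟨hs.1, hs.2.trans ht.2⟩)))
        calc ‖S.J (U s + Z s)‖ ^ 2 ≤ (‖S.J (U s)‖ + M) ^ 2 := by gcongr
          _ ≤ _ := by nlinarith [sq_nonneg (‖S.J (U s)‖ - M)]
    have c2 : Continuous fun s => 2 * ‖S.J (U s)‖ ^ 2 := by fun_prop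
    rw [intervalIntegral.integral_add (c2.intervalIntegrable _ _) (by simp),
      intervalIntegral.integral_const_mul, intervalIntegral.integral_const, smul_eq_mul,
      sub_zero] at e1
    have e2 := hJ t ht
    have e3 : t * (2 * M ^ 2) ≤ T * (2 * M ^ 2) := by
      have := ht.2
      gcongr
    have e4 : 2 * (K2 / (2 * ν)) = K2 / ν := by field_simp
    rw [ha, intervalIntegral.integral_const_mul, hK3]
    gcongr
    linarith
  refine Real.le_sqrt_of_sq_le ?_
  calc ‖U t‖ ^ 2 ≤ ‖U t‖ ^ 2 + M ^ 2 := by nlinarith [sq_nonneg M]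
    _ ≤ _ := hψ
    _ ≤ _ := by gcongr

end Nonlinearity
end FrequencyScale
end Linear

/-! ### Existence and uniqueness for the nonlinear equation -/

section Nonlinear

variable {X : Type*} [NormedAddCommGroup X] [InnerProductSpace ℝ X] [CompleteSpace X]

namespace FrequencyScale

variable {S : FrequencyScale X} {ν T : ℝ}

/-- Global solvability of the linear equation with a Lipschitz feedback, by Picard iteration: after `k`
steps the distance of two iterates is reduced by a factor of order `(k!)^(-1/2)`. -/
theorem exists_feedback (S : FrequencyScale X) (hν : 0 < ν) (hT : 0 ≤ T) {F : ℝ → X → X}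
    (hF : Continuous fun p : ℝ × X => F p.1 p.2) {L : ℝ}
    (hL : ∀ s ∈ Icc 0 T, ∀ x y, ‖F s x - F s y‖ ≤ L * ‖x - y‖) (U0 : X) :
    ∃ U, Continuous U ∧ S.IsLinearSolution ν T U (fun s => F s (U s)) U0 := by
  have hc : ∀ v : C(Icc (0 : ℝ) T, X), Continuous (IccExtend hT v) := fun v =>
    v.continuous.Icc_extend'
  have hf : ∀ v : C(Icc (0 : ℝ) T, X), Continuous fun s => F s (IccExtend hT v s) := fun v =>
    hF.comp (continuous_id.prodMk (hc v))
  choose sol hsolc hsol using fun v => S.exists_isLinearSolution hν hT (hf v) U0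
  let Φ : C(Icc (0 : ℝ) T, X) → C(Icc (0 : ℝ) T, X) := fun v =>
    ⟨fun t => sol v t, (hsolc v).comp continuous_subtype_val⟩
  have hstep : ∀ v w, ∀ t : Icc (0 : ℝ) T, ‖Φ v t - Φ w t‖ ^ 2
      ≤ ν⁻¹ * L ^ 2 * ∫ s in (0 : ℝ)..t, ‖IccExtend hT v s - IccExtend hT w s‖ ^ 2 := by
    intro v w t
    have h1 := ((hsol v).sub (hsol w) (hsolc v) (hf v) (hsolc w) (hf w)).norm_sq_le hν
      ((hsolc v).sub (hsolc w)) ((hf v).sub (hf w)) t t.2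
    simp only [sub_self, norm_zero, ne_eq, OfNat.ofNat_ne_zero, not_false_eq_true, zero_pow,
      zero_add] at h1
    refine h1.trans ?_
    have hcv := hc v
    have hcw := hc w
    rw [mul_assoc, ← intervalIntegral.integral_const_mul (L ^ 2)]
    refine mul_le_mul_of_nonneg_left ?_ (inv_nonneg.2 hν.le)
    have c1 : Continuous fun s => ‖F s (IccExtend hT v s) - F s (IccExtend hT w s)‖ ^ 2 :=
      ((hf v).sub (hf w)).norm.pow 2
    refine integral_mono_of_continuous c1 (by fun_prop) t.2.1 fun s hs => ?_
    have h2 := hL s ⟨hs.1, hs.2.trans t.2.2⟩ (IccExtend hT v s) (IccExtend hT w s)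
    rw [← mul_pow]
    gcongr
  set c := ν⁻¹ * L ^ 2 with hcdef
  have hc0 : 0 ≤ c := by positivity
  have hiter : ∀ k v w, ∀ t : Icc (0 : ℝ) T, ‖Φ^[k] v t - Φ^[k] w t‖ ^ 2
      ≤ (c * t) ^ k / k.factorial * dist v w ^ 2 := by
    intro k
    induction k with
    | zero =>
      intro v w t
      simp only [Function.iterate_zero, id_eq, pow_zero, Nat.factorial_zero, Nat.cast_one, div_one,
        one_mul]
      have := ContinuousMap.dist_apply_le_dist (f := v) (g := w) t
      rw [dist_eq_norm] at this
      gcongr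
    | succ k ih =>
      intro v w t
      rw [Function.iterate_succ_apply', Function.iterate_succ_apply']
      refine (hstep _ _ t).trans ?_
      have h1 : ∫ s in (0 : ℝ)..t, ‖IccExtend hT (Φ^[k] v) s - IccExtend hT (Φ^[k] w) s‖ ^ 2
          ≤ ∫ s in (0 : ℝ)..t, (c ^ k / k.factorial * dist v w ^ 2) * s ^ k := by
        have hcv := hc (Φ^[k] v)
        have hcw := hc (Φ^[k] w)
        refine integral_mono_of_continuous (by fun_prop) (by fun_prop) t.2.1 fun s hs => ?_
        have hs' : s ∈ Icc 0 T := ⟨hs.1, hs.2.trans t.2.2⟩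
        rw [IccExtend_of_mem hT _ hs', IccExtend_of_mem hT _ hs']
        refine (ih v w ⟨s, hs'⟩).trans (le_of_eq ?_)
        simp only [mul_pow]; ring
      rw [intervalIntegral.integral_const_mul, integral_pow] at h1
      refine (mul_le_mul_of_nonneg_left h1 hc0).trans (le_of_eq ?_)
      rw [Nat.factorial_succ]
      push_cast
      field_simp
      ring
  obtain ⟨k, hk⟩ := ((FloorSemiring.tendsto_pow_div_factorial_atTop (c * T)).eventually
    (gt_mem_nhds (show (0 : ℝ) < 1 / 4 by norm_num))).exists
  have hcontr : ContractingWith (1 / 2) Φ^[k] := by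
    refine ⟨by norm_num, LipschitzWith.of_dist_le_mul fun v w => ?_⟩
    refine (ContinuousMap.dist_le (by positivity)).2 fun t => ?_
    rw [dist_eq_norm]
    refine le_of_sq_le_sq ((hiter k v w t).trans ?_) (by positivity)
    have h2 : (c * t) ^ k / k.factorial ≤ 1 / 4 := by
      refine le_trans ?_ hk.le
      have := t.2.2
      have := t.2.1
      gcongr
    calc (c * t) ^ k / k.factorial * dist v w ^ 2 ≤ 1 / 4 * dist v w ^ 2 := by gcongr
      _ = _ := by push_cast; ring
  have hfix := hcontr.isFixedPt_fixedPoint_iterate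
  set v := ContractingWith.fixedPoint Φ^[k] hcontr
  have hv : ∀ t ∈ Icc 0 T, sol v t = IccExtend hT v t := fun t ht => by
    rw [IccExtend_of_mem hT _ ht]
    exact congrArg (fun u : C(Icc (0 : ℝ) T, X) => u ⟨t, ht⟩) hfix
  exact ⟨sol v, hsolc v, (hsol v).congr (fun _ _ => rfl) fun t ht => by rw [hv t ht]⟩

namespace Nonlinearity

variable (N : Nonlinearity S) {U U' Z : ℝ → X} {U0 : X}

/-- The equation `u' + ν Λ² u + Λ B(u + z, u + z) = 0`, `u(0) = u₀` on `[0, T]`. -/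
def IsSol (ν T : ℝ) (Z U : ℝ → X) (U0 : X) : Prop :=
  S.IsLinearSolution ν T U (fun s => N.B (U s + Z s) (U s + Z s)) U0

variable {N} in
theorem IsSol.unique (hν : 0 < ν) (h : N.IsSol ν T Z U U0) (h' : N.IsSol ν T Z U' U0)
    (hU : Continuous U) (hU' : Continuous U') (hZ : Continuous Z) : ∀ t ∈ Icc 0 T, U t = U' t := by
  intro t ht
  have hc : Continuous fun s => N.C * (‖U s + Z s‖ + ‖U' s + Z s‖) := by fun_prop
  obtain ⟨L, hL⟩ := isCompact_Icc.exists_bound_of_continuousOn (hc.continuousOn (s := Icc 0 T))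
  have hf : Continuous fun s => N.B (U s + Z s) (U s + Z s) := by fun_prop
  have hf' : Continuous fun s => N.B (U' s + Z s) (U' s + Z s) := by fun_prop
  have h1 := gronwall_integral (φ := fun t => ‖U t - U' t‖ ^ 2) (a := fun _ => ν⁻¹ * L ^ 2) (c := 0)
    (T := T) (by fun_prop) continuous_const (fun _ => by positivity) (fun t ht => ?_) t ht
  · rw [zero_mul] at h1
    have h2 : ‖U t - U' t‖ = 0 := by nlinarith [norm_nonneg (U t - U' t)]
    exact sub_eq_zero.1 (norm_eq_zero.1 h2)
  · have h1 := (IsLinearSolution.sub h h' hU hf hU' hf').norm_sq_le hν (by fun_prop)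
      (hf.sub hf') t ht
    simp only [sub_self, norm_zero, ne_eq, OfNat.ofNat_ne_zero, not_false_eq_true, zero_pow,
      zero_add] at h1 ⊢
    refine h1.trans ?_
    rw [← intervalIntegral.integral_const_mul]
    refine integral_mono_of_continuous (by fun_prop) (by fun_prop) ht.1 fun s hs => ?_
    rw [mul_assoc, ← mul_pow]
    have h2 := N.norm_B_sub_le (U s + Z s) (U' s + Z s)
    rw [add_sub_add_right_eq_sub] at h2
    have h3 := (le_abs_self _).trans (hL s ⟨hs.1, hs.2.trans ht.2⟩)
    gcongr
    refine h2.trans ?_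
    gcongr

/-- A cutoff function: `1` on `[0, R]` and `0` on `[2R, ∞)`. -/
def trunc (R r : ℝ) : ℝ := max 0 (min 1 (2 - r / R))

theorem trunc_nonneg (R r : ℝ) : 0 ≤ trunc R r := le_max_left _ _

theorem trunc_le_one (R r : ℝ) : trunc R r ≤ 1 := max_le zero_le_one (min_le_left _ _)

theorem trunc_eq_one {R r : ℝ} (hR : 0 < R) (h : r ≤ R) : trunc R r = 1 := by
  have : r / R ≤ 1 := (div_le_one hR).2 h
  rw [trunc, min_eq_left (by linarith), max_eq_right zero_le_one]

theorem trunc_eq_zero {R r : ℝ} (hR : 0 < R) (h : 2 * R ≤ r) : trunc R r = 0 := by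
  have : 2 ≤ r / R := (le_div_iff₀ hR).2 h
  rw [trunc, max_eq_left]
  exact (min_le_right _ _).trans (by linarith)

theorem continuous_trunc (R : ℝ) : Continuous (trunc R) := by
  unfold trunc; fun_prop

theorem abs_trunc_sub_le {R : ℝ} (hR : 0 < R) (r s : ℝ) : |trunc R r - trunc R s| ≤ |r - s| / R := by
  have h1 : |trunc R r - trunc R s| ≤ |min 1 (2 - r / R) - min 1 (2 - s / R)| := by
    simpa [trunc] using abs_max_sub_max_le_max 0 (min 1 (2 - r / R)) 0 (min 1 (2 - s / R))
  have h2 : |min 1 (2 - r / R) - min 1 (2 - s / R)| ≤ |(2 - r / R) - (2 - s / R)| := by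
    simpa using abs_min_sub_min_le_max 1 (2 - r / R) 1 (2 - s / R)
  refine h1.trans (h2.trans (le_of_eq ?_))
  rw [sub_sub_sub_cancel_left, ← sub_div, abs_div, abs_of_pos hR, abs_sub_comm]

theorem norm_trunc_sub_le {R : ℝ} (hR : 0 < R) (x y : X) :
    ‖trunc R ‖x‖ • N.B x x - trunc R ‖y‖ • N.B y y‖ ≤ 8 * N.C * R * ‖x - y‖ := by
  wlog hxy : ‖y‖ ≤ ‖x‖ generalizing x y
  · rw [norm_sub_rev, norm_sub_rev x]
    exact this y x (le_of_not_ge hxy)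
  have hC := N.C_nonneg
  rcases le_or_gt (2 * R) ‖y‖ with hy | hy
  · rw [trunc_eq_zero hR hy, trunc_eq_zero hR (hy.trans hxy)]
    simp only [zero_smul, sub_self, norm_zero]
    positivity
  have h1 : trunc R ‖x‖ • N.B x x - trunc R ‖y‖ • N.B y y
      = trunc R ‖x‖ • (N.B x x - N.B y y) + (trunc R ‖x‖ - trunc R ‖y‖) • N.B y y := by
    rw [smul_sub, sub_smul]; abel
  have h2 : ‖trunc R ‖x‖ • (N.B x x - N.B y y)‖ ≤ 4 * N.C * R * ‖x - y‖ := by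
    rcases le_or_gt (2 * R) ‖x‖ with hx | hx
    · rw [trunc_eq_zero hR hx, zero_smul, norm_zero]
      positivity
    · rw [norm_smul, Real.norm_of_nonneg (trunc_nonneg _ _)]
      refine (mul_le_of_le_one_left (norm_nonneg _) (trunc_le_one _ _)).trans ?_
      refine (N.norm_B_sub_le x y).trans ?_
      have : ‖x‖ + ‖y‖ ≤ 4 * R := by linarith
      calc N.C * (‖x‖ + ‖y‖) * ‖x - y‖ ≤ N.C * (4 * R) * ‖x - y‖ := by gcongr
        _ = _ := by ring
  have h3 : ‖(trunc R ‖x‖ - trunc R ‖y‖) • N.B y y‖ ≤ 4 * N.C * R * ‖x - y‖ := by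
    rw [norm_smul, Real.norm_eq_abs]
    have e1 := (abs_trunc_sub_le hR ‖x‖ ‖y‖).trans
      (div_le_div_of_nonneg_right (abs_norm_sub_norm_le x y) hR.le)
    have e2 := N.norm_B_le' y y
    calc |trunc R ‖x‖ - trunc R ‖y‖| * ‖N.B y y‖ ≤ ‖x - y‖ / R * (N.C * (2 * R) * (2 * R)) := by
          refine mul_le_mul e1 (e2.trans ?_) (norm_nonneg _) (by positivity)
          gcongr
      _ = _ := by field_simp; ring
  rw [h1]
  refine (norm_add_le _ _).trans ?_
  linarith

theorem exists_isSol (hν : 0 < ν) (hT : 0 ≤ T) (hZ : Continuous Z) (hQZ : ∀ t, N.Q (Z t) = Z t)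
    (hQ0 : N.Q U0 = U0) : ∃ U, Continuous U ∧ N.IsSol ν T Z U U0 := by
  obtain ⟨K, hK0, hK⟩ := N.exists_bound hν hT hZ hQZ ‖U0‖
  obtain ⟨M, hM⟩ := isCompact_Icc.exists_bound_of_continuousOn (hZ.continuousOn (s := Icc 0 T))
  have hM0 : 0 ≤ M := (norm_nonneg _).trans (hM 0 ⟨le_rfl, hT⟩)
  set R := K + M + 1 with hR
  have hR0 : 0 < R := by positivity
  have ht := continuous_trunc R
  obtain ⟨U, hU, h⟩ := S.exists_feedback hν hT
    (F := fun s x => trunc R ‖x + Z s‖ • N.B (x + Z s) (x + Z s)) (by fun_prop)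
    (L := 8 * N.C * R) (fun s _ x y => by simpa using N.norm_trunc_sub_le hR0 (x + Z s) (y + Z s)) U0
  refine ⟨U, hU, h.congr (fun _ _ => rfl) fun t ht => ?_⟩
  have h1 := hK U0 U (fun s => trunc R ‖U s + Z s‖) le_rfl hQ0 hU (by fun_prop)
    (fun _ => trunc_nonneg _ _) (fun _ => trunc_le_one _ _) h t ht
  rw [trunc_eq_one hR0 ((norm_add_le _ _).trans (by linarith [hM t ht])), one_smul]

theorem exists_global (hν : 0 < ν) (hZ : Continuous Z) (hQZ : ∀ t, N.Q (Z t) = Z t)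
    (hQ0 : N.Q U0 = U0) : ∃ U, Continuous U ∧ ∀ T, N.IsSol ν T Z U U0 := by
  choose V hV hVs using fun n : ℕ => N.exists_isSol (T := n) hν n.cast_nonneg hZ hQZ hQ0
  have hVV : ∀ n m : ℕ, ∀ t : ℝ, 0 ≤ t → t ≤ n → t ≤ m → V n t = V m t := by
    intro n m t h0 hn hm
    exact IsSol.unique (N := N) (T := min n m) hν ((hVs n).mono (min_le_left _ _))
      ((hVs m).mono (min_le_right _ _)) (hV n) (hV m) hZ t ⟨h0, le_min hn hm⟩
  have heq : ∀ (n : ℕ) (t : ℝ), t ≤ n → V ⌈t⌉₊ (max t 0) = V n (max t 0) := fun n t ht =>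
    hVV _ _ _ (le_max_right _ _) (max_le (Nat.le_ceil t) (Nat.cast_nonneg _))
      (max_le ht (Nat.cast_nonneg _))
  refine ⟨fun t => V ⌈t⌉₊ (max t 0), continuous_iff_continuousAt.2 fun t => ?_, fun T => ?_⟩
  · obtain ⟨n, hn⟩ := exists_nat_gt t
    have h1 : ContinuousAt (fun t => V n (max t 0)) t :=
      ((hV n).comp (continuous_id.max continuous_const)).continuousAt
    exact h1.congr (Filter.mem_of_superset (Iio_mem_nhds hn)
      fun s (hs : s < (n : ℝ)) => (heq n s hs.le).symm)
  · obtain ⟨n, hn⟩ := exists_nat_ge T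
    have h1 : ∀ t ∈ Icc 0 T, V ⌈t⌉₊ (max t 0) = V n t := fun t ht => by
      rw [heq n t (ht.2.trans hn), max_eq_left ht.1]
    exact ((hVs n).mono hn).congr h1 fun t ht => by simp only [h1 t ht]

end Nonlinearity
end FrequencyScale
end Nonlinear

/-! ### Weak continuity in the data -/

section Nonlinear

variable {X : Type*} [NormedAddCommGroup X] [InnerProductSpace ℝ X] [CompleteSpace X]

namespace FrequencyScale

variable {S : FrequencyScale X} {ν T : ℝ}

/-- Pointwise weak convergence of solutions of the linear equation is uniform in time: tested with
`J² x` they are equicontinuous, and these test elements are dense. -/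
theorem eventually_abs_inner_le {w f : ℕ → ℝ → X} {W0 : ℕ → X}
    (h : ∀ n, S.IsLinearSolution ν T (w n) (f n) (W0 n)) (hw : ∀ n, Continuous (w n))
    (hf : ∀ n, Continuous (f n)) {M : ℝ} (hwM : ∀ n, ∀ t ∈ Icc 0 T, ‖w n t‖ ≤ M)
    (hfM : ∀ n, ∀ t ∈ Icc 0 T, ‖f n t‖ ≤ M) (hT : 0 ≤ T)
    (hlim : ∀ t ∈ Icc 0 T, WeakNull fun n => w n t) (y : X) {ε : ℝ} (hε : 0 < ε) :
    ∀ᶠ n in atTop, ∀ t ∈ Icc 0 T, |⟪y, w n t⟫_ℝ| ≤ ε := by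
  have hM0 : 0 ≤ M := (norm_nonneg _).trans (hwM 0 0 ⟨le_rfl, hT⟩)
  -- approximation of `y` by an element of the range of `J²`
  have h0 := ((tendsto_const_nhds (x := y)).sub (S.P_tendsto y)).norm
  rw [sub_self, norm_zero] at h0
  obtain ⟨k, hk⟩ := (h0.eventually (gt_mem_nhds (show 0 < ε / (3 * (M + 1)) by positivity))).exists
  set x := S.Λ k (S.Λ k y) with hx
  have hxy : S.J (S.J x) = S.P k y := by
    rw [hx, S.J_Λ, S.P_Λ_self, S.J_Λ]
  -- equicontinuity
  have hlip : ∀ n, ∀ s ∈ Icc 0 T, ∀ t ∈ Icc 0 T,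
      |⟪S.P k y, w n t - w n s⟫_ℝ| ≤ ‖x‖ * ((|ν| * M + M) * |t - s|) := by
    intro n s hs t ht
    have c1 := (hw n)
    have c2 : Continuous fun s => S.J (f n s) := by have := hf n; fun_prop
    have e1 : S.J (S.J (w n t - w n s)) = -(∫ r in s..t, (ν • w n r + S.J (f n r))) := by
      have e2 := h n t ht
      have e3 := h n s hs
      have c3 : Continuous fun s => ν • w n s := by fun_prop
      rw [intervalIntegral.integral_add (c3.intervalIntegrable _ _) (c2.intervalIntegrable _ _),
        intervalIntegral.integral_smul,
        ← intervalIntegral.integral_interval_sub_left (c1.intervalIntegrable 0 t)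
          (c1.intervalIntegrable 0 s),
        ← intervalIntegral.integral_interval_sub_left (c2.intervalIntegrable 0 t)
          (c2.intervalIntegrable 0 s), map_sub, map_sub, smul_sub]
      rw [← e3] at e2
      rw [← sub_eq_zero] at e2 ⊢
      rw [← e2]
      abel
    rw [← hxy, S.J_symm, S.J_symm]
    refine (abs_real_inner_le_norm _ _).trans (mul_le_mul_of_nonneg_left ?_ (norm_nonneg _))
    rw [e1, norm_neg]
    refine intervalIntegral.norm_integral_le_of_norm_le_const fun r hr => ?_
    have hr' : r ∈ Icc 0 T := (convex_Icc 0 T).ordConnected.uIcc_subset hs ht (uIoc_subset_uIcc hr)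
    refine (norm_add_le _ _).trans (add_le_add ?_ ((S.norm_J_le _).trans (hfM n r hr')))
    rw [norm_smul, Real.norm_eq_abs]
    exact mul_le_mul_of_nonneg_left (hwM n r hr') (abs_nonneg _)
  set L := ‖x‖ * (|ν| * M + M) with hL
  have hL0 : 0 ≤ L := by positivity
  obtain ⟨F, hFs, hFf, hF⟩ := isCompact_Icc.finite_cover_balls (s := Icc 0 T)
    (show 0 < ε / (3 * (L + 1)) by positivity)
  have hev : ∀ᶠ n in atTop, ∀ s ∈ F, |⟪S.P k y, w n s⟫_ℝ| ≤ ε / 3 := by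
    refine (hFf.eventually_all).2 fun s hs => ?_
    obtain ⟨n0, hn0⟩ := Metric.tendsto_atTop.1 (hlim s (hFs hs) (S.P k y)) (ε / 3) (by positivity)
    filter_upwards [eventually_ge_atTop n0] with n hn
    have := hn0 n hn
    rw [Real.dist_0_eq_abs] at this
    exact this.le
  filter_upwards [hev] with n hn t ht
  obtain ⟨s, hsF, hst⟩ := mem_iUnion₂.1 (hF ht)
  have e1 : ⟪y, w n t⟫_ℝ = ⟪y - S.P k y, w n t⟫_ℝ + ⟪S.P k y, w n t - w n s⟫_ℝ
      + ⟪S.P k y, w n s⟫_ℝ := by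
    rw [inner_sub_left, inner_sub_right]; ring
  have e2 : |⟪y - S.P k y, w n t⟫_ℝ| ≤ ε / 3 := by
    refine (abs_real_inner_le_norm _ _).trans ?_
    calc ‖y - S.P k y‖ * ‖w n t‖ ≤ (ε / (3 * (M + 1))) * (M + 1) := by
          gcongr
          linarith [hwM n t ht]
      _ = ε / 3 := by field_simp
  have e3 : |⟪S.P k y, w n t - w n s⟫_ℝ| ≤ ε / 3 := by
    refine (hlip n s (hFs hsF) t ht).trans ?_
    rw [Metric.mem_ball, Real.dist_eq] at hst
    calc ‖x‖ * ((|ν| * M + M) * |t - s|) = L * |t - s| := by rw [hL]; ring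
      _ ≤ (L + 1) * (ε / (3 * (L + 1))) := by
          gcongr
          linarith
      _ = ε / 3 := by field_simp
  rw [e1]
  refine (abs_add_le _ _).trans ?_
  have := abs_add_le ⟪y - S.P k y, w n t⟫_ℝ ⟪S.P k y, w n t - w n s⟫_ℝ
  have := hn s hsF
  linarith

namespace Nonlinearity

variable (N : Nonlinearity S) {Z V : ℝ → X} {U : ℕ → ℝ → X} {V0 : X} {U0 : ℕ → X}

/-- Weak continuity in the data.  The difference `w` of two solutions solves a linear equation
`w = f - L w` with a Volterra operator `L`.  Its iteration splits `w` into a weakly null part and a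
remainder that is as small as the terms of an exponential series. -/
theorem eventually_inner_sub_le (hν : 0 < ν) (hT : 0 ≤ T) (hZ : Continuous Z)
    (hQZ : ∀ t, N.Q (Z t) = Z t) (hU : ∀ n, Continuous (U n)) (hV : Continuous V)
    (hUs : ∀ n, N.IsSol ν T Z (U n) (U0 n)) (hVs : N.IsSol ν T Z V V0)
    (hQU0 : ∀ n, N.Q (U0 n) = U0 n) {R : ℝ} (hR : ∀ n, ‖U0 n‖ ≤ R)
    (h0 : WeakNull fun n => U0 n - V0) (y : X) {ε : ℝ} (hε : 0 < ε) :
    ∀ᶠ n in atTop, ∀ t ∈ Icc 0 T, |⟪y, U n t - V t⟫_ℝ| ≤ ε := by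
  obtain ⟨K, hK0, hK⟩ := N.exists_bound hν hT hZ hQZ R
  obtain ⟨M1, hM1⟩ := isCompact_Icc.exists_bound_of_continuousOn (hZ.continuousOn (s := Icc 0 T))
  obtain ⟨M2, hM2⟩ := isCompact_Icc.exists_bound_of_continuousOn (hV.continuousOn (s := Icc 0 T))
  have hM10 : 0 ≤ M1 := (norm_nonneg _).trans (hM1 0 ⟨le_rfl, hT⟩)
  have hM20 : 0 ≤ M2 := (norm_nonneg _).trans (hM2 0 ⟨le_rfl, hT⟩)
  have hC := N.C_nonneg
  have hUK : ∀ n, ∀ t ∈ Icc 0 T, ‖U n t‖ ≤ K := fun n =>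
    hK (U0 n) (U n) (fun _ => 1) (hR n) (hQU0 n) (hU n) continuous_const (fun _ => zero_le_one)
      (fun _ => le_rfl) (by simpa only [one_smul] using! hUs n)
  set M := K + M1 + M2 with hM
  have hM0 : 0 ≤ M := by positivity
  have hu : ∀ n, ∀ t ∈ Icc 0 T, ‖U n t + Z t‖ ≤ M := fun n t ht =>
    (norm_add_le _ _).trans (by linarith [hUK n t ht, hM1 t ht])
  have hv : ∀ t ∈ Icc 0 T, ‖V t + Z t‖ ≤ M := fun t ht =>
    (norm_add_le _ _).trans (by linarith [hM2 t ht, hM1 t ht])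
  have hw : ∀ n, ∀ t ∈ Icc 0 T, ‖U n t - V t‖ ≤ M := fun n t ht =>
    (norm_sub_le _ _).trans (by linarith [hUK n t ht, hM2 t ht])
  -- the linear forcing
  let G : ℕ → (ℝ → X) → ℝ → X := fun n a t => N.B (a t) (U n t + Z t) + N.B (V t + Z t) (a t)
  have hGc : ∀ n a, Continuous a → Continuous (G n a) := fun n a ha => by
    have := hU n
    fun_prop
  have hG : ∀ n a, ∀ t ∈ Icc 0 T, ‖G n a t‖ ≤ 2 * N.C * M * ‖a t‖ := fun n a t ht => by
    have h1 := N.norm_B_le' (a t) (U n t + Z t)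
    have h2 := N.norm_B_le' (V t + Z t) (a t)
    have h3 : N.C * ‖a t‖ * ‖U n t + Z t‖ ≤ N.C * ‖a t‖ * M := by
      have := hu n t ht
      gcongr
    have h4 : N.C * ‖V t + Z t‖ * ‖a t‖ ≤ N.C * M * ‖a t‖ := by
      have := hv t ht
      gcongr
    refine (norm_add_le _ _).trans ?_
    linarith
  have hwc : ∀ n, Continuous fun t => U n t - V t := fun n => (hU n).sub hV
  have hws : ∀ n, S.IsLinearSolution ν T (fun t => U n t - V t) (G n fun t => U n t - V t)
      (U0 n - V0) := fun n => by
    have hUn := hU n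
    refine (IsLinearSolution.sub (hUs n) hVs (hU n) (by fun_prop) hV (by fun_prop)).congr
      (fun _ _ => rfl) fun t _ => ?_
    simp only [G, map_add, map_sub, sub_apply, add_apply]
    abel
  obtain ⟨c, hc⟩ : ∃ c, c = ν⁻¹ * (2 * N.C * M) ^ 2 := ⟨_, rfl⟩
  have hc0 : 0 ≤ c := by rw [hc]; positivity
  -- the splitting after `k` iterations
  have hsplit : ∀ k : ℕ, ∃ (a : ℕ → ℝ → X) (A : ℝ), (∀ n, Continuous (a n)) ∧
      (∀ n, ∀ t ∈ Icc 0 T, ‖a n t‖ ≤ A) ∧ (∀ t ∈ Icc 0 T, WeakNull fun n => a n t) ∧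
      ∀ n, ∀ t ∈ Icc 0 T, ‖(U n t - V t) - a n t‖ ^ 2 ≤ M ^ 2 * ((c * t) ^ k / k.factorial) := by
    intro k
    induction k with
    | zero =>
      refine ⟨fun _ _ => 0, 0, fun _ => continuous_const, fun n t _ => by simp,
        fun t _ y => by simp, fun n t ht => ?_⟩
      simp only [sub_zero, pow_zero, Nat.factorial_zero, Nat.cast_one, div_one, mul_one]
      have := hw n t ht
      gcongr
    | succ k ih =>
      obtain ⟨a, A, hac, haA, haw, hr⟩ := ih
      have hA0 : 0 ≤ A := (norm_nonneg _).trans (haA 0 0 ⟨le_rfl, hT⟩)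
      choose b hbc hb using fun n => S.exists_isLinearSolution hν hT (hGc n (a n) (hac n))
        (U0 n - V0)
      have hGA : ∀ n, ∀ t ∈ Icc 0 T, ‖G n (a n) t‖ ≤ 2 * N.C * M * A := fun n t ht => by
        refine (hG n (a n) t ht).trans ?_
        have := haA n t ht
        gcongr
      have hbA : ∀ n, ∀ t ∈ Icc 0 T, ‖b n t‖ ≤ Real.sqrt ((R + ‖V0‖) ^ 2
          + ν⁻¹ * (T * (2 * N.C * M * A) ^ 2)) := fun n t ht => by
        refine Real.le_sqrt_of_sq_le (((hb n).norm_sq_le hν (hbc n) (hGc n _ (hac n)) t ht).trans ?_)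
        have e1 : ‖U0 n - V0‖ ≤ R + ‖V0‖ := (norm_sub_le _ _).trans (by linarith [hR n])
        have e2 : ∫ s in (0 : ℝ)..t, ‖G n (a n) s‖ ^ 2
            ≤ ∫ s in (0 : ℝ)..t, (2 * N.C * M * A) ^ 2 :=
          integral_mono_of_continuous ((hGc n _ (hac n)).norm.pow 2) continuous_const ht.1
            fun s hs => by
              have := hGA n s ⟨hs.1, hs.2.trans ht.2⟩
              simp only [Pi.pow_apply]
              gcongr
        rw [intervalIntegral.integral_const, smul_eq_mul, sub_zero] at e2
        have e3 : t * (2 * N.C * M * A) ^ 2 ≤ T * (2 * N.C * M * A) ^ 2 := by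
          have := ht.2
          gcongr
        have e4 := e2.trans e3
        gcongr
      have hweak : ∀ t ∈ Icc 0 T, WeakNull fun n => S.J (G n (a n) t) := fun t ht => by
        have e1 := N.weakNull_left (fun n => a n t) (fun n => U n t + Z t) (A + M) (haw t ht)
          (fun n => by linarith [haA n t ht]) (fun n => by linarith [hu n t ht])
        have e2 := N.weakNull_right (fun _ => V t + Z t) (fun n => a n t) (A + M) (haw t ht)
          (fun n => by linarith [hv t ht]) (fun n => by linarith [haA n t ht])
        simpa only [G, map_add] using e1.add e2
      refine ⟨b, _, hbc, hbA, IsLinearSolution.weakNull hν hb hbc (fun n => hGc n _ (hac n)) hGA hbA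
        h0 hweak, fun n t ht => ?_⟩
      have e1 := ((hws n).sub (hb n) (hwc n) (hGc n _ (hwc n)) (hbc n)
        (hGc n _ (hac n))).norm_sq_le hν ((hwc n).sub (hbc n))
        ((hGc n _ (hwc n)).sub (hGc n _ (hac n))) t ht
      simp only [sub_self, norm_zero, ne_eq, OfNat.ofNat_ne_zero, not_false_eq_true, zero_pow,
        zero_add] at e1
      have e2 : ∫ s in (0 : ℝ)..t, ‖G n (fun t => U n t - V t) s - G n (a n) s‖ ^ 2
          ≤ ∫ s in (0 : ℝ)..t, ((2 * N.C * M) ^ 2 * (M ^ 2 * (c ^ k / k.factorial))) * s ^ k := by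
        refine integral_mono_of_continuous
          (((hGc n _ (hwc n)).sub (hGc n _ (hac n))).norm.pow 2) (by fun_prop) ht.1 fun s hs => ?_
        have hs' : s ∈ Icc 0 T := ⟨hs.1, hs.2.trans ht.2⟩
        have e3 : G n (fun t => U n t - V t) s - G n (a n) s
            = G n (fun t => U n t - V t - a n t) s := by
          simp only [G, map_sub, sub_apply]
          abel
        have e4 := hG n (fun t => U n t - V t - a n t) s hs'
        have e5 := hr n s hs'
        calc ‖G n (fun t => U n t - V t) s - G n (a n) s‖ ^ 2
            ≤ (2 * N.C * M * ‖U n s - V s - a n s‖) ^ 2 := by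
              rw [e3]
              gcongr
          _ = (2 * N.C * M) ^ 2 * ‖U n s - V s - a n s‖ ^ 2 := by ring
          _ ≤ (2 * N.C * M) ^ 2 * (M ^ 2 * ((c * s) ^ k / k.factorial)) := by gcongr
          _ = _ := by rw [mul_pow]; ring
      rw [intervalIntegral.integral_const_mul, integral_pow] at e2
      refine e1.trans ((mul_le_mul_of_nonneg_left e2 (inv_nonneg.2 hν.le)).trans (le_of_eq ?_))
      have e6 : (c * t) ^ (k + 1) = c ^ k * (ν⁻¹ * (2 * N.C * M) ^ 2) * t ^ (k + 1) := by
        rw [← hc]; ring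
      rw [Nat.factorial_succ, e6, zero_pow k.succ_ne_zero, sub_zero]
      push_cast
      field_simp
  have hpt : ∀ t ∈ Icc 0 T, WeakNull fun n => U n t - V t := by
    intro t ht
    refine WeakNull.of_approx fun ε hε => ?_
    have h1 := (FloorSemiring.tendsto_pow_div_factorial_atTop (c * t)).const_mul (M ^ 2)
    rw [mul_zero] at h1
    obtain ⟨k, hk⟩ := (h1.eventually (gt_mem_nhds (show 0 < ε ^ 2 by positivity))).exists
    obtain ⟨a, A, -, -, haw, hr⟩ := hsplit k
    exact ⟨fun n => a n t, haw t ht, fun n =>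
      le_of_sq_le_sq ((hr n t ht).trans hk.le) hε.le⟩
  refine eventually_abs_inner_le hws hwc (fun n => hGc n _ (hwc n)) (M := M + 2 * N.C * M * M)
    (fun n t ht => (hw n t ht).trans (by nlinarith [mul_nonneg hC (mul_nonneg hM0 hM0)]))
    (fun n t ht => ?_) hT hpt y hε
  refine (hG n (fun t => U n t - V t) t ht).trans ?_
  have := hw n t ht
  calc 2 * N.C * M * ‖U n t - V t‖ ≤ 2 * N.C * M * M := by gcongr
    _ ≤ _ := by linarith

end Nonlinearity
end FrequencyScale
end Nonlinear

/-! ### Fourier multipliers on `L²` -/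

section Multipliers

/-- Multiplication by the bounded function `g` on `L²(ℝ²; ℂ²)`. -/
def mulOp {g : Plane → ℂ} (hg : MemLp g ∞ (volume : Measure Plane)) : L2 →L[ℝ] L2 :=
  ((ContinuousLinearMap.lsmul ℂ ℂ).holderL volume ∞ 2 2 hg.toLp).restrictScalars ℝ

theorem coeFn_mulOp {g : Plane → ℂ} (hg : MemLp g ∞ (volume : Measure Plane)) (f : L2) :
    mulOp hg f =ᵐ[volume] fun x => g x • f x := by
  filter_upwards [(ContinuousLinearMap.lsmul ℂ ℂ : ℂ →L[ℂ] CVec →L[ℂ] CVec).coeFn_holder (r := 2)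
    hg.toLp f, hg.coeFn_toLp] with x h1 h2
  rw [h2] at h1
  exact h1

theorem toDistr_mulOp {g : Plane → ℂ} (hg : MemLp g ∞ (volume : Measure Plane))
    (hg' : g.HasTemperateGrowth) (f : L2) :
    ((mulOp hg f : L2) : Distr) = TemperedDistribution.smulLeftCLM CVec g (f : Distr) := by
  ext1 u
  simp only [Lp.toTemperedDistribution_apply, TemperedDistribution.smulLeftCLM_apply_apply]
  refine integral_congr_ae ?_
  filter_upwards [coeFn_mulOp hg f] with x hx
  simp [hx, hg', smul_smul, mul_comm]

theorem memLp_top_of_le {g : Plane → ℝ} (hg : Measurable g) {C : ℝ} (h : ∀ x, |g x| ≤ C) :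
    MemLp (fun x => (g x : ℂ)) ∞ (volume : Measure Plane) :=
  memLp_top_of_bound (Complex.measurable_ofReal.comp hg).aestronglyMeasurable C
    (ae_of_all _ fun x => by simpa using h x)

theorem cvec_inner_eq (a b : CVec) : ⟪a, b⟫_ℝ = (inner ℂ a b : ℂ).re := by
  simp [PiLp.inner_apply, Complex.inner]

theorem l2_inner_eq (f g : L2) : ⟪f, g⟫_ℝ = (inner ℂ f g : ℂ).re := by
  rw [L2.inner_def, L2.inner_def, ← RCLike.re_eq_complex_re, ← integral_re (L2.integrable_inner f g)]
  simp [cvec_inner_eq]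

theorem continuous_weight (s : ℝ) : Continuous (weight s) := by
  unfold weight
  refine Continuous.rpow_const (by fun_prop) fun x => Or.inl (by positivity)

theorem weight_le_weight {s r : ℝ} (h : s ≤ r) (ξ : Plane) : weight s ξ ≤ weight r ξ :=
  Real.rpow_le_rpow_of_exponent_le (by nlinarith [sq_nonneg ‖(2 * Real.pi) • ξ‖]) (by linarith)

theorem weight_le_one {s : ℝ} (hs : s ≤ 0) (ξ : Plane) : weight s ξ ≤ 1 := by
  simpa using weight_le_weight hs ξ

theorem memLp_top_weight {s : ℝ} (hs : s ≤ 0) :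
    MemLp (fun ξ => (weight s ξ : ℂ)) ∞ (volume : Measure Plane) :=
  memLp_top_of_le (continuous_weight s).measurable (C := 1) fun x => by
    rw [abs_of_pos (weight_pos _ _)]
    exact weight_le_one hs x

/-- The set of frequencies at which the weight of order `α` is at most `n`. -/
def lowFreq (α : ℝ) (n : ℕ) : Set Plane := {ξ | weight α ξ ≤ n}

theorem measurableSet_lowFreq (α : ℝ) (n : ℕ) : MeasurableSet (lowFreq α n) :=
  (isClosed_le (continuous_weight α) continuous_const).measurableSet

theorem memLp_top_cutoff (α : ℝ) (n : ℕ) :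
    MemLp (fun ξ => (((lowFreq α n).indicator (fun _ => (1 : ℝ)) ξ : ℝ) : ℂ)) ∞
      (volume : Measure Plane) :=
  memLp_top_of_le (measurable_const.indicator (measurableSet_lowFreq α n)) (C := 1) fun x => by
    by_cases h : x ∈ lowFreq α n <;> simp [h]

theorem memLp_top_weight_cutoff (α : ℝ) (n : ℕ) :
    MemLp (fun ξ => (((lowFreq α n).indicator (weight α) ξ : ℝ) : ℂ)) ∞
      (volume : Measure Plane) :=
  memLp_top_of_le ((continuous_weight α).measurable.indicator (measurableSet_lowFreq α n)) (C := n)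
    fun x => by
    by_cases h : x ∈ lowFreq α n
    · simp only [h, indicator_of_mem, abs_of_pos (weight_pos _ _)]
      exact h
    · simp [h]

theorem mulOp_symm {g : Plane → ℝ} (hg : MemLp (fun x => (g x : ℂ)) ∞ (volume : Measure Plane))
    (f h : L2) : ⟪mulOp hg f, h⟫_ℝ = ⟪f, mulOp hg h⟫_ℝ := by
  rw [L2.inner_def, L2.inner_def]
  refine integral_congr_ae ?_
  filter_upwards [coeFn_mulOp hg f, coeFn_mulOp hg h] with x h1 h2
  rw [h1, h2, Complex.coe_smul, Complex.coe_smul, real_inner_smul_left, real_inner_smul_right]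

theorem norm_mulOp_le {g : Plane → ℂ} (hg : MemLp g ∞ (volume : Measure Plane))
    (h : ∀ x, ‖g x‖ ≤ 1) (f : L2) : ‖mulOp hg f‖ ≤ ‖f‖ := by
  refine Lp.norm_le_norm_of_ae_le ?_
  filter_upwards [coeFn_mulOp hg f] with x h1
  rw [h1, norm_smul]
  exact mul_le_of_le_one_left (norm_nonneg _) (h x)

theorem mulOp_mulOp {g h k : Plane → ℂ} (hg : MemLp g ∞ (volume : Measure Plane))
    (hh : MemLp h ∞ (volume : Measure Plane)) (hk : MemLp k ∞ (volume : Measure Plane))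
    (e : ∀ x, g x * h x = k x) (f : L2) : mulOp hg (mulOp hh f) = mulOp hk f := by
  refine Lp.ext ?_
  filter_upwards [coeFn_mulOp hg (mulOp hh f), coeFn_mulOp hh f, coeFn_mulOp hk f] with x h1 h2 h3
  rw [h1, h2, h3, smul_smul, e]

/-- Dominated convergence to zero in `L²`. -/
theorem tendsto_eLpNorm_zero_of_dominated {E : Type*} [NormedAddCommGroup E] {F : ℕ → Plane → E}
    {b : Plane → ℝ} (hF : ∀ n, AEStronglyMeasurable (F n) volume) (hb : MemLp b 2 volume)
    (hFb : ∀ n, ∀ᵐ x, ‖F n x‖ ≤ b x) (hlim : ∀ᵐ x, Tendsto (fun n => F n x) atTop (𝓝 0)) :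
    Tendsto (fun n => eLpNorm (F n) 2 volume) atTop (𝓝 0) := by
  have hlin : Tendsto (fun n => ∫⁻ x, ‖F n x‖ₑ ^ (2 : ℝ)) atTop (𝓝 (∫⁻ _ : Plane, 0)) := by
    refine tendsto_lintegral_of_dominated_convergence' (fun x => ‖b x‖ₑ ^ (2 : ℝ))
      (fun n => (hF n).enorm.pow_const _) (fun n => ?_) ?_ ?_
    · filter_upwards [hFb n] with x hx
      gcongr
      rw [enorm_le_iff_norm_le]
      exact hx.trans (le_abs_self _)
    · have := lintegral_rpow_enorm_lt_top_of_eLpNorm_lt_top (p := 2) (by norm_num) (by norm_num)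
        hb.eLpNorm_lt_top
      simpa using this.ne
    · filter_upwards [hlim] with x hx
      have h1 := (ENNReal.continuous_rpow_const (y := 2)).tendsto (0 : ℝ≥0∞) |>.comp
        ((continuous_enorm.tendsto (0 : E)).comp hx |> fun h => by simpa using h)
      simpa [Function.comp_def] using h1
  simp only [eLpNorm_eq_lintegral_rpow_enorm_toReal (p := 2) (by norm_num) (by norm_num)]
  have h2 := (ENNReal.continuous_rpow_const (y := (1 / 2 : ℝ))).tendsto (∫⁻ _ : Plane, 0) |>.comp hlin
  simpa [Function.comp_def] using h2

theorem mem_lowFreq_eventually (α : ℝ) (x : Plane) : ∀ᶠ n : ℕ in atTop, x ∈ lowFreq α n := by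
  obtain ⟨N, hN⟩ := exists_nat_ge (weight α x)
  filter_upwards [eventually_ge_atTop N] with n hn
  exact hN.trans (by exact_mod_cast hn)

theorem lowFreq_mono (α : ℝ) {n m : ℕ} (h : n ≤ m) : lowFreq α n ⊆ lowFreq α m := fun x hx =>
  le_trans (show weight α x ≤ n from hx) (by exact_mod_cast h)

theorem tendsto_cutoff (α : ℝ) (f : L2) :
    Tendsto (fun n => mulOp (memLp_top_cutoff α n) f) atTop (𝓝 f) := by
  rw [tendsto_iff_norm_sub_tendsto_zero]
  have h1 : ∀ n, ((mulOp (memLp_top_cutoff α n) f - f : L2) : Plane → CVec) =ᵐ[volume]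
      (fun n x => ((((lowFreq α n).indicator (fun _ => (1 : ℝ)) x : ℝ) : ℂ) - 1) • f x) n := fun n => by
    filter_upwards [Lp.coeFn_sub (mulOp (memLp_top_cutoff α n) f) f,
      coeFn_mulOp (memLp_top_cutoff α n) f] with x h1 h2
    rw [h1, Pi.sub_apply, h2, sub_smul, one_smul]
  have h2 := tendsto_eLpNorm_zero_of_dominated (b := fun x => ‖f x‖)
    (F := fun n x => ((((lowFreq α n).indicator (fun _ => (1 : ℝ)) x : ℝ) : ℂ) - 1) • f x)
    (fun n => (Lp.aestronglyMeasurable _).congr (h1 n)) (Lp.memLp f).norm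
    (fun n => ae_of_all _ fun x => by
      by_cases h : x ∈ lowFreq α n <;> simp [h])
    (ae_of_all _ fun x => by
      refine tendsto_const_nhds.congr' ?_
      filter_upwards [mem_lowFreq_eventually α x] with n hn
      simp [hn])
  simp only [Lp.norm_def]
  have h3 := (ENNReal.tendsto_toReal ENNReal.zero_ne_top).comp h2
  refine Tendsto.congr (fun n => ?_) h3
  simp only [Function.comp_def]
  rw [eLpNorm_congr_ae (h1 n)]

/-- The operator `A^(α/2)` on the frequency side, with cutoffs at the frequencies where its symbol
`(1 + |x|²)^(α/2)` is at most `n`. -/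
def freqScale {α : ℝ} (hα : 0 ≤ α) : FrequencyScale L2 where
  J := mulOp (memLp_top_weight (neg_nonpos.2 hα))
  Λ n := mulOp (memLp_top_weight_cutoff α n)
  P n := mulOp (memLp_top_cutoff α n)
  J_symm := mulOp_symm _
  Λ_symm n := mulOp_symm _
  J_Λ n := mulOp_mulOp _ _ _ fun x => by
    by_cases h : x ∈ lowFreq α n
    · simp only [h, indicator_of_mem]
      rw [← Complex.ofReal_mul, weight_mul]; simp
    · simp [h]
  Λ_J n := mulOp_mulOp _ _ _ fun x => by
    by_cases h : x ∈ lowFreq α n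
    · simp only [h, indicator_of_mem]
      rw [← Complex.ofReal_mul, weight_mul]; simp
    · simp [h]
  Λ_P n m x hnm := mulOp_mulOp _ _ _ (fun x => by
    by_cases h : x ∈ lowFreq α n
    · simp [h, lowFreq_mono α hnm h]
    · simp [h]) x
  P_Λ n m x hnm := mulOp_mulOp _ _ _ (fun x => by
    by_cases h : x ∈ lowFreq α n
    · simp [h, lowFreq_mono α hnm h]
    · simp [h]) x
  P_P n m x hnm := mulOp_mulOp _ _ _ (fun x => by
    by_cases h : x ∈ lowFreq α n
    · simp [h, lowFreq_mono α hnm h]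
    · simp [h]) x
  P_tendsto := tendsto_cutoff α
  norm_P_le n := norm_mulOp_le _ fun x => by
    by_cases h : x ∈ lowFreq α n <;> simp [h]
  norm_J_le := norm_mulOp_le _ fun x => by
    rw [Complex.norm_real, Real.norm_of_nonneg (weight_pos _ _).le]
    exact weight_le_one (neg_nonpos.2 hα) x

end Multipliers

/-! ### Fields given by Fourier integrals -/

section Wiener

theorem integral_fourierInv_smul_eq {f : Plane → ℂ} {G : Plane → CVec} (hf : Integrable f)
    (hG : Integrable G) : ∫ x, 𝓕⁻ f x • G x = ∫ x, f x • 𝓕⁻ G x := by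
  have h := VectorFourier.integral_fourierIntegral_smul_eq_flip (μ := volume) (ν := volume)
    (L := -innerₗ Plane) (f := f) (g := G) (e := Real.fourierChar) Real.continuous_fourierChar
    (by simp only [LinearMap.neg_apply, innerₗ_apply_apply]; fun_prop) hf hG
  have h2 : (-innerₗ Plane).flip = -innerₗ Plane := by
    ext x y; simp [real_inner_comm]
  rw [h2] at h
  exact h

/-- For integrable elements of `L²`, the Fourier transform of `L²` is given by the Fourier integral. -/
theorem fourierInv_ae_eq (G : L2) (hG : Integrable G) :
    ((𝓕⁻ G : L2) : Plane → CVec) =ᵐ[volume] 𝓕⁻ (G : Plane → CVec) := by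
  have hc : Continuous (𝓕⁻ (G : Plane → CVec)) := by
    rw [Real.fourierInv_eq_fourier_comp_neg]
    exact VectorFourier.fourierIntegral_continuous Real.continuous_fourierChar
      (by simp only [innerₗ_apply_apply]; fun_prop) hG.comp_neg
  refine ae_eq_of_integral_contDiff_smul_eq ((Lp.memLp (𝓕⁻ G : L2)).locallyIntegrable one_le_two)
    hc.locallyIntegrable fun g hg hgc => ?_
  have hg₁ : HasCompactSupport (Complex.ofRealCLM ∘ g) := hgc.comp_left rfl
  have hg₂ : ContDiff ℝ (⊤ : ℕ∞) (Complex.ofRealCLM ∘ g) := by fun_prop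
  set φ : 𝓢(Plane, ℂ) := hg₁.toSchwartzMap hg₂ with hφ
  have hφx : ∀ x, φ x = (g x : ℂ) := fun x => by simp [hφ]
  have h1 := congrArg (fun u : Distr => u φ) (Lp.fourierInv_toTemperedDistribution_eq G)
  simp only [TemperedDistribution.fourierInv_apply, Lp.toTemperedDistribution_apply,
    SchwartzMap.fourierInv_coe] at h1
  rw [integral_fourierInv_smul_eq φ.integrable hG] at h1
  simpa [hφx] using h1.symm

/-- The function `𝓕⁻ (g F)`, given by the Fourier integral, for a square integrable symbol `g` and
`F ∈ L²`. -/
def symEval (g : Plane → ℂ) (F : L2) (x : Plane) : CVec := 𝓕⁻ (fun ξ => g ξ • F ξ) x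

variable {g : Plane → ℂ}

theorem integrable_symbol_smul (hg : MemLp g 2 (volume : Measure Plane)) (F : L2) :
    Integrable (fun ξ => g ξ • F ξ) :=
  memLp_one_iff_integrable.1 ((Lp.memLp F).smul (r := 1) hg)

theorem integral_norm_symbol_smul_le (hg : MemLp g 2 (volume : Measure Plane)) (F : L2) :
    ∫ ξ, ‖g ξ • F ξ‖ ≤ (eLpNorm g 2 volume).toReal * ‖F‖ := by
  have h1 := eLpNorm_smul_le_mul_eLpNorm (p := 2) (q := 2) (r := 1) (Lp.memLp F).1 hg.1
  have h2 : ∫ ξ, ‖g ξ • F ξ‖ = (eLpNorm (g • (F : Plane → CVec)) 1 volume).toReal := by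
    rw [eLpNorm_one_eq_lintegral_enorm, integral_norm_eq_lintegral_enorm
      (integrable_symbol_smul hg F).aestronglyMeasurable]
    rfl
  rw [h2, Lp.norm_def, ← ENNReal.toReal_mul]
  exact ENNReal.toReal_mono (ENNReal.mul_ne_top hg.eLpNorm_lt_top.ne (Lp.eLpNorm_lt_top F).ne) h1

theorem norm_symEval_le (hg : MemLp g 2 (volume : Measure Plane)) (F : L2) (x : Plane) :
    ‖symEval g F x‖ ≤ (eLpNorm g 2 volume).toReal * ‖F‖ :=
  (VectorFourier.norm_fourierIntegral_le_integral_norm _ _ _ _ _).trans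
    (integral_norm_symbol_smul_le hg F)

theorem continuous_symEval (hg : MemLp g 2 (volume : Measure Plane)) (F : L2) :
    Continuous (symEval g F) := by
  have : symEval g F = 𝓕 (fun ξ => g (-ξ) • F (-ξ)) := by
    ext1 x
    rw [symEval, Real.fourierInv_eq_fourier_comp_neg]
  rw [this]
  exact VectorFourier.fourierIntegral_continuous Real.continuous_fourierChar
    (by simp only [innerₗ_apply_apply]; fun_prop) (integrable_symbol_smul hg F).comp_neg

theorem symEval_add (hg : MemLp g 2 (volume : Measure Plane)) (F G : L2) (x : Plane) :
    symEval g (F + G) x = symEval g F x + symEval g G x := by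
  have h1 : 𝓕⁻ (fun ξ => g ξ • (F + G : L2) ξ) x
      = 𝓕⁻ (fun ξ => g ξ • F ξ + g ξ • G ξ) x :=
    Real.fourierInv_congr_ae (by
      filter_upwards [Lp.coeFn_add F G] with ξ h
      rw [h, Pi.add_apply, smul_add]) x
  rw [symEval, h1, symEval, symEval, Real.fourierInv_eq, Real.fourierInv_eq, Real.fourierInv_eq,
    ← integral_add]
  · simp only [smul_add]
  · simpa using (Real.fourierIntegral_convergent_iff (-x)).2 (integrable_symbol_smul hg F)
  · simpa using (Real.fourierIntegral_convergent_iff (-x)).2 (integrable_symbol_smul hg G)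

theorem symEval_smul (c : ℝ) (F : L2) (x : Plane) :
    symEval g (c • F) x = c • symEval g F x := by
  have h1 : 𝓕⁻ (fun ξ => g ξ • (c • F : L2) ξ) x = 𝓕⁻ (fun ξ => c • g ξ • F ξ) x :=
    Real.fourierInv_congr_ae (by
      filter_upwards [Lp.coeFn_smul c F] with ξ h
      rw [h, Pi.smul_apply, smul_comm]) x
  rw [symEval, h1, symEval, Real.fourierInv_eq, Real.fourierInv_eq, ← integral_smul]
  refine integral_congr_ae (ae_of_all _ fun ξ => ?_)
  exact smul_comm _ c _

/-- `symEval` at a point as a continuous linear map. -/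
def symEvalCLM (hg : MemLp g 2 (volume : Measure Plane)) (x : Plane) : L2 →L[ℝ] CVec :=
  LinearMap.mkContinuous
    { toFun := fun F => symEval g F x
      map_add' := fun F G => symEval_add hg F G x
      map_smul' := fun c F => symEval_smul c F x } _ fun F => norm_symEval_le hg F x

theorem symEval_ae_eq (hg : MemLp g 2 (volume : Measure Plane))
    (hg' : MemLp g ∞ (volume : Measure Plane)) (F : L2) :
    ((𝓕⁻ (mulOp hg' F) : L2) : Plane → CVec) =ᵐ[volume] symEval g F := by
  have h := coeFn_mulOp hg' F
  refine (fourierInv_ae_eq _ ((integrable_symbol_smul hg F).congr h.symm)).trans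
    (ae_of_all _ fun x => ?_)
  exact Real.fourierInv_congr_ae h x

theorem tendsto_symEval (hg : MemLp g 2 (volume : Measure Plane)) {F : ℕ → L2} (hF : WeakNull F)
    (x : Plane) : Tendsto (fun n => symEval g (F n) x) atTop (𝓝 0) := by
  have h1 : WeakNull fun n => symEval g (F n) x := hF.map (symEvalCLM hg x)
  have h2 : ∀ i : Fin 2, Tendsto (fun n => symEval g (F n) x i) atTop (𝓝 0) := by
    intro i
    have e1 := h1 (EuclideanSpace.single i 1)
    have e2 := h1 (EuclideanSpace.single i Complex.I)
    simp only [cvec_inner_eq, EuclideanSpace.inner_single_left, map_one, one_mul, Complex.conj_I,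
      neg_mul, Complex.neg_re, Complex.I_mul_re, neg_neg] at e1 e2
    have e3 := ((Complex.continuous_ofReal.tendsto 0).comp e1).add
      (((Complex.continuous_ofReal.tendsto 0).comp e2).mul_const Complex.I)
    simpa [Function.comp_def, Complex.re_add_im] using e3
  have h3 : Tendsto (fun n => WithLp.toLp 2 (fun i => symEval g (F n) x i)) atTop
      (𝓝 (WithLp.toLp 2 (fun _ => 0) : CVec)) :=
    ((PiLp.continuous_toLp 2 (fun _ : Fin 2 => ℂ)).tendsto _).comp (tendsto_pi_nhds.2 h2)
  exact h3

end Wiener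

/-! ### The symbols of a velocity field and of its gradient -/

section Symbols

theorem memLp_two_weight {s : ℝ} (hs : 1 < s) :
    MemLp (fun ξ => (weight (-s) ξ : ℂ)) 2 (volume : Measure Plane) := by
  refine MemLp.ofReal ((memLp_two_iff_integrable_sq
    (continuous_weight _).aestronglyMeasurable).2 ?_)
  have h1 : Integrable (fun x : Plane => (1 + ‖x‖ ^ 2) ^ (-(2 * s) / 2)) :=
    integrable_rpow_neg_one_add_norm_sq (by simp; linarith)
  have h2 := h1.comp_smul (R := 2 * Real.pi) (by positivity)
  refine h2.congr (ae_of_all _ fun x => ?_)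
  simp only [weight]
  rw [← Real.rpow_mul_natCast (by positivity)]
  congr 1
  push_cast; ring

/-- The symbol that turns `(1 + |x|²)^α 𝓕[u]` into `𝓕[u]`. -/
def velSym (α : ℝ) (ξ : Plane) : ℂ := (weight (-(2 * α)) ξ : ℂ)

/-- The symbol that turns `(1 + |x|²)^α 𝓕[u]` into `𝓕[∂ᵢ u]`. -/
def gradSym (α : ℝ) (i : Fin 2) (ξ : Plane) : ℂ :=
  2 * Real.pi * Complex.I * (ξ i : ℂ) * (weight (-(2 * α)) ξ : ℂ)

theorem abs_two_pi_mul_le (i : Fin 2) (ξ : Plane) : 2 * Real.pi * |ξ i| ≤ weight 1 ξ := by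
  have h1 : |ξ i| ≤ ‖ξ‖ := by simpa using PiLp.norm_apply_le ξ i
  have h2 : 2 * Real.pi * |ξ i| ≤ ‖(2 * Real.pi) • ξ‖ := by
    rw [norm_smul, Real.norm_of_nonneg (by positivity)]
    gcongr
  rw [weight, ← Real.sqrt_eq_rpow]
  refine h2.trans (Real.le_sqrt_of_sq_le (by linarith))

theorem norm_gradSym_le (α : ℝ) (i : Fin 2) (ξ : Plane) :
    ‖gradSym α i ξ‖ ≤ weight (1 - 2 * α) ξ := by
  have h1 := abs_two_pi_mul_le i ξ
  have h2 := (weight_pos (-(2 * α)) ξ).le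
  rw [gradSym, show (1 : ℝ) - 2 * α = 1 + -(2 * α) by ring, ← weight_mul]
  simp only [norm_mul, Complex.norm_ofNat, Complex.norm_real, Complex.norm_I, mul_one,
    Real.norm_eq_abs, abs_of_pos Real.pi_pos, abs_of_pos (weight_pos (-(2 * α)) ξ)]
  gcongr

theorem measurable_gradSym (α : ℝ) (i : Fin 2) : Measurable (gradSym α i) := by
  have := (continuous_weight (-(2 * α))).measurable
  unfold gradSym
  fun_prop

variable {α : ℝ}

theorem memLp_velSym (hα : 1 < α) : MemLp (velSym α) 2 (volume : Measure Plane) :=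
  memLp_two_weight (by linarith)

theorem memLp_top_velSym (hα : 1 < α) : MemLp (velSym α) ∞ (volume : Measure Plane) :=
  memLp_top_weight (by linarith)

theorem memLp_gradSym (hα : 1 < α) (i : Fin 2) :
    MemLp (gradSym α i) 2 (volume : Measure Plane) := by
  have h1 := memLp_two_weight (s := 2 * α - 1) (by linarith)
  refine h1.mono (measurable_gradSym α i).aestronglyMeasurable (ae_of_all _ fun ξ => ?_)
  rw [Complex.norm_real, Real.norm_of_nonneg (weight_pos _ _).le, neg_sub]
  exact norm_gradSym_le α i ξ

theorem memLp_top_gradSym (hα : 1 < α) (i : Fin 2) :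
    MemLp (gradSym α i) ∞ (volume : Measure Plane) :=
  memLp_top_of_bound (measurable_gradSym α i).aestronglyMeasurable 1 (ae_of_all _ fun ξ =>
    (norm_gradSym_le α i ξ).trans (weight_le_one (by linarith) ξ))

theorem velSym_hasTemperateGrowth : (velSym α).HasTemperateGrowth :=
  weight_hasTemperateGrowth _

theorem gradSym_hasTemperateGrowth (i : Fin 2) : (gradSym α i).HasTemperateGrowth := by
  have h1 := weight_hasTemperateGrowth (-(2 * α))
  have h2 : (fun ξ : Plane => ((inner ℝ ξ (EuclideanSpace.single i (1 : ℝ)) : ℝ) : ℂ)).HasTemperateGrowth := by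
    fun_prop
  have h3 : gradSym α i = fun ξ => (2 * Real.pi * Complex.I)
      * ((inner ℝ ξ (EuclideanSpace.single i (1 : ℝ)) : ℝ) : ℂ) * (weight (-(2 * α)) ξ : ℂ) := by
    ext ξ
    simp [gradSym, EuclideanSpace.inner_single_right]
  rw [h3]
  fun_prop

/-- The directional derivatives of the velocity field are given by the gradient symbols. -/
theorem hasLineDerivAt_symEval (hα : 1 < α) (F : L2) (i : Fin 2) (x : Plane) :
    HasLineDerivAt ℝ (symEval (velSym α) F) (symEval (gradSym α i) F x) x
      (EuclideanSpace.single i (1 : ℝ)) := by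
  have hint : Integrable (fun ξ : Plane => ‖ξ‖ * ‖velSym α ξ • F ξ‖) := by
    have h1 := (integrable_symbol_smul (memLp_two_weight (s := 2 * α - 1) (by linarith)) F).norm
    have h2 := (integrable_symbol_smul (memLp_velSym hα) F).aestronglyMeasurable
    refine h1.mono' (by fun_prop) (ae_of_all _ fun ξ => ?_)
    rw [norm_mul, norm_norm, norm_norm, norm_smul, norm_smul, ← mul_assoc]
    gcongr
    have h3 : ‖ξ‖ ≤ weight 1 ξ := by
      rw [weight, ← Real.sqrt_eq_rpow]
      refine Real.le_sqrt_of_sq_le ?_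
      have hpi : 1 ≤ 2 * Real.pi := by linarith [Real.pi_gt_three]
      rw [norm_smul, Real.norm_of_nonneg (by positivity), mul_pow]
      nlinarith [sq_nonneg ‖ξ‖, mul_nonneg (sub_nonneg.2 (one_le_pow₀ hpi (n := 2))) (sq_nonneg ‖ξ‖)]
    rw [velSym, Complex.norm_real, Complex.norm_real, Real.norm_of_nonneg (weight_pos _ _).le,
      Real.norm_of_nonneg (weight_pos _ _).le, show -(2 * α - 1) = 1 + -(2 * α) by ring,
      ← weight_mul]
    gcongr
    exact (weight_pos _ _).le
  have h := VectorFourier.hasFDerivAt_fourierIntegral (μ := volume) (-innerSL ℝ (E := Plane))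
    (integrable_symbol_smul (memLp_velSym hα) F) hint x
  convert! h.hasLineDerivAt (EuclideanSpace.single i (1 : ℝ)) using 1
  have hf : Integrable (VectorFourier.fourierSMulRight (-innerSL ℝ (E := Plane))
      (fun ξ => velSym α ξ • F ξ)) := by
    refine (hint.const_mul (2 * Real.pi * ‖-innerSL ℝ (E := Plane)‖)).mono'
      (integrable_symbol_smul (memLp_velSym hα) F).aestronglyMeasurable.fourierSMulRight
      (ae_of_all _ fun ξ => ?_)
    rw [← mul_assoc]
    exact VectorFourier.norm_fourierSMulRight_le _ _ _
  have hi := (VectorFourier.fourierIntegral_convergent_iff Real.continuous_fourierChar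
    (by apply (-innerSL ℝ (E := Plane)).continuous₂ :
      Continuous (fun p : Plane × Plane => (-innerSL ℝ (E := Plane)).toLinearMap₁₂ p.1 p.2)) x).2 hf
  rw [VectorFourier.fourierIntegral, ContinuousLinearMap.integral_apply hi, symEval, Real.fourierInv_eq]
  refine integral_congr_ae (ae_of_all _ fun ξ => ?_)
  change _ = Real.fourierChar (-((-innerSL ℝ (E := Plane)) ξ x)) •
    (VectorFourier.fourierSMulRight (-innerSL ℝ (E := Plane)) (fun ξ => velSym α ξ • F ξ) ξ
      (EuclideanSpace.single i 1))
  rw [VectorFourier.fourierSMulRight_apply]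
  have h4 : (innerSL ℝ ξ) (EuclideanSpace.single i (1 : ℝ) : Plane) = ξ i := by
    simp [EuclideanSpace.inner_single_right]
  simp only [neg_apply, neg_neg, neg_smul, smul_neg]
  rw [← Complex.coe_smul, smul_smul, smul_smul]
  congr 2
  simp only [gradSym, velSym]
  rw [h4]

/-- The function that represents a distribution in `L²`. -/
theorem l2Fun_toDistr (f : L2) : l2Fun (f : Distr) = f := by
  have h : ∃ g : L2, (f : Distr) = (g : Distr) := ⟨f, rfl⟩
  rw [l2Fun, dif_pos h]
  exact congrArg (fun f : L2 => (f : Plane → CVec)) (toDistr_injective h.choose_spec.symm)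

/-- The field `u` with `(1 + |x|²)^α 𝓕[u] = F`. -/
def velocity (hα : 1 < α) (F : L2) : L2 := 𝓕⁻ (mulOp (memLp_top_velSym hα) F)

/-- The derivative `∂ᵢ u` of the field `u` with `(1 + |x|²)^α 𝓕[u] = F`. -/
def velocityDeriv (hα : 1 < α) (i : Fin 2) (F : L2) : L2 := 𝓕⁻ (mulOp (memLp_top_gradSym hα i) F)

theorem velocity_ae_eq (hα : 1 < α) (F : L2) : velocity hα F =ᵐ[volume] symEval (velSym α) F :=
  symEval_ae_eq (memLp_velSym hα) _ F

theorem velocityDeriv_ae_eq (hα : 1 < α) (i : Fin 2) (F : L2) :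
    velocityDeriv hα i F =ᵐ[volume] symEval (gradSym α i) F :=
  symEval_ae_eq (memLp_gradSym hα i) _ F

theorem toDistr_eq (hα : 1 < α) (u : Sob (2 * α)) :
    (u : Distr) = (velocity hα (Sob.fourierRep u) : Distr) := by
  rw [velocity, ← Lp.fourierInv_toTemperedDistribution_eq,
    toDistr_mulOp _ velSym_hasTemperateGrowth, ← Sob.fourierRep_spec, weightedFourier]
  have h := smulLeft_weight (-(2 * α)) (2 * α) (𝓕 (u : Distr))
  change _ = 𝓕⁻ (TemperedDistribution.smulLeftCLM CVec
    (fun ξ : Plane => (weight (-(2 * α)) ξ : ℂ)) _)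
  rw [h]
  simp

theorem lineDeriv_velocity (hα : 1 < α) (F : L2) (i : Fin 2) :
    ∂_{(EuclideanSpace.single i (1 : ℝ) : Plane)} (velocity hα F : Distr)
      = (velocityDeriv hα i F : Distr) := by
  rw [velocity, velocityDeriv, ← Lp.fourierInv_toTemperedDistribution_eq,
    ← Lp.fourierInv_toTemperedDistribution_eq, toDistr_mulOp _ (gradSym_hasTemperateGrowth i),
    toDistr_mulOp _ velSym_hasTemperateGrowth, TemperedDistribution.lineDeriv_eq_fourierMultiplierCLM,
    TemperedDistribution.fourierMultiplierCLM_apply, fourier_fourierInv_eq,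
    TemperedDistribution.smulLeftCLM_smulLeftCLM_apply velSym_hasTemperateGrowth (by fun_prop),
    ← FourierTransform.fourierInv_smul, ← smul_apply,
    ← TemperedDistribution.smulLeftCLM_smul (velSym_hasTemperateGrowth.mul (by fun_prop))]
  congr 3
  ext ξ
  simp only [gradSym, velSym, Pi.smul_apply, EuclideanSpace.inner_single_right, conj_trivial, one_mul,
    smul_eq_mul, Pi.mul_apply]
  ring

end Symbols

/-! ### The product estimate -/

section Product

open scoped Convolution

/-- The weight is submultiplicative up to a constant, in the additive form that suits convolutions. -/
theorem weight_add_le {s : ℝ} (hs : 0 ≤ s) (ξ η : Plane) :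
    weight s (ξ + η) ≤ 4 ^ (s / 2) * (weight s ξ + weight s η) := by
  have hmax : 1 + ‖(2 * Real.pi) • (ξ + η)‖ ^ 2 ≤
      4 * max (1 + ‖(2 * Real.pi) • ξ‖ ^ 2) (1 + ‖(2 * Real.pi) • η‖ ^ 2) := by
    have h1 : ‖(2 * Real.pi) • (ξ + η)‖ ≤ ‖(2 * Real.pi) • ξ‖ + ‖(2 * Real.pi) • η‖ := by
      rw [smul_add]; exact norm_add_le _ _
    have h2 := norm_nonneg ((2 * Real.pi) • (ξ + η))
    have h3 := le_max_left (1 + ‖(2 * Real.pi) • ξ‖ ^ 2) (1 + ‖(2 * Real.pi) • η‖ ^ 2)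
    have h4 := le_max_right (1 + ‖(2 * Real.pi) • ξ‖ ^ 2) (1 + ‖(2 * Real.pi) • η‖ ^ 2)
    have h5 : ‖(2 * Real.pi) • (ξ + η)‖ ^ 2 ≤ (‖(2 * Real.pi) • ξ‖ + ‖(2 * Real.pi) • η‖) ^ 2 := by
      gcongr
    nlinarith [sq_nonneg (‖(2 * Real.pi) • ξ‖ - ‖(2 * Real.pi) • η‖)]
  have h0 : 0 ≤ s / 2 := by positivity
  calc weight s (ξ + η)
      ≤ (4 * max (1 + ‖(2 * Real.pi) • ξ‖ ^ 2) (1 + ‖(2 * Real.pi) • η‖ ^ 2)) ^ (s / 2) :=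
        Real.rpow_le_rpow (by positivity) hmax h0
    _ = 4 ^ (s / 2) * max (1 + ‖(2 * Real.pi) • ξ‖ ^ 2) (1 + ‖(2 * Real.pi) • η‖ ^ 2) ^ (s / 2) :=
        Real.mul_rpow (by positivity) (by positivity)
    _ ≤ _ := by
        gcongr
        rcases max_cases (1 + ‖(2 * Real.pi) • ξ‖ ^ 2) (1 + ‖(2 * Real.pi) • η‖ ^ 2) with h | h
        · rw [h.1]
          exact le_add_of_nonneg_right (weight_pos _ _).le
        · rw [h.1]
          exact le_add_of_nonneg_left (weight_pos _ _).le

/-- Cauchy-Schwarz inequality for a weighted convolution at a point. -/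
theorem sq_convolution_le {ω : Plane → ℝ≥0∞} (hω : Measurable ω) (hω0 : ∀ ξ, ω ξ ≠ 0)
    (hωt : ∀ ξ, ω ξ ≠ ∞) {c : ℝ≥0∞} (hc : ∀ ξ η, ω (ξ + η) ≤ c * (ω ξ + ω η))
    {p q : Plane → ℝ≥0∞} (hp : Measurable p) (hq : Measurable q) (ξ : Plane) :
    ω ξ * (∫⁻ η, p η * q (ξ - η)) ^ 2 ≤
      2 * c * (∫⁻ η, (ω η)⁻¹) * ∫⁻ η, ω η * p η ^ 2 * (ω (ξ - η) * q (ξ - η) ^ 2) := by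
  have hsub : ∀ f : Plane → ℝ≥0∞, Measurable f → Measurable fun η => f (ξ - η) := fun f hf =>
    hf.comp (measurable_const.sub measurable_id)
  have h1 := ENNReal.lintegral_mul_le_Lp_mul_Lq (volume : Measure Plane) Real.HolderConjugate.two_two
    (f := fun η => ((ω η)⁻¹ * (ω (ξ - η))⁻¹) ^ (1 / 2 : ℝ))
    (g := fun η => (ω η * ω (ξ - η)) ^ (1 / 2 : ℝ) * (p η * q (ξ - η)))
    (((hω.inv.mul (hsub _ hω.inv)).pow_const _).aemeasurable)
    ((((hω.mul (hsub _ hω)).pow_const _).mul (hp.mul (hsub _ hq))).aemeasurable)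
  have e1 : ∀ η, ((fun η => ((ω η)⁻¹ * (ω (ξ - η))⁻¹) ^ (1 / 2 : ℝ)) *
      (fun η => (ω η * ω (ξ - η)) ^ (1 / 2 : ℝ) * (p η * q (ξ - η)))) η = p η * q (ξ - η) := by
    intro η
    rw [Pi.mul_apply, ← mul_assoc, ← ENNReal.mul_rpow_of_nonneg _ _ (by norm_num),
      ← ENNReal.mul_inv (Or.inl (hω0 _)) (Or.inl (hωt _)),
      ENNReal.inv_mul_cancel (mul_ne_zero (hω0 _) (hω0 _)) (ENNReal.mul_ne_top (hωt _) (hωt _)),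
      ENNReal.one_rpow, one_mul]
  have hh : ∀ a : ℝ≥0∞, (a ^ (1 / 2 : ℝ)) ^ (2 : ℝ) = a := fun a => by
    rw [← ENNReal.rpow_mul]; norm_num
  have hh' : ∀ a : ℝ≥0∞, (a ^ (1 / 2 : ℝ)) ^ 2 = a := fun a => by
    rw [← ENNReal.rpow_two, hh]
  simp only [e1, ENNReal.mul_rpow_of_nonneg _ _ (zero_le_two (α := ℝ)), hh] at h1
  have h2 := pow_le_pow_left' h1 2
  rw [mul_pow, hh', hh'] at h2
  have h3 : ω ξ * ∫⁻ η, (ω η)⁻¹ * (ω (ξ - η))⁻¹ ≤ 2 * c * ∫⁻ η, (ω η)⁻¹ := by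
    have hm : Measurable fun η => (ω η)⁻¹ * (ω (ξ - η))⁻¹ := hω.inv.mul (hsub _ hω.inv)
    rw [← lintegral_const_mul _ hm]
    calc ∫⁻ η, ω ξ * ((ω η)⁻¹ * (ω (ξ - η))⁻¹)
        ≤ ∫⁻ η, c * ((ω (ξ - η))⁻¹ + (ω η)⁻¹) := by
          refine lintegral_mono fun η => ?_
          have h4 := hc η (ξ - η)
          rw [add_sub_cancel] at h4
          calc ω ξ * ((ω η)⁻¹ * (ω (ξ - η))⁻¹)
              ≤ c * (ω η + ω (ξ - η)) * ((ω η)⁻¹ * (ω (ξ - η))⁻¹) := by gcongr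
            _ = c * ((ω η * (ω η)⁻¹) * (ω (ξ - η))⁻¹
                + (ω (ξ - η) * (ω (ξ - η))⁻¹) * (ω η)⁻¹) := by ring
            _ = _ := by
              rw [ENNReal.mul_inv_cancel (hω0 _) (hωt _), ENNReal.mul_inv_cancel (hω0 _) (hωt _),
                one_mul, one_mul]
      _ = 2 * c * ∫⁻ η, (ω η)⁻¹ := by
          have hi : Measurable fun η => (ω (ξ - η))⁻¹ := hsub _ hω.inv
          have hm : Measurable fun η => (ω (ξ - η))⁻¹ + (ω η)⁻¹ := hi.add hω.inv
          rw [lintegral_const_mul _ hm, lintegral_add_left hi,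
            lintegral_sub_left_eq_self (fun η => (ω η)⁻¹) ξ]
          ring
  calc ω ξ * (∫⁻ η, p η * q (ξ - η)) ^ 2
      ≤ ω ξ * ((∫⁻ η, (ω η)⁻¹ * (ω (ξ - η))⁻¹) *
          ∫⁻ η, ω η * ω (ξ - η) * (p η ^ (2 : ℝ) * q (ξ - η) ^ (2 : ℝ))) := by gcongr
    _ ≤ 2 * c * (∫⁻ η, (ω η)⁻¹) * ∫⁻ η, ω η * ω (ξ - η) * (p η ^ (2 : ℝ) * q (ξ - η) ^ (2 : ℝ)) := by
        rw [← mul_assoc]; gcongr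
    _ = _ := by
        congr 1
        refine lintegral_congr fun η => ?_
        rw [ENNReal.rpow_two, ENNReal.rpow_two]; ring

/-- Weighted `L²` spaces are convolution algebras when the inverse of the weight is integrable. -/
theorem lintegral_sq_convolution_le {ω : Plane → ℝ≥0∞} (hω : Measurable ω) (hω0 : ∀ ξ, ω ξ ≠ 0)
    (hωt : ∀ ξ, ω ξ ≠ ∞) {c : ℝ≥0∞} (hc : ∀ ξ η, ω (ξ + η) ≤ c * (ω ξ + ω η))
    {p q : Plane → ℝ≥0∞} (hp : Measurable p) (hq : Measurable q) :
    ∫⁻ ξ, ω ξ * (∫⁻ η, p η * q (ξ - η)) ^ 2 ≤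
      2 * c * (∫⁻ η, (ω η)⁻¹) * ((∫⁻ η, ω η * p η ^ 2) * ∫⁻ η, ω η * q η ^ 2) := by
  have hP : Measurable fun η => ω η * p η ^ 2 := hω.mul (hp.pow_const _)
  have hQ : Measurable fun η => ω η * q η ^ 2 := hω.mul (hq.pow_const _)
  have hPQ : Measurable fun z : Plane × Plane =>
      ω z.2 * p z.2 ^ 2 * (ω (z.1 - z.2) * q (z.1 - z.2) ^ 2) :=
    (hP.comp measurable_snd).mul (hQ.comp (measurable_fst.sub measurable_snd))
  refine (lintegral_mono fun ξ => sq_convolution_le hω hω0 hωt hc hp hq ξ).trans ?_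
  rw [lintegral_const_mul _ hPQ.lintegral_prod_right', lintegral_lintegral_swap hPQ.aemeasurable]
  refine le_of_eq ?_
  congr 1
  rw [← lintegral_mul_const _ hP]
  refine lintegral_congr fun η => ?_
  have hm : Measurable fun ξ => ω (ξ - η) * q (ξ - η) ^ 2 :=
    hQ.comp (measurable_id.sub measurable_const)
  dsimp only
  rw [lintegral_const_mul _ hm,
    lintegral_sub_right_eq_self (fun ξ => ω ξ * q ξ ^ 2) η]

theorem lintegral_enorm_sq (f : L2) : ∫⁻ x, ‖f x‖ₑ ^ 2 = ‖f‖ₑ ^ 2 := by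
  rw [Lp.enorm_def, eLpNorm_eq_lintegral_rpow_enorm_toReal (by norm_num) (by norm_num),
    ← ENNReal.rpow_two, ← ENNReal.rpow_mul]
  simp

variable {α : ℝ}

theorem integrable_velSym_apply (hα : 1 < α) (F : L2) (i : Fin 2) :
    Integrable (fun ξ => velSym α ξ * F ξ i) :=
  (EuclideanSpace.proj i : CVec →L[ℂ] ℂ).integrable_comp (integrable_symbol_smul (memLp_velSym hα) F)

theorem fourierInv_velSym_apply (hα : 1 < α) (F : L2) (i : Fin 2) (x : Plane) :
    𝓕⁻ (fun ξ => velSym α ξ * F ξ i) x = symEval (velSym α) F x i := by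
  have hi := integrable_symbol_smul (memLp_velSym hα) F
  have h := (EuclideanSpace.proj i : CVec →L[ℂ] ℂ).integral_comp_comm
    (show Integrable (fun ξ => Real.fourierChar ⟪ξ, x⟫_ℝ • (velSym α ξ • F ξ)) by
      simpa using (Real.fourierIntegral_convergent_iff (-x)).2 hi)
  rw [symEval, Real.fourierInv_eq, Real.fourierInv_eq]
  exact h

/-- The products `uᵢ ∂ᵢ v` lie in `H^α`, with a bound by the norms of `u` in `H^α` and of `v` in
`H^{2α}`: on the Fourier side they are convolutions, and `(1 + |x|²)^(-α)` is integrable. -/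
theorem exists_product (hα : 1 < α) : ∃ C : ℝ, 0 ≤ C ∧ ∀ (F G : L2) (i : Fin 2), ∃ g : L2,
    ((𝓕⁻ ((freqScale (show 0 ≤ α by linarith)).J g) : L2) : Plane → CVec) =ᵐ[volume]
      (fun x => symEval (velSym α) F x i • symEval (gradSym α i) G x) ∧
    ‖g‖ ≤ C * ‖(freqScale (show 0 ≤ α by linarith)).J F‖ * ‖G‖ := by
  have hα0 : 0 ≤ α := by linarith
  set ω : Plane → ℝ≥0∞ := fun ξ => ENNReal.ofReal (weight (2 * α) ξ) with hω
  have hωm : Measurable ω := (continuous_weight _).measurable.ennreal_ofReal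
  have hω0 : ∀ ξ, ω ξ ≠ 0 := fun ξ => by simp [hω, weight_pos]
  have hωt : ∀ ξ, ω ξ ≠ ∞ := fun ξ => ENNReal.ofReal_ne_top
  have hω' : ∀ ξ, ω ξ = ‖(weight α ξ : ℂ)‖ₑ ^ 2 := fun ξ => by
    rw [← ofReal_norm, ← ENNReal.ofReal_pow (norm_nonneg _), Complex.norm_real,
      Real.norm_of_nonneg (weight_pos _ _).le, sq, weight_mul, ← two_mul]
  have hωi : ∫⁻ ξ, (ω ξ)⁻¹ < ∞ := by
    have h1 := memLp_two_weight hα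
    have h2 := lintegral_rpow_enorm_lt_top_of_eLpNorm_lt_top (p := 2) (by norm_num) (by norm_num)
      h1.eLpNorm_lt_top
    refine lt_of_le_of_lt (le_of_eq (lintegral_congr fun ξ => ?_)) h2
    rw [ENNReal.toReal_ofNat, ENNReal.rpow_two, ← ofReal_norm,
      ← ENNReal.ofReal_pow (norm_nonneg _), Complex.norm_real,
      Real.norm_of_nonneg (weight_pos _ _).le, sq, weight_mul, hω]
    simp only
    rw [← ENNReal.ofReal_inv_of_pos (weight_pos _ _)]
    congr 1
    refine inv_eq_of_mul_eq_one_right ?_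
    rw [weight_mul, show 2 * α + (-α + -α) = 0 by ring, weight_zero]
  set K : ℝ≥0∞ := 2 * ENNReal.ofReal (4 ^ (2 * α / 2)) * ∫⁻ ξ, (ω ξ)⁻¹ with hK
  have hKt : K ≠ ∞ := ENNReal.mul_ne_top (by finiteness) hωi.ne
  refine ⟨Real.sqrt K.toReal, Real.sqrt_nonneg _, fun F G i => ?_⟩
  set a : Plane → ℂ := fun ξ => velSym α ξ * F ξ i with ha
  set b : Plane → CVec := fun ξ => gradSym α i ξ • G ξ with hb
  have hai : Integrable a := integrable_velSym_apply hα F i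
  have hbi : Integrable b := integrable_symbol_smul (memLp_gradSym hα i) G
  have ham : Measurable a := by
    have h1 : Measurable (velSym α) :=
      Complex.measurable_ofReal.comp (continuous_weight _).measurable
    have h2 : Measurable fun ξ => F ξ i := by
      have := (Lp.stronglyMeasurable F).measurable
      fun_prop
    exact h1.mul h2
  have hbm : Measurable b := (measurable_gradSym α i).smul (Lp.stronglyMeasurable G).measurable
  set H : Plane → CVec := a ⋆[ContinuousLinearMap.lsmul ℂ ℂ, volume] b with hH
  have hHi : Integrable H := hai.integrable_convolution _ hbi
  have hHle : ∀ ξ, ‖H ξ‖ₑ ≤ ∫⁻ η, ‖a η‖ₑ * ‖b (ξ - η)‖ₑ := fun ξ => by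
    refine (enorm_integral_le_lintegral_enorm _).trans (le_of_eq ?_)
    refine lintegral_congr fun η => ?_
    rw [ContinuousLinearMap.lsmul_apply, enorm_smul]
  set J := (freqScale (show 0 ≤ α by linarith)).J with hJ
  have hJa : ∀ f : L2, J f =ᵐ[volume] fun ξ => (weight (-α) ξ : ℂ) • f ξ := coeFn_mulOp _
  have hA : ∫⁻ ξ, ω ξ * ‖a ξ‖ₑ ^ 2 ≤ ‖J F‖ₑ ^ 2 := by
    rw [← lintegral_enorm_sq]
    refine lintegral_mono_ae ?_
    filter_upwards [hJa F] with ξ h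
    rw [h, hω', ← mul_pow]
    gcongr
    simp only [ha, velSym]
    rw [← enorm_mul, ← mul_assoc, ← Complex.ofReal_mul, weight_mul, enorm_mul,
      enorm_smul, show α + -(2 * α) = -α by ring]
    gcongr
    rw [enorm_le_iff_norm_le]
    exact PiLp.norm_apply_le _ _
  have hB : ∫⁻ ξ, ω ξ * ‖b ξ‖ₑ ^ 2 ≤ ‖G‖ₑ ^ 2 := by
    rw [← lintegral_enorm_sq]
    refine lintegral_mono fun ξ => ?_
    rw [hω', ← mul_pow]
    gcongr
    rw [hb, enorm_smul, ← mul_assoc, ← enorm_mul]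
    refine mul_le_of_le_one_left (by positivity) ?_
    rw [← ofReal_norm, ENNReal.ofReal_le_one, norm_mul, Complex.norm_real,
      Real.norm_of_nonneg (weight_pos _ _).le]
    calc weight α ξ * ‖gradSym α i ξ‖ ≤ weight α ξ * weight (1 - 2 * α) ξ := by
          gcongr
          · exact (weight_pos _ _).le
          · exact norm_gradSym_le α i ξ
      _ ≤ 1 := by
          rw [weight_mul]
          exact weight_le_one (by linarith) ξ
  have hg2 : ∫⁻ ξ, ‖(weight α ξ : ℂ) • H ξ‖ₑ ^ 2 ≤ K * (‖J F‖ₑ ^ 2 * ‖G‖ₑ ^ 2) := by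
    have h1 := lintegral_sq_convolution_le hωm hω0 hωt (c := ENNReal.ofReal (4 ^ (2 * α / 2)))
      (fun ξ η => by
        rw [hω]
        simp only
        rw [← ENNReal.ofReal_add (weight_pos _ _).le (weight_pos _ _).le,
          ← ENNReal.ofReal_mul (by positivity)]
        exact ENNReal.ofReal_le_ofReal (weight_add_le (by linarith) ξ η)) ham.enorm hbm.enorm
    refine le_trans (lintegral_mono fun ξ => ?_) (h1.trans ?_)
    · rw [enorm_smul, mul_pow, ← hω']
      gcongr
      exact hHle ξ
    · rw [← hK]
      gcongr
  have hgm : AEStronglyMeasurable (fun ξ => (weight α ξ : ℂ) • H ξ) volume :=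
    ((Complex.continuous_ofReal.comp (continuous_weight α)).aestronglyMeasurable).smul
      hHi.aestronglyMeasurable
  have hg : MemLp (fun ξ => (weight α ξ : ℂ) • H ξ) 2 volume := by
    refine ⟨hgm, ?_⟩
    rw [eLpNorm_lt_top_iff_lintegral_rpow_enorm_lt_top (by norm_num) (by norm_num)]
    refine lt_of_le_of_lt (by simpa using hg2) ?_
    have : ‖J F‖ₑ ≠ ∞ := enorm_ne_top
    have : ‖G‖ₑ ≠ ∞ := enorm_ne_top
    exact lt_top_iff_ne_top.2 (by finiteness)
  refine ⟨hg.toLp, ?_, ?_⟩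
  · have hJg : J hg.toLp =ᵐ[volume] H := by
      filter_upwards [hJa hg.toLp, hg.coeFn_toLp] with ξ h1 h2
      rw [h1, h2, smul_smul, ← Complex.ofReal_mul, weight_mul]
      simp
    refine (fourierInv_ae_eq _ (hHi.congr hJg.symm)).trans (ae_of_all _ fun x => ?_)
    rw [Real.fourierInv_congr_ae hJg x, Real.fourierInv_eq_fourier_neg, hH,
      Real.fourier_smul_convolution_eq hai hbi, ← Real.fourierInv_eq_fourier_neg,
      ← Real.fourierInv_eq_fourier_neg, ha, fourierInv_velSym_apply hα]
    rfl
  · have h1 : ‖hg.toLp‖ₑ ^ 2 ≤ K * (‖J F‖ₑ ^ 2 * ‖G‖ₑ ^ 2) := by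
      rw [← lintegral_enorm_sq]
      refine le_trans (le_of_eq (lintegral_congr_ae ?_)) hg2
      filter_upwards [hg.coeFn_toLp] with ξ h
      rw [h]
    have h2 := ENNReal.toReal_mono (by
      have : ‖J F‖ₑ ≠ ∞ := enorm_ne_top
      have : ‖G‖ₑ ≠ ∞ := enorm_ne_top
      finiteness) h1
    simp only [ENNReal.toReal_mul, ENNReal.toReal_pow, toReal_enorm] at h2
    refine le_of_sq_le_sq ?_ (by positivity)
    rw [mul_pow, mul_pow, Real.sq_sqrt ENNReal.toReal_nonneg, mul_assoc]
    exact h2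

end Product

/-! ### The convection term and the Leray projector on the Fourier side -/

section Transport

variable {α : ℝ}

/-- The field `(u · ∇) v`, where `(1 + |x|²)^α 𝓕[u] = F` and `(1 + |x|²)^α 𝓕[v] = G`. -/
def transport (α : ℝ) (F G : L2) (x : Plane) : CVec :=
  ∑ i : Fin 2, symEval (velSym α) F x i • symEval (gradSym α i) G x

/-- The Fourier transform on `L²` as a real isometry. -/
def fourierL2 : L2 ≃ₗᵢ[ℝ] L2 where
  __ := ((Lp.fourierTransformₗᵢ Plane CVec).toLinearEquiv.restrictScalars ℝ)
  norm_map' := (Lp.fourierTransformₗᵢ Plane CVec).norm_map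

theorem fourierL2_symm_apply (F : L2) : fourierL2.symm F = 𝓕⁻ F := rfl

/-- The bilinear operator that represents the convection term on the Fourier side, one order below
the space of its arguments. -/
theorem exists_transportOp (hα : 1 < α) : ∃ (B : L2 →L[ℝ] L2 →L[ℝ] L2) (C : ℝ), 0 ≤ C ∧
    (∀ F G, fourierL2.symm ((freqScale (show 0 ≤ α by linarith)).J (B F G)) =ᵐ[volume]
      transport α F G) ∧
    ∀ F G, ‖B F G‖ ≤ C * ‖(freqScale (show 0 ≤ α by linarith)).J F‖ * ‖G‖ := by
  set S := freqScale (show 0 ≤ α by linarith) with hS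
  obtain ⟨C, hC, h⟩ := exists_product hα
  choose g hg hgn using h
  set b : L2 → L2 → L2 := fun F G => ∑ i : Fin 2, g F G i with hb
  have hb1 : ∀ F G, fourierL2.symm (S.J (b F G)) =ᵐ[volume] transport α F G := fun F G => by
    simp only [hb, Fin.sum_univ_two, map_add]
    filter_upwards [hg F G 0, hg F G 1, Lp.coeFn_add (fourierL2.symm (S.J (g F G 0)))
      (fourierL2.symm (S.J (g F G 1)))] with x h0 h1 h2
    rw [h2, Pi.add_apply, transport, Fin.sum_univ_two, ← h0, ← h1]
    rfl
  have hb2 : ∀ F G, ‖b F G‖ ≤ 2 * C * ‖S.J F‖ * ‖G‖ := fun F G => by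
    simp only [hb, Fin.sum_univ_two]
    refine (norm_add_le _ _).trans ?_
    have := hgn F G 0
    have := hgn F G 1
    linarith
  have huniq : ∀ f f' : L2, fourierL2.symm (S.J f) =ᵐ[volume] fourierL2.symm (S.J f') → f = f' :=
    fun f f' h => by
    have h1 := fourierL2.symm.injective (Lp.ext h)
    rw [← sub_eq_zero]
    refine S.J_injective ?_
    rw [map_sub, h1, sub_self]
  have hv := memLp_velSym hα
  have hd := memLp_gradSym hα
  let bl : L2 →ₗ[ℝ] L2 →ₗ[ℝ] L2 := LinearMap.mk₂ ℝ b
    (fun F F' G => huniq _ _ <| by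
      rw [map_add, map_add]
      filter_upwards [hb1 (F + F') G, hb1 F G, hb1 F' G, Lp.coeFn_add (fourierL2.symm (S.J (b F G)))
        (fourierL2.symm (S.J (b F' G)))] with x h0 h1 h2 h3
      rw [h0, h3, Pi.add_apply, h1, h2]
      simp only [transport, symEval_add hv, PiLp.add_apply, add_smul, Finset.sum_add_distrib])
    (fun c F G => huniq _ _ <| by
      rw [map_smul, map_smul]
      filter_upwards [hb1 (c • F) G, hb1 F G, Lp.coeFn_smul c (fourierL2.symm (S.J (b F G)))]
        with x h0 h1 h3
      rw [h0, h3, Pi.smul_apply, h1]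
      simp only [transport, symEval_smul, PiLp.smul_apply, smul_assoc, Finset.smul_sum])
    (fun F G G' => huniq _ _ <| by
      rw [map_add, map_add]
      filter_upwards [hb1 F (G + G'), hb1 F G, hb1 F G', Lp.coeFn_add (fourierL2.symm (S.J (b F G)))
        (fourierL2.symm (S.J (b F G')))] with x h0 h1 h2 h3
      rw [h0, h3, Pi.add_apply, h1, h2]
      simp only [transport, symEval_add (hd _), smul_add, Finset.sum_add_distrib])
    (fun c F G => huniq _ _ <| by
      rw [map_smul, map_smul]
      filter_upwards [hb1 F (c • G), hb1 F G, Lp.coeFn_smul c (fourierL2.symm (S.J (b F G)))]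
        with x h0 h1 h3
      rw [h0, h3, Pi.smul_apply, h1]
      simp only [transport, symEval_smul, smul_comm _ c, Finset.smul_sum])
  refine ⟨bl.mkContinuous₂ (2 * C) fun F G => (hb2 F G).trans ?_, 2 * C, by positivity, hb1, hb2⟩
  gcongr
  exact S.norm_J_le F

/-- The Leray projector on the Fourier side. -/
def lerayFourier : L2 →L[ℝ] L2 :=
  (fourierL2 : L2 →L[ℝ] L2) ∘L leray ∘L (fourierL2.symm : L2 →L[ℝ] L2)

theorem lerayFourier_apply (F : L2) : lerayFourier F = fourierL2 (leray (fourierL2.symm F)) := rfl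

theorem leray_symm (f g : L2) : ⟪leray f, g⟫_ℝ = ⟪f, leray g⟫_ℝ :=
  Submodule.inner_starProjection_left_eq_right _ f g

theorem lerayFourier_symm (F G : L2) : ⟪lerayFourier F, G⟫_ℝ = ⟪F, lerayFourier G⟫_ℝ := by
  rw [lerayFourier_apply, lerayFourier_apply, ← fourierL2.symm.inner_map_map,
    ← fourierL2.symm.inner_map_map F, fourierL2.symm_apply_apply, fourierL2.symm_apply_apply,
    leray_symm]

theorem lerayFourier_eq_self_iff (F : L2) :
    lerayFourier F = F ↔ fourierL2.symm F ∈ solenoidalL2 := by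
  rw [lerayFourier_apply, ← fourierL2.symm.injective.eq_iff, fourierL2.symm_apply_apply, leray,
    Submodule.starProjection_eq_self_iff]

theorem lerayFourier_idem (F : L2) : lerayFourier (lerayFourier F) = lerayFourier F := by
  rw [lerayFourier_eq_self_iff, lerayFourier_apply, fourierL2.symm_apply_apply]
  exact Submodule.starProjection_apply_mem _ _

theorem norm_lerayFourier_le (F : L2) : ‖lerayFourier F‖ ≤ ‖F‖ := by
  rw [lerayFourier_apply, fourierL2.norm_map, ← fourierL2.symm.norm_map F]
  exact Submodule.norm_starProjection_apply_le _ _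

/-- Bessel potentials preserve divergence-free fields. -/
theorem mem_solenoidalL2_of_weight {s : ℝ} (hs : s ≤ 0) {F : L2}
    (hF : fourierL2.symm F ∈ solenoidalL2) :
    fourierL2.symm (mulOp (memLp_top_weight hs) F) ∈ solenoidalL2 := by
  have h1 : ((fourierL2.symm (mulOp (memLp_top_weight hs) F) : L2) : Distr)
      = bessel s ((fourierL2.symm F : L2) : Distr) := by
    rw [fourierL2_symm_apply, fourierL2_symm_apply, ← Lp.fourierInv_toTemperedDistribution_eq,
      ← Lp.fourierInv_toTemperedDistribution_eq, toDistr_mulOp _ (weight_hasTemperateGrowth s),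
      bessel, TemperedDistribution.fourierMultiplierCLM_apply, fourier_fourierInv_eq]
  change ((fourierL2.symm (mulOp (memLp_top_weight hs) F) : L2) : Distr) ∈ solenoidal
  rw [h1]
  have h2 : ((fourierL2.symm F : L2) : Distr) ∈ solenoidal := hF
  exact ⟨h2.1.bessel s, h2.2.bessel s⟩

/-- A symmetric operator that preserves the divergence-free fields commutes with the projector. -/
theorem lerayFourier_weight {s : ℝ} (hs : s ≤ 0) (F : L2) :
    lerayFourier (mulOp (memLp_top_weight hs) F) = mulOp (memLp_top_weight hs) (lerayFourier F) := by
  set T := mulOp (memLp_top_weight hs) with hT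
  have hpres : ∀ G, lerayFourier G = G → lerayFourier (T G) = T G := fun G hG => by
    rw [lerayFourier_eq_self_iff] at hG ⊢
    exact mem_solenoidalL2_of_weight hs hG
  refine ext_inner_right ℝ fun G => ?_
  have h1 : ⟪lerayFourier (T F), G⟫_ℝ = ⟪F, T (lerayFourier G)⟫_ℝ := by
    rw [lerayFourier_symm, hT, mulOp_symm]
  have h2 := hpres _ (lerayFourier_idem G)
  rw [h1, ← h2, ← lerayFourier_symm, hT, ← mulOp_symm, ← lerayFourier_symm,
    hpres _ (lerayFourier_idem F)]

end Transport

/-! ### Bounds for the convection term -/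

section Estimates

variable {α : ℝ}

theorem lintegral_mul_enorm_le {E E' : Type*} [NormedAddCommGroup E] [NormedAddCommGroup E']
    {f : Plane → E} {g : Plane → E'} (hf : AEStronglyMeasurable f volume)
    (hg : AEStronglyMeasurable g volume) :
    ∫⁻ x, ‖f x‖ₑ * ‖g x‖ₑ ≤ eLpNorm f 2 volume * eLpNorm g 2 volume := by
  have h := ENNReal.lintegral_mul_le_Lp_mul_Lq (volume : Measure Plane)
    Real.HolderConjugate.two_two hf.enorm hg.enorm
  rw [eLpNorm_eq_lintegral_rpow_enorm_toReal (by norm_num) (by norm_num),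
    eLpNorm_eq_lintegral_rpow_enorm_toReal (by norm_num) (by norm_num)]
  simpa using h

theorem enorm_inner_le_lintegral (f g : L2) : ‖⟪f, g⟫_ℝ‖ₑ ≤ ∫⁻ x, ‖f x‖ₑ * ‖g x‖ₑ := by
  rw [L2.inner_def]
  refine (enorm_integral_le_lintegral_enorm _).trans (lintegral_mono fun x => ?_)
  rw [← ofReal_norm, ← ofReal_norm, ← ofReal_norm, ← ENNReal.ofReal_mul (norm_nonneg _)]
  exact ENNReal.ofReal_le_ofReal (norm_inner_le_norm _ _)

theorem enorm_transport_le (F G : L2) (x : Plane) : ‖transport α F G x‖ₑ ≤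
    ∑ i : Fin 2, ‖symEval (velSym α) F x‖ₑ * ‖symEval (gradSym α i) G x‖ₑ := by
  refine (enorm_sum_le _ _).trans (Finset.sum_le_sum fun i _ => ?_)
  rw [enorm_smul]
  gcongr
  rw [enorm_le_iff_norm_le]
  exact PiLp.norm_apply_le _ _

theorem enorm_inner_transport_le (hα : 1 < α) {φ g F G : L2} (hg : g =ᵐ[volume] transport α F G) :
    ‖⟪φ, g⟫_ℝ‖ₑ ≤ ∑ i : Fin 2, ∫⁻ x,
      ‖φ x‖ₑ * (‖symEval (velSym α) F x‖ₑ * ‖symEval (gradSym α i) G x‖ₑ) := by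
  refine (enorm_inner_le_lintegral φ g).trans ?_
  have h1 : ∫⁻ x, ‖φ x‖ₑ * ‖g x‖ₑ ≤ ∫⁻ x, ∑ i : Fin 2,
      ‖φ x‖ₑ * (‖symEval (velSym α) F x‖ₑ * ‖symEval (gradSym α i) G x‖ₑ) := by
    refine lintegral_mono_ae ?_
    filter_upwards [hg] with x hx
    rw [hx, ← Finset.mul_sum]
    gcongr
    exact enorm_transport_le F G x
  have hu := (continuous_symEval (memLp_velSym hα) F).measurable.enorm
  refine h1.trans (le_of_eq (lintegral_finsetSum' _ fun i _ => ?_))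
  have hv := (continuous_symEval (memLp_gradSym hα i) G).measurable.enorm
  exact (Lp.aestronglyMeasurable φ).enorm.mul (hu.mul hv).aemeasurable

theorem norm_velocity_le (hα : 1 < α) (F : L2) : ‖velocity hα F‖ ≤ ‖F‖ := by
  rw [velocity, ← fourierL2_symm_apply, fourierL2.symm.norm_map]
  refine norm_mulOp_le _ (fun ξ => ?_) _
  rw [velSym, Complex.norm_real, Real.norm_of_nonneg (weight_pos _ _).le]
  exact weight_le_one (by linarith) ξ

theorem norm_velocityDeriv_le (hα : 1 < α) (i : Fin 2) (F : L2) : ‖velocityDeriv hα i F‖ ≤ ‖F‖ := by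
  rw [velocityDeriv, ← fourierL2_symm_apply, fourierL2.symm.norm_map]
  exact norm_mulOp_le _ (fun ξ => (norm_gradSym_le α i ξ).trans (weight_le_one (by linarith) ξ)) _

theorem J_J_eq (hα : 1 < α) (F : L2) : (freqScale (show 0 ≤ α by linarith)).J
    ((freqScale (show 0 ≤ α by linarith)).J F) = mulOp (memLp_top_velSym hα) F :=
  mulOp_mulOp _ _ _ (fun ξ => by
    rw [velSym, ← Complex.ofReal_mul, weight_mul]
    congr 2
    ring) F

theorem fourierL2_symm_J_J (hα : 1 < α) (F : L2) :
    fourierL2.symm ((freqScale (show 0 ≤ α by linarith)).J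
      ((freqScale (show 0 ≤ α by linarith)).J F)) = velocity hα F := by
  rw [J_J_eq hα]; rfl

end Estimates

/-! ### Cancellation in the convection term -/

section Cancellation

variable {α : ℝ}

/-- A distribution that vanishes on real test functions is represented by the zero function. -/
theorem ae_eq_zero_of_schwartz {f : Plane → ℝ} (hf : LocallyIntegrable f)
    (h : ∀ φ : 𝓢(Plane, ℂ), (∀ x, (φ x).im = 0) → ∫ x, (φ x).re * f x = 0) :
    ∀ᵐ x, f x = 0 := by
  refine ae_eq_zero_of_integral_contDiff_smul_eq_zero hf fun g hg hgc => ?_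
  have hg₁ : HasCompactSupport (Complex.ofRealCLM ∘ g) := hgc.comp_left rfl
  have hg₂ : ContDiff ℝ (⊤ : ℕ∞) (Complex.ofRealCLM ∘ g) := by fun_prop
  have h1 := h (hg₁.toSchwartzMap hg₂) (fun x => by simp)
  simpa using h1

theorem toDistr_apply_apply (f : L2) (φ : 𝓢(Plane, ℂ)) (i : Fin 2) :
    (f : Distr) φ i = ∫ x, φ x * f x i := by
  have hi : Integrable fun x => φ x • f x :=
    memLp_one_iff_integrable.1 ((Lp.memLp f).smul (r := 1) (φ.memLp 2))
  rw [Lp.toTemperedDistribution_apply]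
  exact ((EuclideanSpace.proj i : CVec →L[ℂ] ℂ).integral_comp_comm hi).symm

theorem integrable_schwartz_mul (f : L2) (φ : 𝓢(Plane, ℂ)) (i : Fin 2) :
    Integrable fun x => φ x * f x i := by
  have hi : Integrable fun x => φ x • f x :=
    memLp_one_iff_integrable.1 ((Lp.memLp f).smul (r := 1) (φ.memLp 2))
  exact (EuclideanSpace.proj i : CVec →L[ℂ] ℂ).integrable_comp hi

theorem memLp_apply (f : L2) (i : Fin 2) : MemLp (fun x => f x i) 2 volume :=
  (Lp.memLp f).continuousLinearMap_comp (EuclideanSpace.proj i : CVec →L[ℂ] ℂ)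

theorem im_eq_zero_of_isRealValued {f : L2} (hf : IsRealValued (f : Distr)) (i : Fin 2) :
    ∀ᵐ x, (f x i).im = 0 := by
  refine ae_eq_zero_of_schwartz (((memLp_apply f i).im).locallyIntegrable one_le_two)
    fun φ hφ => ?_
  have h1 := hf φ hφ i
  rw [toDistr_apply_apply] at h1
  have h2 := integral_im (integrable_schwartz_mul f φ i)
  simp only [RCLike.im_eq_complex_im] at h2
  rw [h1] at h2
  rw [← h2]
  refine integral_congr_ae (ae_of_all _ fun x => ?_)
  simp [Complex.mul_im, hφ x]

theorem sum_re_eq_zero_of_isDivFree {u : L2} {d : Fin 2 → L2} (hu : IsDivFree (u : Distr))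
    (hd : ∀ i, ∂_{(EuclideanSpace.single i (1 : ℝ) : Plane)} (u : Distr) = (d i : Distr)) :
    ∀ᵐ x, ∑ i : Fin 2, (d i x i).re = 0 := by
  refine ae_eq_zero_of_schwartz ?_ fun φ hφ => ?_
  · have h1 : MemLp (fun x => ∑ i : Fin 2, (d i x i).re) 2 volume :=
      memLp_finsetSum _ fun i _ => (memLp_apply (d i) i).re
    exact h1.locallyIntegrable one_le_two
  · have h1 := congrArg Complex.re (hu φ)
    simp only [hd, toDistr_apply_apply] at h1
    rw [← integral_finsetSum _ fun i _ => integrable_schwartz_mul (d i) φ i] at h1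
    have h2 := integral_re (integrable_finsetSum Finset.univ
      fun i _ => integrable_schwartz_mul (d i) φ i)
    simp only [RCLike.re_eq_complex_re] at h2
    rw [h1] at h2
    rw [← Complex.zero_re, ← h2]
    refine integral_congr_ae (ae_of_all _ fun x => ?_)
    simp only [Complex.re_sum, Complex.mul_re, hφ x, zero_mul, sub_zero, Finset.mul_sum]

theorem abs_re_symEval_le {g : Plane → ℂ} (hg : MemLp g 2 (volume : Measure Plane)) (F : L2)
    (i : Fin 2) (x : Plane) :
    ‖(symEval g F x i).re‖ ≤ (eLpNorm g 2 volume).toReal * ‖F‖ :=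
  (Complex.abs_re_le_norm _).trans ((PiLp.norm_apply_le _ i).trans (norm_symEval_le hg F x))

theorem continuous_re_symEval {g : Plane → ℂ} (hg : MemLp g 2 (volume : Measure Plane)) (F : L2)
    (i : Fin 2) : Continuous fun x => (symEval g F x i).re := by
  have := continuous_symEval hg F
  fun_prop

/-- The convection term `(u · ∇) v` is orthogonal to `v` if `u` is real and divergence-free: integrate
by parts in `½ ∫ uᵢ ∂ᵢ|v|²`. -/
theorem inner_transport_self (hα : 1 < α) {F G g : L2} (hg : g =ᵐ[volume] transport α F G)
    (hF : velocity hα F ∈ solenoidalL2) : ⟪g, velocity hα G⟫_ℝ = 0 := by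
  set u := symEval (velSym α) F with hu
  set v := symEval (velSym α) G with hv
  set d := fun i => symEval (gradSym α i) F with hd
  set e := fun i => symEval (gradSym α i) G with he
  have hF' : (velocity hα F : Distr) ∈ solenoidal := hF
  have hreal : ∀ᵐ x, ∀ i, (u x i).im = 0 := by
    rw [ae_all_iff]
    intro i
    filter_upwards [im_eq_zero_of_isRealValued hF'.1 i, velocity_ae_eq hα F] with x h1 h2
    rw [← h1, h2]
  have hdiv : ∀ᵐ x, ∑ i : Fin 2, (d i x i).re = 0 := by
    filter_upwards [sum_re_eq_zero_of_isDivFree hF'.2 (lineDeriv_velocity hα F),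
      velocityDeriv_ae_eq hα 0 F, velocityDeriv_ae_eq hα 1 F] with x h1 h2 h3
    rw [← h1, Fin.sum_univ_two, Fin.sum_univ_two, h2, h3]
  have hvv : Integrable fun x => ⟪v x, v x⟫_ℝ := by
    refine (L2.integrable_inner (𝕜 := ℝ) (velocity hα G) (velocity hα G)).congr ?_
    filter_upwards [velocity_ae_eq hα G] with x h
    rw [h]
  have hev : ∀ i, Integrable fun x => ⟪e i x, v x⟫_ℝ := fun i => by
    refine (L2.integrable_inner (𝕜 := ℝ) (velocityDeriv hα i G) (velocity hα G)).congr ?_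
    filter_upwards [velocity_ae_eq hα G, velocityDeriv_ae_eq hα i G] with x h h'
    rw [h, h']
  have hue : ∀ i, Integrable fun x => (u x i).re * ⟪e i x, v x⟫_ℝ := fun i =>
    (hev i).bdd_mul (continuous_re_symEval (memLp_velSym hα) F i).aestronglyMeasurable
      (ae_of_all _ (abs_re_symEval_le (memLp_velSym hα) F i))
  have huv : ∀ i, Integrable fun x => (u x i).re * ⟪v x, v x⟫_ℝ := fun i =>
    hvv.bdd_mul (continuous_re_symEval (memLp_velSym hα) F i).aestronglyMeasurable
      (ae_of_all _ (abs_re_symEval_le (memLp_velSym hα) F i))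
  have hdv : ∀ i, Integrable fun x => (d i x i).re * ⟪v x, v x⟫_ℝ := fun i =>
    hvv.bdd_mul (continuous_re_symEval (memLp_gradSym hα i) F i).aestronglyMeasurable
      (ae_of_all _ (abs_re_symEval_le (memLp_gradSym hα i) F i))
  have hparts : ∀ i, ∫ x, (u x i).re * (2 * ⟪e i x, v x⟫_ℝ)
      = - ∫ x, (d i x i).re * ⟪v x, v x⟫_ℝ := fun i => by
    refine integral_bilinear_hasLineDerivAt_right_eq_neg_left_of_integrable
      (B := ContinuousLinearMap.mul ℝ ℝ) (v := EuclideanSpace.single i (1 : ℝ)) (hdv i) ?_ (huv i)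
      (fun x _ => ?_) (fun x _ => ?_)
    · refine ((hue i).const_mul 2).congr (ae_of_all _ fun x => ?_)
      simp only [ContinuousLinearMap.mul_apply']
      ring
    · have h1 : HasDerivAt (fun t : ℝ => u (x + t • EuclideanSpace.single i (1 : ℝ))) (d i x) 0 :=
        hasLineDerivAt_symEval hα F i x
      exact (Complex.reCLM ∘L (EuclideanSpace.proj i : CVec →L[ℂ] ℂ).restrictScalars ℝ).hasFDerivAt
        |>.comp_hasDerivAt 0 h1
    · have h1 : HasDerivAt (fun t : ℝ => v (x + t • EuclideanSpace.single i (1 : ℝ))) (e i x) 0 :=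
        hasLineDerivAt_symEval hα G i x
      have h2 := h1.inner ℝ h1
      simp only [zero_smul, add_zero] at h2
      rw [real_inner_comm (e i x) (v x), ← two_mul] at h2
      exact h2
  have hsum : ⟪g, velocity hα G⟫_ℝ = ∑ i : Fin 2, ∫ x, (u x i).re * ⟪e i x, v x⟫_ℝ := by
    rw [L2.inner_def, ← integral_finsetSum _ fun i _ => hue i]
    refine integral_congr_ae ?_
    filter_upwards [hg, velocity_ae_eq hα G, hreal] with x h1 h2 h3
    rw [h1, h2, transport, sum_inner]
    refine Finset.sum_congr rfl fun i _ => ?_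
    have h4 : (u x i) = ((u x i).re : ℂ) := Complex.ext rfl (by simp [h3 i])
    change ⟪u x i • e i x, v x⟫_ℝ = _
    rw [h4, Complex.coe_smul, real_inner_smul_left, Complex.ofReal_re]
  have hzero : ∑ i : Fin 2, ∫ x, (d i x i).re * ⟪v x, v x⟫_ℝ = 0 := by
    rw [← integral_finsetSum _ fun i _ => hdv i]
    refine integral_eq_zero_of_ae ?_
    filter_upwards [hdiv] with x h
    rw [← Finset.sum_mul, h, zero_mul, Pi.zero_apply]
  have h2 : 2 * ⟪g, velocity hα G⟫_ℝ = 0 := by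
    rw [hsum, Finset.mul_sum, ← neg_eq_zero, ← hzero, ← Finset.sum_neg_distrib]
    refine Finset.sum_congr rfl fun i _ => ?_
    rw [← neg_eq_iff_eq_neg.2 (hparts i), neg_inj, ← integral_const_mul]
    refine integral_congr_ae (ae_of_all _ fun x => ?_)
    dsimp only
    ring
  simpa using h2

end Cancellation

/-! ### The convection term in weak norms -/

section Nonlinearity

variable {α : ℝ}

theorem eLpNorm_velocity (hα : 1 < α) (F : L2) :
    eLpNorm (symEval (velSym α) F) 2 volume = ‖velocity hα F‖ₑ := by
  rw [Lp.enorm_def, eLpNorm_congr_ae (velocity_ae_eq hα F)]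

theorem eLpNorm_velocityDeriv (hα : 1 < α) (i : Fin 2) (F : L2) :
    eLpNorm (symEval (gradSym α i) F) 2 volume = ‖velocityDeriv hα i F‖ₑ := by
  rw [Lp.enorm_def, eLpNorm_congr_ae (velocityDeriv_ae_eq hα i F)]

/-- The convection term in a weak norm: its gradient factor is bounded. -/
theorem abs_inner_transport_le (hα : 1 < α) {φ g F G : L2} (hg : g =ᵐ[volume] transport α F G) :
    |⟪φ, g⟫_ℝ| ≤ (∑ i : Fin 2, (eLpNorm (gradSym α i) 2 volume).toReal)
      * ‖velocity hα F‖ * ‖G‖ * ‖φ‖ := by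
  have h1 : ‖⟪φ, g⟫_ℝ‖ₑ ≤ ∑ i : Fin 2, ENNReal.ofReal ((eLpNorm (gradSym α i) 2 volume).toReal * ‖G‖
      * (‖φ‖ * ‖velocity hα F‖)) := by
    refine (enorm_inner_transport_le hα hg).trans (Finset.sum_le_sum fun i _ => ?_)
    have hu := (continuous_symEval (memLp_velSym hα) F)
    calc ∫⁻ x, ‖φ x‖ₑ * (‖symEval (velSym α) F x‖ₑ * ‖symEval (gradSym α i) G x‖ₑ)
        ≤ ∫⁻ x, ENNReal.ofReal ((eLpNorm (gradSym α i) 2 volume).toReal * ‖G‖)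
            * (‖φ x‖ₑ * ‖symEval (velSym α) F x‖ₑ) := by
          refine lintegral_mono fun x => ?_
          rw [← mul_assoc, mul_comm]
          gcongr
          rw [← ofReal_norm]
          exact ENNReal.ofReal_le_ofReal (norm_symEval_le (memLp_gradSym hα i) G x)
      _ ≤ ENNReal.ofReal ((eLpNorm (gradSym α i) 2 volume).toReal * ‖G‖)
            * (‖φ‖ₑ * ‖velocity hα F‖ₑ) := by
          rw [lintegral_const_mul' _ _ ENNReal.ofReal_ne_top, Lp.enorm_def φ, ← eLpNorm_velocity]
          gcongr
          exact lintegral_mul_enorm_le (Lp.aestronglyMeasurable φ) hu.aestronglyMeasurable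
      _ = _ := by
          rw [← ofReal_norm, ← ofReal_norm, ← ENNReal.ofReal_mul (by positivity),
            ← ENNReal.ofReal_mul (by positivity)]
  rw [← ENNReal.ofReal_sum_of_nonneg (fun i _ => by positivity), ← ofReal_norm,
    ENNReal.ofReal_le_ofReal_iff (Finset.sum_nonneg fun i _ => by positivity)] at h1
  refine h1.trans (le_of_eq ?_)
  rw [Finset.sum_mul, Finset.sum_mul, Finset.sum_mul]
  refine Finset.sum_congr rfl fun i _ => ?_
  ring

/-- Weakly null frequency data give fields that tend to zero pointwise and boundedly, hence in `L²`
against a square integrable weight. -/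
theorem tendsto_eLpNorm_mul_symEval {g : Plane → ℂ} (hg : MemLp g 2 (volume : Measure Plane)) (φ : L2)
    {x : ℕ → L2} {M : ℝ} (hx : WeakNull x) (hM : ∀ n, ‖x n‖ ≤ M) :
    Tendsto (fun n => eLpNorm (fun z => ‖φ z‖ * ‖symEval g (x n) z‖) 2 volume) atTop (𝓝 0) := by
  refine tendsto_eLpNorm_zero_of_dominated (b := fun z => ‖φ z‖ *
    ((eLpNorm g 2 volume).toReal * M)) (fun n => ?_) ((Lp.memLp φ).norm.mul_const _) (fun n => ?_) ?_
  · exact (Lp.aestronglyMeasurable φ).norm.mul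
      (continuous_symEval hg (x n)).norm.aestronglyMeasurable
  · refine ae_of_all _ fun z => ?_
    rw [norm_mul, norm_norm, norm_norm]
    gcongr
    refine (norm_symEval_le hg (x n) z).trans ?_
    gcongr
    exact hM n
  · refine ae_of_all _ fun z => ?_
    simpa using (tendsto_symEval hg hx z).norm.const_mul ‖φ z‖

theorem tendsto_inner_transport_left (hα : 1 < α) (φ : L2) {f x y : ℕ → L2} {M : ℝ}
    (hf : ∀ n, f n =ᵐ[volume] transport α (x n) (y n)) (hx : WeakNull x) (hxM : ∀ n, ‖x n‖ ≤ M)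
    (hyM : ∀ n, ‖y n‖ ≤ M) : Tendsto (fun n => ⟪φ, f n⟫_ℝ) atTop (𝓝 0) := by
  rw [tendsto_zero_iff_enorm_tendsto_zero]
  have hlim : Tendsto (fun n => ∑ _i : Fin 2,
      eLpNorm (fun z => ‖φ z‖ * ‖symEval (velSym α) (x n) z‖) 2 volume * ENNReal.ofReal M)
      atTop (𝓝 (∑ _i : Fin 2, 0 * ENNReal.ofReal M)) :=
    tendsto_finsetSum _ fun i _ => ENNReal.Tendsto.mul_const
      (tendsto_eLpNorm_mul_symEval (memLp_velSym hα) φ hx hxM) (Or.inr ENNReal.ofReal_ne_top)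
  simp only [zero_mul, Finset.sum_const_zero] at hlim
  refine tendsto_of_tendsto_of_tendsto_of_le_of_le tendsto_const_nhds hlim (fun _ => zero_le)
    fun n => ?_
  refine (enorm_inner_transport_le hα (hf n)).trans (Finset.sum_le_sum fun i _ => ?_)
  have h1 := lintegral_mul_enorm_le ((Lp.aestronglyMeasurable φ).norm.mul
    (continuous_symEval (memLp_velSym hα) (x n)).norm.aestronglyMeasurable)
    (continuous_symEval (memLp_gradSym hα i) (y n)).aestronglyMeasurable
  simp only [enorm_mul, enorm_norm, mul_assoc, Pi.mul_apply] at h1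
  refine h1.trans ?_
  rw [eLpNorm_velocityDeriv hα, ← ofReal_norm (velocityDeriv hα i (y n))]
  exact mul_le_mul_right (ENNReal.ofReal_le_ofReal ((norm_velocityDeriv_le hα i _).trans (hyM n))) _

theorem tendsto_inner_transport_right (hα : 1 < α) (φ : L2) {f x y : ℕ → L2} {M : ℝ}
    (hf : ∀ n, f n =ᵐ[volume] transport α (x n) (y n)) (hy : WeakNull y) (hxM : ∀ n, ‖x n‖ ≤ M)
    (hyM : ∀ n, ‖y n‖ ≤ M) : Tendsto (fun n => ⟪φ, f n⟫_ℝ) atTop (𝓝 0) := by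
  rw [tendsto_zero_iff_enorm_tendsto_zero]
  have hlim : Tendsto (fun n => ∑ i : Fin 2,
      eLpNorm (fun z => ‖φ z‖ * ‖symEval (gradSym α i) (y n) z‖) 2 volume * ENNReal.ofReal M)
      atTop (𝓝 (∑ _i : Fin 2, 0 * ENNReal.ofReal M)) :=
    tendsto_finsetSum _ fun i _ => ENNReal.Tendsto.mul_const
      (tendsto_eLpNorm_mul_symEval (memLp_gradSym hα i) φ hy hyM) (Or.inr ENNReal.ofReal_ne_top)
  simp only [zero_mul, Finset.sum_const_zero] at hlim
  refine tendsto_of_tendsto_of_tendsto_of_le_of_le tendsto_const_nhds hlim (fun _ => zero_le)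
    fun n => ?_
  refine (enorm_inner_transport_le hα (hf n)).trans (Finset.sum_le_sum fun i _ => ?_)
  have h1 := lintegral_mul_enorm_le ((Lp.aestronglyMeasurable φ).norm.mul
    (continuous_symEval (memLp_gradSym hα i) (y n)).norm.aestronglyMeasurable)
    (continuous_symEval (memLp_velSym hα) (x n)).aestronglyMeasurable
  simp only [enorm_mul, enorm_norm, mul_assoc, Pi.mul_apply] at h1
  simp only [mul_comm ‖symEval (velSym α) (x n) _‖ₑ]
  refine h1.trans ?_
  rw [eLpNorm_velocity hα, ← ofReal_norm (velocity hα (x n))]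
  exact mul_le_mul_right (ENNReal.ofReal_le_ofReal ((norm_velocity_le hα _).trans (hxM n))) _

/-- The convection term of the Navier-Stokes equations satisfies the hypotheses of the abstract
theory. -/
theorem exists_nonlinearity (hα : 1 < α) :
    ∃ N : (freqScale (show 0 ≤ α by linarith)).Nonlinearity, N.Q = lerayFourier ∧
      ∀ F G, ∃ f : L2, f =ᵐ[volume] transport α F G ∧
        fourierL2.symm ((freqScale (show 0 ≤ α by linarith)).J (N.B F G)) = leray f := by
  have hα0 : 0 ≤ α := by linarith
  obtain ⟨B, C, hC, hB, hBC⟩ := exists_transportOp hα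
  set S := freqScale (show 0 ≤ α by linarith) with hS
  have hQJ : ∀ F, lerayFourier (S.J F) = S.J (lerayFourier F) :=
    lerayFourier_weight (neg_nonpos.2 hα0)
  have hin : ∀ F G ψ, ⟪S.J (lerayFourier (B F G)), ψ⟫_ℝ
      = ⟪fourierL2.symm (lerayFourier ψ), fourierL2.symm (S.J (B F G))⟫_ℝ := fun F G ψ => by
    rw [fourierL2.symm.inner_map_map, ← hQJ, lerayFourier_symm, real_inner_comm]
  have hvJ : ∀ F, ‖velocity hα F‖ = ‖S.J (S.J F)‖ := fun F => by
    rw [← fourierL2_symm_J_J, fourierL2.symm.norm_map]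
  set c := ∑ i : Fin 2, (eLpNorm (gradSym α i) 2 volume).toReal with hc
  have hc0 : 0 ≤ c := Finset.sum_nonneg fun i _ => ENNReal.toReal_nonneg
  refine ⟨{
    Q := lerayFourier
    B := (ContinuousLinearMap.compL ℝ L2 L2 L2 lerayFourier) ∘L B
    C := C + c
    C_nonneg := by positivity
    Q_J := hQJ
    Q_B := fun F G => lerayFourier_idem _
    norm_B_le := fun F G => ?_
    cancel := fun F G hF hG => ?_
    low_le := fun F G H => ?_
    weakNull_left := fun x y M hx hxM hyM ψ => ?_
    weakNull_right := fun x y M hy hxM hyM ψ => ?_ }, rfl, fun F G => ⟨_, hB F G, ?_⟩⟩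
  · refine (norm_lerayFourier_le _).trans ((hBC F G).trans ?_)
    gcongr
    linarith
  · change ⟪S.J (lerayFourier (B F G)), S.J (S.J G)⟫_ℝ = 0
    rw [hin, hQJ, hQJ, hG, fourierL2_symm_J_J, real_inner_comm]
    refine inner_transport_self hα (hB F G) ?_
    rw [← fourierL2_symm_J_J, ← lerayFourier_eq_self_iff, hQJ, hQJ, hF]
  · change |⟪S.J (lerayFourier (B F G)), S.J (S.J H)⟫_ℝ| ≤ _
    rw [hin]
    refine (abs_inner_transport_le hα (hB F G)).trans ?_
    rw [hvJ, fourierL2.symm.norm_map]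
    gcongr
    · linarith
    · exact norm_lerayFourier_le _
  · change Tendsto (fun n => ⟪ψ, S.J (lerayFourier (B (x n) (y n)))⟫_ℝ) atTop (𝓝 0)
    simp only [real_inner_comm _ ψ, hin]
    exact tendsto_inner_transport_left hα _ (fun n => hB (x n) (y n)) hx hxM hyM
  · change Tendsto (fun n => ⟪ψ, S.J (lerayFourier (B (x n) (y n)))⟫_ℝ) atTop (𝓝 0)
    simp only [real_inner_comm _ ψ, hin]
    exact tendsto_inner_transport_right hα _ (fun n => hB (x n) (y n)) hy hxM hyM
  · change fourierL2.symm (S.J (lerayFourier (B F G))) = _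
    rw [← hQJ, lerayFourier_apply, fourierL2.symm_apply_apply]

end Nonlinearity

/-! ### Sobolev spaces on the Fourier side -/

section Transfer

/-- `u ↦ (1 + |x|²)^(s/2) 𝓕[u]` as an isometry of `H^s` into `L²`. -/
def rep (s : ℝ) : Sob s →ₗᵢ[ℝ] L2 := ⟨Sob.fourierRep, fun _ => rfl⟩

theorem weightedFourier_toDistr {s : ℝ} (u : Sob s) :
    weightedFourier s (u : Distr) = (rep s u : L2) := Sob.fourierRep_spec u

/-- The range of `rep s` does not depend on `s`: it consists of the Fourier transforms of the square
integrable divergence-free fields. -/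
theorem lerayFourier_rep {s : ℝ} (u : Sob s) : lerayFourier (rep s u) = rep s u := by
  rw [lerayFourier_eq_self_iff]
  change ((fourierL2.symm (rep s u) : L2) : Distr) ∈ solenoidal
  rw [fourierL2_symm_apply, ← Lp.fourierInv_toTemperedDistribution_eq, ← weightedFourier_toDistr]
  exact ⟨u.2.1.1.bessel s, u.2.1.2.bessel s⟩

theorem exists_rep_eq (s : ℝ) {F : L2} (hF : lerayFourier F = F) : ∃ u : Sob s, rep s u = F := by
  rw [lerayFourier_eq_self_iff] at hF
  have h : ((fourierL2.symm F : L2) : Distr) ∈ solenoidal := hF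
  have hw : weightedFourier s (bessel (-s) ((fourierL2.symm F : L2) : Distr)) = (F : Distr) := by
    rw [weightedFourier_bessel, neg_add_cancel, fourierL2_symm_apply,
      ← Lp.fourierInv_toTemperedDistribution_eq, weightedFourier]
    simp
  let u : Sob s := ⟨bessel (-s) ((fourierL2.symm F : L2) : Distr),
    ⟨h.1.bessel _, h.2.bessel _⟩, F, hw⟩
  exact ⟨u, toDistr_injective ((weightedFourier_toDistr u).symm.trans hw)⟩

theorem weightedFourier_toDistr_add {r c : ℝ} (hc : c ≤ 0) (u : Sob r) :
    weightedFourier (r + c) (u : Distr) = (mulOp (memLp_top_weight hc) (rep r u) : L2) := by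
  rw [toDistr_mulOp _ (weight_hasTemperateGrowth c), ← weightedFourier_toDistr, weightedFourier,
    weightedFourier, smulLeft_weight]

theorem toDistr_eq_toDistr_iff {r s c : ℝ} (hc : c ≤ 0) (hs : s = r + c) (u : Sob r) (v : Sob s) :
    (u : Distr) = (v : Distr) ↔ rep s v = mulOp (memLp_top_weight hc) (rep r u) := by
  subst hs
  rw [← toDistr_injective.eq_iff, ← weightedFourier_toDistr, ← weightedFourier_toDistr_add hc,
    (Sob.weightedFourier_injective _).eq_iff, eq_comm]

theorem rep_stokesPow {α r s : ℝ} (h : r = s + 2 * α) (u : Sob r) :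
    rep s (Sob.stokesPow α h u) = rep r u := by
  refine toDistr_injective ?_
  dsimp only
  rw [← weightedFourier_toDistr, ← weightedFourier_toDistr]
  subst h
  have h1 := weightedFourier_bessel s (2 * α) (u : Distr)
  rw [show 2 * α + s = s + 2 * α by ring] at h1
  exact h1

theorem rep_intervalIntegral {s : ℝ} {f : ℝ → Sob s} {t : ℝ} (ht : 0 ≤ t) :
    rep s (∫ r in (0 : ℝ)..t, f r) = ∫ r in (0 : ℝ)..t, rep s (f r) := by
  rw [intervalIntegral.integral_of_le ht, intervalIntegral.integral_of_le ht]
  exact ((rep s).integral_comp_comm f).symm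

theorem convection_ae_eq {α : ℝ} (hα : 1 < α) (u v : Sob (2 * α)) :
    convection u v =ᵐ[volume] transport α (rep _ u) (rep _ v) := by
  have h1 : l2Fun (u : Distr) = velocity hα (rep _ u) := by
    rw [toDistr_eq hα u]; exact l2Fun_toDistr _
  have h2 : ∀ i, l2Fun (∂_{(EuclideanSpace.single i (1 : ℝ) : Plane)} (v : Distr))
      = velocityDeriv hα i (rep _ v) := fun i => by
    rw [toDistr_eq hα v, lineDeriv_velocity]; exact l2Fun_toDistr _
  filter_upwards [velocity_ae_eq hα (rep _ u), velocityDeriv_ae_eq hα 0 (rep _ v),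
    velocityDeriv_ae_eq hα 1 (rep _ v)] with x h3 h4 h5
  simp only [convection, transport, h1, h2, Fin.sum_univ_two, h3, h4, h5]

variable {α : ℝ}

theorem toDistr_eq_bilinB_iff (hα : 1 < α) {u v : Sob (2 * α)} {b : Sob α} {g f : L2}
    (hf : f =ᵐ[volume] transport α (rep _ u) (rep _ v))
    (hg : fourierL2.symm ((freqScale (show 0 ≤ α by linarith)).J g) = leray f) :
    (b : Distr) = bilinB u v ↔ rep α b = g := by
  have h1 := hf.trans (convection_ae_eq hα u v).symm
  have h2 : MemLp (convection u v) 2 (volume : Measure Plane) := (memLp_congr_ae h1).1 (Lp.memLp f)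
  have h3 : h2.toLp = f := Lp.ext (h2.coeFn_toLp.trans h1.symm)
  have h4 : bilinB u v = (leray f : Distr) := by rw [bilinB, dif_pos h2, h3]
  have h5 : weightedFourier α (leray f : Distr) = (g : Distr) := by
    rw [← hg, fourierL2_symm_apply, ← Lp.fourierInv_toTemperedDistribution_eq, weightedFourier]
    have h6 := toDistr_mulOp (memLp_top_weight (neg_nonpos.2 (show 0 ≤ α by linarith)))
      (weight_hasTemperateGrowth (-α)) g
    change TemperedDistribution.smulLeftCLM CVec _ (𝓕 (𝓕⁻ ((mulOp (memLp_top_weight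
      (neg_nonpos.2 (show 0 ≤ α by linarith))) g : L2) : Distr))) = _
    rw [h6, fourier_fourierInv_eq, smulLeft_weight]
    simp
  rw [h4, ← (Sob.weightedFourier_injective α).eq_iff, h5, weightedFourier_toDistr,
    toDistr_injective.eq_iff]

/-- The integrated equation in `H^α`, on the Fourier side and one order lower. -/
theorem equation_iff (hα : 1 < α) (ν : ℝ) (v x : Sob (2 * α)) {w : ℝ → Sob (3 * α)} {b : ℝ → Sob α}
    {t : ℝ} (ht : 0 ≤ t) (hw : IntegrableOn w (Icc 0 t)) (hb : IntegrableOn b (Icc 0 t)) :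
    (v : Distr) + ((ν • ∫ s in (0 : ℝ)..t, Sob.stokesPow α (show 3 * α = α + 2 * α by ring) (w s) :
            Sob α) : Distr) + ((∫ s in (0 : ℝ)..t, b s : Sob α) : Distr) = (x : Distr) ↔
      (freqScale (show 0 ≤ α by linarith)).J ((freqScale (show 0 ≤ α by linarith)).J (rep _ v))
        + ν • (∫ s in (0 : ℝ)..t, (freqScale (show 0 ≤ α by linarith)).J (rep _ (w s)))
        + (∫ s in (0 : ℝ)..t, (freqScale (show 0 ≤ α by linarith)).J (rep _ (b s)))
      = (freqScale (show 0 ≤ α by linarith)).J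
          ((freqScale (show 0 ≤ α by linarith)).J (rep _ x)) := by
  set S := freqScale (show 0 ≤ α by linarith) with hS
  have hJ : ∀ u : Sob (2 * α), weightedFourier α (u : Distr) = (S.J (rep _ u) : L2) := fun u => by
    have h := weightedFourier_toDistr_add (neg_nonpos.2 (show 0 ≤ α by linarith)) u
    rw [show 2 * α + -α = α by ring] at h
    exact h
  have hint : ∀ {s : ℝ} {f : ℝ → Sob s}, IntegrableOn f (Icc 0 t) →
      IntervalIntegrable (fun r => rep s (f r)) volume 0 t := fun {s f} hf => by
    rw [intervalIntegrable_iff_integrableOn_Icc_of_le ht]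
    exact (rep s).toContinuousLinearMap.integrable_comp hf
  have hinj : Function.Injective S.J :=
    (injective_iff_map_eq_zero S.J).2 fun x => S.J_injective
  rw [← (Sob.weightedFourier_injective α).eq_iff, weightedFourier_add, weightedFourier_add, hJ, hJ,
    weightedFourier_toDistr, weightedFourier_toDistr, ← toDistr_add, ← toDistr_add,
    toDistr_injective.eq_iff, map_smul, rep_intervalIntegral ht, rep_intervalIntegral ht,
    ← hinj.eq_iff, map_add, map_add, map_smul]
  simp only [rep_stokesPow]
  rw [← ContinuousLinearMap.intervalIntegral_comp_comm _ (hint hw),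
    ← ContinuousLinearMap.intervalIntegral_comp_comm _ (hint hb)]

end Transfer

/-! ### Solutions in Sobolev spaces -/

section Solutions

variable {α ν : ℝ} {hα : 0 ≤ α}

/-- A continuous curve in `H^s`, on the Fourier side and extended by a constant to negative times. -/
def lift {s : ℝ} (v : C(ℝ≥0, Sob s)) (t : ℝ) : L2 := rep s (v t.toNNReal)

theorem continuous_lift {s : ℝ} (v : C(ℝ≥0, Sob s)) : Continuous (lift v) :=
  (rep s).continuous.comp (v.continuous.comp continuous_real_toNNReal)

theorem lerayFourier_lift {s : ℝ} (v : C(ℝ≥0, Sob s)) (t : ℝ) :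
    lerayFourier (lift v t) = lift v t := lerayFourier_rep _

theorem lift_coe {s : ℝ} (v : C(ℝ≥0, Sob s)) (t : ℝ≥0) : lift v t = rep s (v t) := by
  rw [lift, Real.toNNReal_coe]

theorem exists_lift_eq {s : ℝ} {U : ℝ → L2} (hU : Continuous U)
    (hQ : ∀ t, 0 ≤ t → lerayFourier (U t) = U t) :
    ∃ v : C(ℝ≥0, Sob s), ∀ t, 0 ≤ t → lift v t = U t := by
  choose v hv using fun t : ℝ≥0 => exists_rep_eq s (hQ t t.2)
  refine ⟨⟨v, ?_⟩, fun t ht => ?_⟩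
  · rw [(rep s).isometry.isEmbedding.continuous_iff]
    exact (hU.comp NNReal.continuous_coe).congr fun t => (hv t).symm
  · rw [lift]
    change rep s (v t.toNNReal) = _
    rw [hv, Real.coe_toNNReal t ht]

/-- `N.B F G` represents the projected convection term `Π (u · ∇) v` in `H^α`, where `F` and `G`
represent `u` and `v` in `H^{2α}`. -/
def IsConvection (N : (freqScale hα).Nonlinearity) : Prop :=
  ∀ F G, ∃ f : L2, f =ᵐ[volume] transport α F G ∧
    fourierL2.symm ((freqScale hα).J (N.B F G)) = leray f

variable {N : (freqScale hα).Nonlinearity}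

theorem isSol_of_isSolution (h1 : 1 < α)
    (hN : IsConvection N)
    {z v : C(ℝ≥0, Sob (2 * α))} {x : Sob (2 * α)} (h : IsSolution ν α z x v) (T : ℝ) :
    N.IsSol ν T (lift z) (lift v) (rep _ x) := by
  obtain ⟨w, b, hw, hwv, hb, hbi, heq⟩ := h
  intro t ht
  have hwi : IntegrableOn w (Icc 0 t) := (hw t).integrable one_le_two
  have h2 := (equation_iff h1 ν (v ⟨t, ht.1⟩) x ht.1 hwi (hbi t)).1 (heq ⟨t, ht.1⟩)
  have e1 : lift v t = rep _ (v ⟨t, ht.1⟩) := lift_coe v ⟨t, ht.1⟩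
  have e2 : ∫ s in (0 : ℝ)..t, (freqScale hα).J (rep _ (w s)) = ∫ s in (0 : ℝ)..t, lift v s := by
    rw [intervalIntegral.integral_of_le ht.1, intervalIntegral.integral_of_le ht.1]
    refine setIntegral_congr_ae measurableSet_Ioc ?_
    filter_upwards [(ae_restrict_iff' measurableSet_Ici).1 hwv] with s hs hst
    exact ((toDistr_eq_toDistr_iff (neg_nonpos.2 hα) (by ring) _ _).1 (hs hst.1.le)).symm
  have e3 : ∫ s in (0 : ℝ)..t, (freqScale hα).J (rep _ (b s))
      = ∫ s in (0 : ℝ)..t, (freqScale hα).J (N.B (lift v s + lift z s) (lift v s + lift z s)) := by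
    refine intervalIntegral.integral_congr fun s hs => ?_
    rw [uIcc_of_le ht.1] at hs
    obtain ⟨s, rfl⟩ : ∃ r : ℝ≥0, (r : ℝ) = s := ⟨⟨s, hs.1⟩, rfl⟩
    obtain ⟨f, hf, hg⟩ := hN (rep _ (v s + z s)) (rep _ (v s + z s))
    have h3 := (toDistr_eq_bilinB_iff h1 hf hg).1 (hb s)
    simp only [lift_coe, ← map_add, h3]
  rw [e1, ← e2, ← e3]
  exact h2

/-- A solution on the Fourier side is a solution: the square integrable curve in `H^{3α}` is provided by
maximal regularity. -/
theorem isSolution_of_isSol (hν : 0 < ν) (h1 : 1 < α) (hQ : N.Q = lerayFourier)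
    (hN : IsConvection N)
    {z v : C(ℝ≥0, Sob (2 * α))} {x : Sob (2 * α)}
    (h : ∀ T, N.IsSol ν T (lift z) (lift v) (rep _ x)) : IsSolution ν α z x v := by
  have hzc := continuous_lift z
  have hvc := continuous_lift v
  have hfc : Continuous fun s => N.B (lift v s + lift z s) (lift v s + lift z s) := by fun_prop
  choose b hb using fun s : ℝ => exists_rep_eq α
    (hQ ▸ N.Q_B (lift v s + lift z s) (lift v s + lift z s))
  have hbc : Continuous b := by
    rw [(rep α).isometry.isEmbedding.continuous_iff]
    exact hfc.congr fun s => (hb s).symm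
  -- `w` is the regular representative of `v` wherever there is one
  classical
  set w : ℝ → Sob (3 * α) := fun s =>
    if hs : ∃ u : Sob (3 * α), (u : Distr) = v s.toNNReal then hs.choose else 0 with hw
  have hreg : ∀ n : ℕ, MemLp w 2 (volume.restrict (Icc 0 (n : ℝ))) ∧
      ∀ᵐ s ∂(volume.restrict (Icc 0 (n : ℝ))), (w s : Distr) = v s.toNNReal := by
    intro n
    obtain ⟨W, hW, hWv⟩ := (h n).exists_regular hν n.cast_nonneg hvc hfc
    have hkey : ∀ᵐ s ∂(volume.restrict (Icc 0 (n : ℝ))),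
        (w s : Distr) = v s.toNNReal ∧ rep _ (w s) = W s := by
      filter_upwards [hWv] with s hs
      have hQW : lerayFourier (W s) = W s := by
        rw [← sub_eq_zero]
        refine (freqScale hα).J_injective ?_
        rw [map_sub, ← hQ, ← N.Q_J, hs, hQ, lerayFourier_lift, sub_self]
      obtain ⟨u, hu⟩ := exists_rep_eq (3 * α) hQW
      have hex : ∃ u : Sob (3 * α), (u : Distr) = v s.toNNReal :=
        ⟨u, (toDistr_eq_toDistr_iff (neg_nonpos.2 hα) (by ring) _ _).2 (by rw [hu]; exact hs.symm)⟩
      have hws : (w s : Distr) = v s.toNNReal := by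
        simp only [hw, dif_pos hex]
        exact hex.choose_spec
      refine ⟨hws, ?_⟩
      have h2 := (toDistr_eq_toDistr_iff (neg_nonpos.2 hα) (by ring) _ _).1 hws
      rw [← sub_eq_zero]
      refine (freqScale hα).J_injective ?_
      rw [map_sub, hs]
      exact sub_eq_zero.2 h2.symm
    refine ⟨?_, hkey.mono fun s hs => hs.1⟩
    have hWw : MemLp (fun s => rep _ (w s)) 2 (volume.restrict (Icc 0 (n : ℝ))) :=
      (memLp_congr_ae (hkey.mono fun s hs => hs.2)).2 hW
    refine ⟨(rep (3 * α)).isometry.isEmbedding.aestronglyMeasurable_comp_iff.1 hWw.1, ?_⟩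
    refine lt_of_le_of_lt (le_of_eq (eLpNorm_congr_norm_ae (ae_of_all _ fun s => ?_))) hWw.2
    exact ((rep _).norm_map _).symm
  have hwT : ∀ T : ℝ, MemLp w 2 (volume.restrict (Icc 0 T)) := fun T =>
    (hreg ⌈T⌉₊).1.mono_measure
      (Measure.restrict_mono (Icc_subset_Icc_right (Nat.le_ceil T)) le_rfl)
  have hwv : ∀ᵐ s ∂(volume.restrict (Ici (0 : ℝ))), (w s : Distr) = v s.toNNReal := by
    have hU : Ici (0 : ℝ) = ⋃ n : ℕ, Icc 0 (n : ℝ) := by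
      ext s
      simp only [mem_Ici, mem_iUnion, mem_Icc]
      exact ⟨fun hs => ⟨⌈s⌉₊, hs, Nat.le_ceil s⟩, fun ⟨n, hn⟩ => hn.1⟩
    rw [hU, ae_restrict_iUnion_iff]
    exact fun n => (hreg n).2
  refine ⟨w, b, hwT, hwv, fun s => ?_, fun T => hbc.continuousOn.integrableOn_Icc, fun t => ?_⟩
  · obtain ⟨f, hf, hg⟩ := hN (rep _ (v s + z s)) (rep _ (v s + z s))
    refine (toDistr_eq_bilinB_iff h1 hf hg).2 ?_
    rw [hb, lift_coe, lift_coe, ← map_add]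
  · have ht : 0 ≤ (t : ℝ) := t.2
    refine (equation_iff h1 ν (v t) x ht ((hwT t).integrable one_le_two)
      hbc.continuousOn.integrableOn_Icc).2 ?_
    have h2 := h t t ⟨ht, le_rfl⟩
    have e2 : ∫ s in (0 : ℝ)..t, (freqScale hα).J (rep _ (w s)) = ∫ s in (0 : ℝ)..t, lift v s := by
      rw [intervalIntegral.integral_of_le ht, intervalIntegral.integral_of_le ht]
      refine setIntegral_congr_ae measurableSet_Ioc ?_
      filter_upwards [(ae_restrict_iff' measurableSet_Ici).1 hwv] with s hs hst
      exact ((toDistr_eq_toDistr_iff (neg_nonpos.2 hα) (by ring) _ _).1 (hs hst.1.le)).symm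
    rw [lift_coe, ← e2] at h2
    simp only [hb]
    exact h2

theorem exists_isSolution (hν : 0 < ν) (h1 : 1 < α) (hQ : N.Q = lerayFourier)
    (hN : IsConvection N)
    (z : C(ℝ≥0, Sob (2 * α))) (x : Sob (2 * α)) : ∃ v, IsSolution ν α z x v := by
  have hzc := continuous_lift z
  have hQx : N.Q (rep _ x) = rep _ x := by rw [hQ, lerayFourier_rep]
  obtain ⟨U, hU, hUs⟩ := N.exists_global hν hzc (fun t => by rw [hQ, lerayFourier_lift]) hQx
  have hQU : ∀ t, 0 ≤ t → lerayFourier (U t) = U t := fun t ht => by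
    rw [← hQ]
    exact N.Q_eq_self hν (hUs t) hU (by fun_prop) (fun _ => N.Q_B _ _) hQx t ⟨ht, le_rfl⟩
  obtain ⟨v, hv⟩ := exists_lift_eq (s := 2 * α) hU hQU
  refine ⟨v, isSolution_of_isSol hν h1 hQ hN fun T => ?_⟩
  exact (hUs T).congr (fun t ht => hv t ht.1) fun t ht => by rw [hv t ht.1]

theorem IsSolution.eq (hν : 0 < ν) (h1 : 1 < α)
    (hN : IsConvection N)
    {z v v' : C(ℝ≥0, Sob (2 * α))} {x : Sob (2 * α)} (h : IsSolution ν α z x v)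
    (h' : IsSolution ν α z x v') : v = v' := by
  ext1 t
  refine (rep _).injective ?_
  rw [← lift_coe, ← lift_coe]
  exact (isSol_of_isSolution h1 hN h t).unique hν (isSol_of_isSolution h1 hN h' t)
    (continuous_lift v) (continuous_lift v') (continuous_lift z) t ⟨t.2, le_rfl⟩

theorem isSolution_solutionMap (hν : 0 < ν) (h1 : 1 < α) (z : C(ℝ≥0, Sob (2 * α)))
    (x : Sob (2 * α)) : IsSolution ν α z x (solutionMap ν α x z) := by
  obtain ⟨N, hQ, hN⟩ := exists_nonlinearity h1
  have h := exists_isSolution hν h1 hQ hN z x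
  rw [solutionMap, dif_pos h]
  exact h.choose_spec

end Solutions

/-! ### Weak convergence in Sobolev spaces -/

section WeakConvergence

theorem weakNull_rep_sub {s : ℝ} {xs : ℕ → Sob s} {x : Sob s}
    (h : Tendsto (fun n => toWeakSpace ℝ (Sob s) (xs n)) atTop (𝓝 (toWeakSpace ℝ (Sob s) x))) :
    WeakNull fun n => rep s (xs n) - rep s x := by
  intro y
  have hc := WeakBilin.eval_continuous (topDualPairing ℝ (Sob s)).flip
    ((innerSL ℝ y) ∘L (rep s).toContinuousLinearMap)
  have h1 : Tendsto (fun n => ⟪y, rep s (xs n)⟫_ℝ) atTop (𝓝 ⟪y, rep s x⟫_ℝ) :=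
    (hc.tendsto (toWeakSpace ℝ (Sob s) x)).comp h
  simpa [inner_sub_right] using h1.sub_const ⟪y, rep s x⟫_ℝ

/-- Weakly convergent sequences are bounded. -/
theorem WeakNull.exists_norm_le {X : Type*} [NormedAddCommGroup X] [InnerProductSpace ℝ X]
    [CompleteSpace X] {x : ℕ → X} (h : WeakNull x) : ∃ R, ∀ n, ‖x n‖ ≤ R := by
  obtain ⟨R, hR⟩ := banach_steinhaus (g := fun n => innerSL ℝ (x n)) fun y => by
    obtain ⟨C, hC⟩ := (h y).norm.bddAbove_range
    refine ⟨C, fun n => ?_⟩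
    rw [innerSL_apply_apply, real_inner_comm]
    exact hC ⟨n, rfl⟩
  exact ⟨R, fun n => by simpa using hR n⟩

/-- Continuous functionals on `H^s` are inner products on the Fourier side. -/
theorem exists_inner_rep {s : ℝ} (ℓ : StrongDual ℝ (Sob s)) : ∃ y : L2, ∀ u, ℓ u = ⟪y, rep s u⟫_ℝ := by
  set e := (rep s).equivRange with he
  obtain ⟨g, hg, -⟩ := exists_extension_norm_eq (LinearMap.range (rep s).toLinearMap)
    (ℓ ∘L (e.symm.toContinuousLinearEquiv : _ →L[ℝ] Sob s))
  refine ⟨(toDual ℝ L2).symm g, fun u => ?_⟩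
  rw [toDual_symm_apply]
  have h1 := hg (e u)
  have h2 : ((e u : LinearMap.range (rep s).toLinearMap) : L2) = rep s u := rfl
  rw [h2] at h1
  rw [h1]
  simp

/-- The solution map for data in `H^{2α}` is continuous from weak convergence of sequences to
convergence, uniform on `[0, T]`, of the inner products with a fixed element. -/
theorem eventually_inner_solutionMap_le {ν α : ℝ} (hν : 0 < ν) (hα : 1 < α)
    (z : C(ℝ≥0, Sob (2 * α))) {x : Sob (2 * α)} {xs : ℕ → Sob (2 * α)}
    (h : Tendsto (fun n => toWeakSpace ℝ (Sob (2 * α)) (xs n)) atTop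
      (𝓝 (toWeakSpace ℝ (Sob (2 * α)) x))) (T : ℝ≥0) (y : L2) {ε : ℝ} (hε : 0 < ε) :
    ∀ᶠ n in atTop, ∀ t ∈ Icc 0 T,
      |⟪y, rep _ (solutionMap ν α (xs n) z t - solutionMap ν α x z t)⟫_ℝ| ≤ ε := by
  obtain ⟨N, hQ, hN⟩ := exists_nonlinearity hα
  have hsol := isSolution_solutionMap hν hα z
  have hw := weakNull_rep_sub h
  obtain ⟨R, hR⟩ := hw.exists_norm_le
  have hR' : ∀ n, ‖rep _ (xs n)‖ ≤ R + ‖rep _ x‖ := fun n => by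
    have h1 := norm_add_le (rep _ (xs n) - rep _ x) (rep _ x)
    rw [sub_add_cancel] at h1
    linarith [hR n]
  have hev := N.eventually_inner_sub_le hν T.2 (continuous_lift z)
    (fun t => by rw [hQ, lerayFourier_lift]) (fun n => continuous_lift _) (continuous_lift _)
    (fun n => isSol_of_isSolution hα hN (hsol (xs n)) T) (isSol_of_isSolution hα hN (hsol x) T)
    (fun n => by rw [hQ, lerayFourier_rep]) hR' hw y hε
  filter_upwards [hev] with n hn t ht
  have h1 := hn t ⟨t.2, ht.2⟩
  rwa [lift_coe, lift_coe, ← map_sub] at h1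

/-- Uniform convergence on `[0, T]` against every continuous functional is convergence in
`C([0, T]; H^s_w)`. -/
theorem tendsto_restrictWeak {s : ℝ} {T : ℝ≥0} {v : ℕ → C(ℝ≥0, Sob s)} {v' : C(ℝ≥0, Sob s)}
    (h : ∀ (y : L2) (ε : ℝ), 0 < ε → ∀ᶠ n in atTop, ∀ t ∈ Icc 0 T,
      |⟪y, rep s (v n t - v' t)⟫_ℝ| ≤ ε) :
    Tendsto (fun n => restrictWeak T (v n)) atTop (𝓝 (restrictWeak T v')) := by
  have hunif : Tendsto (fun p : ℕ × Icc (0 : ℝ≥0) T =>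
      toWeakSpace ℝ (Sob s) (v p.1 p.2 - v' p.2)) (atTop ×ˢ ⊤) (𝓝 0) := by
    have hinj : Function.Injective (topDualPairing ℝ (Sob s)).flip := fun u u' huu =>
      (rep s).injective (ext_inner_left ℝ fun y =>
        DFunLike.congr_fun huu ((innerSL ℝ y) ∘L (rep s).toContinuousLinearMap))
    refine (WeakBilin.tendsto_iff_forall_eval_tendsto (topDualPairing ℝ (Sob s)).flip hinj).2
      fun ℓ => ?_
    obtain ⟨y, hy⟩ := exists_inner_rep ℓ
    rw [Metric.tendsto_nhds]
    intro ε hε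
    rw [← principal_univ, eventually_prod_principal_iff]
    filter_upwards [h y (ε / 2) (half_pos hε)] with n hn t _
    have h1 := hn t t.2
    rw [← hy] at h1
    have h2 : dist (ℓ (v n t - v' t)) (ℓ 0) < ε := by
      rw [map_zero, Real.dist_0_eq_abs]
      linarith
    exact h2
  -- a neighbourhood of the compact image of `v'` contains a uniform one
  rw [ContinuousMap.tendsto_nhds_compactOpen]
  intro K hK U hU hKU
  obtain ⟨V, hV, hVU⟩ := compact_open_separated_add_right
    (hK.image (restrictWeak T v').continuous) hU hKU.image_subset
  have h1 := hunif.eventually hV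
  rw [← principal_univ, eventually_prod_principal_iff] at h1
  filter_upwards [h1] with n hn t ht
  have h2 := hVU (Set.add_mem_add (mem_image_of_mem _ ht) (hn t (mem_univ t)))
  have h3 : restrictWeak T v' t + toWeakSpace ℝ (Sob s) (v n t - v' t) = restrictWeak T (v n) t := by
    change toWeakSpace ℝ (Sob s) (v' t) + toWeakSpace ℝ (Sob s) (v n t - v' t)
      = toWeakSpace ℝ (Sob s) (v n t)
    rw [← map_add, add_sub_cancel]
  rwa [h3] at h2

end WeakConvergence

end HyperNS

end

open HyperNS in
/-- For fixed `z`, the solution map `x ↦ 𝒱(x, z)` is well defined on `H^{2α}` and sequentially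
continuous from `H^{2α}_w` to `C([0, T]; H^{2α}_w)`. -/
theorem mainTheorem9 (ν α : ℝ) (hν : 0 < ν) (hα : 1 < α) (z : C(ℝ≥0, Sob (2 * α))) :
    (∀ x : Sob (2 * α), IsSolution ν α z x (solutionMap ν α x z) ∧
      ∀ v : C(ℝ≥0, Sob (2 * α)), IsSolution ν α z x v → v = solutionMap ν α x z) ∧
    (∀ T : ℝ≥0, 0 < T →
      SeqContinuous (fun x : WeakSpace ℝ (Sob (2 * α)) =>
        restrictWeak T (solutionMap ν α ((toWeakSpace ℝ (Sob (2 * α))).symm x) z))) ∧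
    (∀ (x : Sob (2 * α)) (xs : ℕ → Sob (2 * α)),
      Tendsto (fun n => toWeakSpace ℝ (Sob (2 * α)) (xs n)) atTop
        (𝓝 (toWeakSpace ℝ (Sob (2 * α)) x)) →
      ∀ T : ℝ≥0, 0 < T → ∀ y : Sob (-(2 * α)),
        Tendsto (fun n => ⨆ t ∈ Set.Icc (0 : ℝ≥0) T,
          ‖Sob.pairing y (solutionMap ν α (xs n) z t - solutionMap ν α x z t)‖ₑ) atTop (𝓝 0)) := by
  refine ⟨fun x => ?_, fun T _ xs x hx => ?_, fun x xs hx T _ y => ?_⟩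
  · obtain ⟨N, -, hN⟩ := exists_nonlinearity hα
    have h1 := isSolution_solutionMap hν hα z x
    exact ⟨h1, fun v hv => hv.eq hν hα hN h1⟩
  · exact tendsto_restrictWeak fun y ε hε =>
      eventually_inner_solutionMap_le (x := (toWeakSpace ℝ (Sob (2 * α))).symm x)
        (xs := fun n => (toWeakSpace ℝ (Sob (2 * α))).symm (xs n)) hν hα z hx T y hε
  · rw [ENNReal.tendsto_nhds_zero]
    intro ε hε
    obtain ⟨δ, hδ, hδε⟩ : ∃ δ : ℝ, 0 < δ ∧ ENNReal.ofReal δ ≤ ε := by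
      obtain ⟨δ, -, h1, h2⟩ := ENNReal.lt_iff_exists_real_btwn.1 hε
      exact ⟨δ, by simpa using h1, h2.le⟩
    filter_upwards [eventually_inner_solutionMap_le hν hα z hx T (rep _ y) hδ] with n hn
    refine iSup₂_le fun t ht => le_trans ?_ hδε
    rw [← ofReal_norm]
    refine ENNReal.ofReal_le_ofReal ?_
    rw [Sob.pairing, ← l2_inner_eq]
    exact hn t ht
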